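/- **Theorem.** Let $V$ be a finite set of variables. A *DBN-template* on $V$ is a triple $(V,\mathcal E^0,\mathcal E^{\mathsf{step}})$ with edge sets $\mathcal E^0\subseteq V\times V$ and $\mathcal E^{\mathsf{step}}\subseteq (V\cup V')\times V'$ (where $V'$ is a disjoint copy of $V$), both acyclic. It is *restricted* if $(X,Y)\in\mathcal E^0$ implies $(X',Y')\in\mathcal E^{\mathsf{step}}$. Its unfolding up to time $t$ is the directed acyclic graph on the copies $X^i$ ($X\in V$, $0\le i\le t$) with the edges $X^0\to Y^0$ for $(X,Y)\in\mathcal E^0$, and, for $1\le i\le t$, $X^i\to Y^i$ for $(X',Y')\in\mathcal E^{\mathsf{step}}$ and $X^{i-1}\to Y^i$ for $(X,Y')\in\mathcal E^{\mathsf{step}}$. A *structural CI proposition* $(\mathbf X \perp\!\!\!\perp \mathbf Y\mid\mathbf Z)$, with $\mathbf X,\mathbf Y,\mathbf Z\subseteq V$ pairwise disjoint, holds at time $t$ if $\mathbf Z^t$ d-separates $\mathbf X^t$ and $\mathbf Y^t$ in the unfolding up to time $t$. For a set $A$ of such propositions, the *trace* of the template is the infinite word $\tau\in(2^A)^\omega$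 whose letter $\tau(t)$ is the set of propositions in $A$ that hold at time $t$. 1. The following problem can be solved in polynomial time: given a restricted DBN-template and an LTL formula $\varphi$ (built with $\neg$, $\wedge$, next and until) over structural CI propositions on its variables, decide whether its trace satisfies $\varphi$. 2. The following problem can be solved in polynomial time: given a restricted DBN-template, a finite set $A$ of structural CI propositions on its variables, and a nondeterministic Büchi automaton $\mathcal A$ over the alphabet $2^A$, decide whether $\mathcal A$ accepts the trace $\tau\in(2^A)^\omega$ of the template. 3. The trace of a restricted DBN-template on the variables $V$, with respect to any set $A$ of structural CI propositions, is constant from time $|V|^2$ on: $\tau(t)=\tau(|V|^2)$ for all $t\ge|V|^2$. Polynomial time means: by a deterministic multi-tape Turing machine, with the number of steps bounded by a polynomial in the length of the encoding of the instance. Templates are encoded by $|V|$ in unary and by adjacency matrices; formulae by their written-out text; automata by the lists of the elements of $A$, of their states and of their transitions, where a letter is written as an $|A|$-bit vector. -/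

import Mathlib

/-! ### Directed acyclic graphs and d-separation -/

/-- A directed graph, given by its edge relation, without directed cycles. -/
def IsDAG {N : Type*} (r : N → N → Prop) : Prop :=
  ∀ v, ¬ Relation.TransGen r v v

/-- `W 0, …, W k` is a d-path from `X` to `Y` with respect to `Z` in the graph `r`
(the values of `W` beyond `k` play no role). -/
structure IsDPath {N : Type*} (r : N → N → Prop) (X Y Z : Set N) (k : ℕ) (W : ℕ → N) : Prop where
  start_mem : W 0 ∈ X
  end_mem : W k ∈ Y
  adj : ∀ i < k, r (W i) (W (i + 1)) ∨ r (W (i + 1)) (W i)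
  noncollider : ∀ i, i + 1 < k →
    (r (W (i + 1)) (W i) ∨ r (W (i + 1)) (W (i + 2))) → W (i + 1) ∉ Z
  collider : ∀ i, i + 1 < k →
    (r (W i) (W (i + 1)) ∧ r (W (i + 2)) (W (i + 1))) →
      ∃ d ∈ Z, Relation.ReflTransGen r (W (i + 1)) d

/-- `Z` d-separates `X` and `Y`: there is no d-path from `X` to `Y` with respect to `Z`. -/
def DSep {N : Type*} (r : N → N → Prop) (X Y Z : Set N) : Prop :=
  ¬ ∃ (k : ℕ) (W : ℕ → N), IsDPath r X Y Z k W

/-! ### Templates of dynamic Bayesian networks -/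

/-- The edge relation on `V ∪ V'` of a step template; `Sum.inl x` stands for the variable `x` and
`Sum.inr x` for its primed copy. All edges lead into primed variables. -/
def stepRel {V : Type*} (E : Finset ((V ⊕ V) × V)) (a b : V ⊕ V) : Prop :=
  ∃ y : V, b = Sum.inr y ∧ (a, y) ∈ E

/-- A DBN-template on the variables `V`: an initial template `E0 ⊆ V × V` and a step template
`Estep ⊆ (V ∪ V') × V'`, both acyclic. -/
structure DBNTemplate (V : Type*) where
  E0 : Finset (V × V)
  Estep : Finset ((V ⊕ V) × V)
  dag_E0 : IsDAG (fun x y => (x, y) ∈ E0)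
  dag_Estep : IsDAG (stepRel Estep)

/-- A structural conditional independence proposition `(X ⫫ Y ∣ Z)`, for pairwise disjoint sets
of variables. -/
structure CIProp (V : Type*) where
  X : Finset V
  Y : Finset V
  Z : Finset V
  disjoint_XY : Disjoint X Y
  disjoint_XZ : Disjoint X Z
  disjoint_YZ : Disjoint Y Z

namespace DBNTemplate

variable {V : Type*}

/-- Every initial edge also occurs as an edge between primed variables of the step template. -/
def IsRestricted (T : DBNTemplate V) : Prop :=
  ∀ x y, (x, y) ∈ T.E0 → (Sum.inr x, y) ∈ T.Estep

/-- The edge relation of the unfolding of the template up to time `t`; the node `(x, i)` is the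
copy of the variable `x` in time slice `i`, for `i = 0, …, t`. -/
def unfolding (T : DBNTemplate V) (t : ℕ) (a b : V × Fin (t + 1)) : Prop :=
  (a.2.val = 0 ∧ b.2.val = 0 ∧ (a.1, b.1) ∈ T.E0) ∨
  (1 ≤ b.2.val ∧ a.2.val = b.2.val ∧ (Sum.inr a.1, b.1) ∈ T.Estep) ∨
  (a.2.val + 1 = b.2.val ∧ (Sum.inl a.1, b.1) ∈ T.Estep)

/-- The copies in time slice `t` of the variables in `S`, in the unfolding up to time `t`. -/
def lastSlice (t : ℕ) (S : Finset V) : Set (V × Fin (t + 1)) :=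
  {a | a.1 ∈ S ∧ a.2 = Fin.last t}

/-- The proposition `p` holds at time `t`. -/
def HoldsAt (T : DBNTemplate V) (t : ℕ) (p : CIProp V) : Prop :=
  DSep (T.unfolding t) (lastSlice t p.X) (lastSlice t p.Y) (lastSlice t p.Z)

/-- The trace with respect to a set `A` of propositions: the infinite word over `2^A` whose letter
at position `t` consists of the propositions in `A` that hold at time `t`. -/
def trace (T : DBNTemplate V) (A : Set (CIProp V)) (t : ℕ) : Set (CIProp V) :=
  {p | p ∈ A ∧ T.HoldsAt t p}

end DBNTemplate

/-! ### Specification formalisms -/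

/-- Formulae of linear temporal logic with atomic propositions in `α`. -/
inductive LTLFormula (α : Type*) where
  | atom (a : α) : LTLFormula α
  | neg (f : LTLFormula α) : LTLFormula α
  | conj (f g : LTLFormula α) : LTLFormula α
  | next (f : LTLFormula α) : LTLFormula α
  | untl (f g : LTLFormula α) : LTLFormula α

/-- `f.Sat w`: the infinite word `w` satisfies the formula `f`. -/
def LTLFormula.Sat {α : Type*} : LTLFormula α → (ℕ → Set α) → Prop
  | .atom a, w => a ∈ w 0
  | .neg f, w => ¬ f.Sat w
  | .conj f g, w => f.Sat w ∧ g.Sat w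
  | .next f, w => f.Sat (fun i => w (1 + i))
  | .untl f g, w =>
      ∃ t, g.Sat (fun i => w (t + i)) ∧ ∀ s < t, f.Sat (fun i => w (s + i))

/-- A nondeterministic Büchi automaton with states `Q` and alphabet `S`. -/
structure NBA (S Q : Type*) where
  Δ : Set (Q × S × Q)
  initial : Set Q
  accepting : Set Q

/-- The automaton has an accepting run on the infinite word `w`. -/
def NBA.Accepts {S Q : Type*} (B : NBA S Q) (w : ℕ → S) : Prop :=
  ∃ ρ : ℕ → Q, ρ 0 ∈ B.initial ∧ (∀ i, (ρ i, w i, ρ (i + 1)) ∈ B.Δ) ∧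
    {j | ρ j ∈ B.accepting}.Infinite

/-! ### Instances of the model-checking problems -/

/-- An instance of structural LTL model checking of restricted DBN-templates. -/
structure LTLInstance where
  n : ℕ
  template : DBNTemplate (Fin n)
  restricted : template.IsRestricted
  formula : LTLFormula (CIProp (Fin n))

/-- The trace of the template satisfies the formula. -/
def LTLInstance.Yes (I : LTLInstance) : Prop :=
  I.formula.Sat (I.template.trace Set.univ)

/-- An instance of structural NBA model checking of restricted DBN-templates. The finite set `A` of
propositions is given by the list `props`, the automaton has the states `0, …, q - 1`, and the list
`trans` consists of its transitions; a letter, i.e. a subset of `A`, is given by the set of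
positions in `props` of its elements. -/
structure NBAInstance where
  n : ℕ
  template : DBNTemplate (Fin n)
  restricted : template.IsRestricted
  props : List (CIProp (Fin n))
  props_nodup : props.Nodup
  q : ℕ
  initial : Finset (Fin q)
  accepting : Finset (Fin q)
  trans : List (Fin q × Finset (Fin props.length) × Fin q)

namespace NBAInstance

/-- The set `A` of propositions. -/
def propSet (I : NBAInstance) : Set (CIProp (Fin I.n)) :=
  {p | p ∈ I.props}

/-- The subset of `A` given by a set of positions. -/
def letter (I : NBAInstance) (s : Finset (Fin I.props.length)) : Set (CIProp (Fin I.n)) :=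
  {p | ∃ i ∈ s, I.props.get i = p}

/-- The automaton of the instance. -/
def automaton (I : NBAInstance) : NBA (Set (CIProp (Fin I.n))) (Fin I.q) where
  Δ := {d | ∃ e ∈ I.trans, d = (e.1, I.letter e.2.1, e.2.2)}
  initial := {s | s ∈ I.initial}
  accepting := {s | s ∈ I.accepting}

/-- The automaton accepts the trace of the template. -/
def Yes (I : NBAInstance) : Prop :=
  I.automaton.Accepts (I.template.trace I.propSet)

end NBAInstance

/-! ### Encoding of instances as words -/

/-- The input alphabet. -/
inductive Token where
  | bit (b : Bool)
  | sep
  | item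
  | neg
  | conj
  | next
  | untl
  deriving DecidableEq, Fintype

/-- A number below some bound, written in unary. -/
def encodeIndex {k : ℕ} (i : Fin k) : List Token :=
  List.replicate i.val Token.item ++ [Token.sep]

/-- A subset of `{0, …, k - 1}`, written as `k` bits. -/
def encodeSubset {k : ℕ} (s : Finset (Fin k)) : List Token :=
  List.ofFn fun i => Token.bit (decide (i ∈ s))

/-- A template on `n` variables: the number `n` in unary, then the adjacency matrices of the initial
edges, of the edges from `V` to `V'`, and of the edges from `V'` to `V'`, row by row. -/
def encodeTemplate {n : ℕ} (T : DBNTemplate (Fin n)) : List Token :=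
  List.replicate n Token.item ++ [Token.sep] ++
  (List.finRange n).flatMap
    (fun x => List.ofFn fun y => Token.bit (decide ((x, y) ∈ T.E0))) ++
  (List.finRange n).flatMap
    (fun x => List.ofFn fun y => Token.bit (decide ((Sum.inl x, y) ∈ T.Estep))) ++
  (List.finRange n).flatMap
    (fun x => List.ofFn fun y => Token.bit (decide ((Sum.inr x, y) ∈ T.Estep)))

/-- A proposition `(X ⫫ Y ∣ Z)`: the three subsets, one after the other. -/
def encodeCIProp {n : ℕ} (p : CIProp (Fin n)) : List Token :=
  encodeSubset p.X ++ encodeSubset p.Y ++ encodeSubset p.Z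

/-- A formula, in postfix notation, with each atomic proposition written out. -/
def encodeFormula {n : ℕ} : LTLFormula (CIProp (Fin n)) → List Token
  | .atom p => Token.item :: encodeCIProp p
  | .neg f => encodeFormula f ++ [Token.neg]
  | .conj f g => encodeFormula f ++ encodeFormula g ++ [Token.conj]
  | .next f => encodeFormula f ++ [Token.next]
  | .untl f g => encodeFormula f ++ encodeFormula g ++ [Token.untl]

/-- The template, followed by the formula. -/
def LTLInstance.encode (I : LTLInstance) : List Token :=
  encodeTemplate I.template ++ encodeFormula I.formula

/-- The template, followed by the list of propositions, the list of states (each with two bits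
telling whether it is initial and whether it is accepting) and the list of transitions. -/
def NBAInstance.encode (I : NBAInstance) : List Token :=
  encodeTemplate I.template ++
  I.props.flatMap (fun p => Token.item :: encodeCIProp p) ++ [Token.sep] ++
  (List.finRange I.q).flatMap (fun s =>
    [Token.item, Token.bit (decide (s ∈ I.initial)), Token.bit (decide (s ∈ I.accepting))]) ++
  [Token.sep] ++
  I.trans.flatMap (fun d =>
    Token.item :: (encodeIndex d.1 ++ encodeSubset d.2.1 ++ encodeIndex d.2.2))

/-! ### Polynomial time -/

open Classical in
/-- The problem `P`, on instances encoded by `enc`, is decided by a Turing machine in time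
polynomial in the length of the encoding. -/
def PolyTimeDecidable {α Γ : Type} (enc : α → List Γ) (P : α → Prop) : Prop :=
  Nonempty (Turing.TM2ComputableInPolyTime enc Computability.encodeBool
    (fun a => decide (P a)))

/-!
Why the theorem holds.

*Reduction of d-separation to the last slice.* In an acyclic graph, `X` and `Y` are d-connected
given `Z` if and only if they are joined by a chain of treks (pairs of directed paths from a common source
that avoid `Z` in their interiors) in which consecutive treks meet in `Z`
(`DSeparation.dSep_iff`): a d-connecting path is cut at its colliders, each of which is followed
down to its first descendant in `Z`. In an unfolding, with `Z` in the last slice, all nodes of the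
chain lie in the last slice, and a trek between two such nodes either stays in this slice or enters
it by two edges from nodes of the previous slice that have a common ancestor
(`DBNTemplate.trek_iff`). Hence the propositions that hold at time `t + 1` depend only on the
relation `coAnc t` of having a common ancestor at time `t` (`DBNTemplate.holdsAt_iff`), and
`coAnc (t + 1)` is obtained from `coAnc t` by an operator independent of `t`.

*Stabilization.* For a restricted template `coAnc` grows with `t` (`DBNTemplate.coAnc_mono`). A
growing sequence of subsets of `V × V` that is generated by one operator, and whose first member is
not empty, is constant after at most `|V| ^ 2 - 1` steps; so the trace is constant from time
`|V| ^ 2` on (`DBNTemplate.trace_eq_of_le`).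

*Polynomial time.* The decision procedures are written in a small language (`Cmd`, `Form`): nested
loops over the numbers below the input length, which insert tuples into a database, with tests given
by first-order formulae with bounded quantifiers. The running time of such a program is polynomial
whatever the program does. A command becomes a structured stack program and this a Turing machine
with several stacks (`StackProg.polyTimeDecidable`, `polyTimeDecidable_of_cmd`), so that only the
correctness of the procedures remains to be shown. A relation that is specified by recursion on its
first argument is computed by looping over its tuples in lexicographic order (`Cmd.eval_define`);
this covers reachability (`Cmd.eval_closure`), the trek relations and thereby the propositions that
hold at each time below the input length (`Cmd.eval_separation`).

*The specifications.* The encoding of a template with `n` variables has `3 * n ^ 2 + n + 1` letters.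
Therefore the last position `N - 1` of the input word is at least `n ^ 2`, and as a time it stands
for all later ones.
* An LTL formula is written in postfix notation. The subformulae that end before a position are
  evaluated before those that end there, for all times up to `N - 1` (`Cmd.eval_sats`); the first
  and the last position of a subformula identify it (`IsTextOf.unique`).
* A Büchi automaton accepts an eventually constant word if and only if there is a lasso: a run up to
  a time from which the word is constant, and then a path to an accepting state on a cycle, with
  moves for the constant letter (`NBA.accepts_iff_lasso`, `Cmd.eval_lasso`).

The variables and relation symbols of the programs are numbers. Variable 0 holds `n`, variable 1 the
last position, and, for automata, variables 2 and 3 hold the numbers of propositions and of states.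
The symbols 0 to 7 stand for the sets of positions of the eight letters (so 1 is the set of
positions of the bit `true`), 8 and 9 for paths within the first and the later slices, 10 for treks, 11 for
chains of treks, and 12 for the propositions that hold; the symbols from 13 on are specific to the
two problems.
-/

/-! ### Structured stack programs and their translation into Turing machines -/

/-- Structured programs on finitely many stacks over one alphabet. `pop k f` removes the top symbol
`o` of the stack `k` (`none` if there is none) and goes on with `f o`; `loop k f` removes the top
symbol `a` of `k` and runs `f a`, until the stack `k` is empty. -/
inductive StackProg (K A : Type) where
  | skip : StackProg K A
  | push (k : K) (a : A) : StackProg K A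
  | seq (p q : StackProg K A) : StackProg K A
  | pop (k : K) (f : Option A → StackProg K A) : StackProg K A
  | loop (k : K) (f : A → StackProg K A) : StackProg K A

namespace StackProg

open Turing Function

variable {K A : Type} [DecidableEq K]

/-- `Exec p S S' t`: started with the stacks `S`, the program `p` ends with the stacks `S'`, after
at most `t` steps. Straight-line code is free, as in Mathlib's `TM2` model. -/
inductive Exec : StackProg K A → (K → List A) → (K → List A) → ℕ → Prop
  | skip {S t} : Exec .skip S S t
  | push {k a S t} : Exec (.push k a) S (update S k (a :: S k)) t
  | seq {p q S S' S'' t t' u} :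
      Exec p S S' t → Exec q S' S'' t' → t + t' ≤ u → Exec (.seq p q) S S'' u
  | pop {k f S S' t u} :
      Exec (f (S k).head?) (update S k (S k).tail) S' t → t + 1 ≤ u → Exec (.pop k f) S S' u
  | loop_nil {k f S u} : S k = [] → 1 ≤ u → Exec (.loop k f) S S u
  | loop_cons {k f S S' S'' a l t t' u} : S k = a :: l → Exec (f a) (update S k l) S' t →
      Exec (.loop k f) S' S'' t' → t + t' + 2 ≤ u → Exec (.loop k f) S S'' u

/-- The labels needed by the Turing machine that executes the program. -/
@[reducible]
def Lab : StackProg K A → Type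
  | .skip => Empty
  | .push _ _ => Empty
  | .seq p q => p.Lab ⊕ q.Lab
  | .pop _ f => Σ o, Option (f o).Lab
  | .loop _ f => Option (Σ a, Option (f a).Lab)

/-- There are finitely many labels. -/
@[reducible]
noncomputable def labFintype [Fintype A] : (p : StackProg K A) → Fintype p.Lab
  | .skip => inferInstanceAs (Fintype Empty)
  | .push _ _ => inferInstanceAs (Fintype Empty)
  | .seq p q =>
    letI := labFintype p
    letI := labFintype q
    inferInstanceAs (Fintype (p.Lab ⊕ q.Lab))
  | .pop _ f =>
    letI := fun o => labFintype (f o)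
    inferInstanceAs (Fintype (Σ o, Option (f o).Lab))
  | .loop _ f =>
    letI := fun a => labFintype (f a)
    inferInstanceAs (Fintype (Option (Σ a, Option (f a).Lab)))

/-- The stack alphabets of the machine: besides the stacks of the program there is an output stack
`none`, which takes Boolean values. -/
abbrev Alph (K A : Type) : Option K → Type
  | none => Bool
  | some _ => A

/-- Statements of the machine; its internal state is the result of the last `pop`. -/
abbrev MStmt (K A L : Type) := TM2.Stmt (Alph K A) L (Option A)

/-- The statement that starts the execution of `p` and goes on with `c`. The labels of `p` are
embedded by `emb` into those of the machine. -/
def code {L : Type} : (p : StackProg K A) → (emb : p.Lab → L) → (c : MStmt K A L) → MStmt K A L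
  | .skip, _, c => c
  | .push k a, _, c => .push (some k) (fun _ => a) c
  | .seq p q, emb, c => p.code (fun l => emb (.inl l)) (q.code (fun l => emb (.inr l)) c)
  | .pop k _, emb, _ => .pop (some k) (fun _ o => o) (.goto fun v => emb ⟨v, none⟩)
  | .loop _ _, emb, _ => .goto fun _ => emb none

/-- The statements at the labels of `p`. -/
def body {L : Type} : (p : StackProg K A) → (emb : p.Lab → L) → (c : MStmt K A L) →
    p.Lab → MStmt K A L
  | .skip, _, _, l => nomatch l
  | .push _ _, _, _, l => nomatch l
  | .seq p q, emb, c, .inl l =>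
    p.body (fun l => emb (.inl l)) (q.code (fun l => emb (.inr l)) c) l
  | .seq _ q, emb, c, .inr l => q.body (fun l => emb (.inr l)) c l
  | .pop _ f, emb, c, ⟨o, none⟩ => (f o).code (fun l => emb ⟨o, some l⟩) c
  | .pop _ f, emb, c, ⟨o, some l⟩ => (f o).body (fun l => emb ⟨o, some l⟩) c l
  | .loop k _, emb, c, none => .pop (some k) (fun _ o => o) (.branch Option.isNone c
      (.goto fun v => emb (v.map fun a => ⟨a, none⟩)))
  | .loop _ f, emb, _, some ⟨a, none⟩ =>
    (f a).code (fun l => emb (some ⟨a, some l⟩)) (.goto fun _ => emb none)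
  | .loop _ f, emb, _, some ⟨a, some l⟩ =>
    (f a).body (fun l => emb (some ⟨a, some l⟩)) (.goto fun _ => emb none) l
termination_by structural p => p

/-- The stacks of the machine, with an empty output stack. -/
def lift (S : K → List A) : ∀ o : Option K, List (Alph K A o)
  | none => []
  | some k => S k

omit [DecidableEq K] in
lemma lift_some (S : K → List A) (k : K) : lift S (some k) = S k := rfl

lemma update_lift (S : K → List A) (k : K) (l : List A) :
    update (lift S) (some k) l = lift (update S k l) := by
  funext o
  cases o with
  | none => simp [lift]
  | some j =>
    by_cases h : j = k
    · subst h; simp [lift]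
    · rw [update_of_ne (by simpa using h)]; simp [lift, h]

/-- `StepsTo M n c c'`: the machine gets from `c` to `c'` in `n` steps. -/
def StepsTo {L : Type} (M : L → MStmt K A L) (n : ℕ)
    (c c' : TM2.Cfg (Alph K A) L (Option A)) : Prop :=
  (flip bind (TM2.step M))^[n] (some c) = some c'

lemma StepsTo.trans {L : Type} {M : L → MStmt K A L} {n n' : ℕ}
    {c c' c'' : TM2.Cfg (Alph K A) L (Option A)}
    (h : StepsTo M n c c') (h' : StepsTo M n' c' c'') : StepsTo M (n + n') c c'' := by
  unfold StepsTo at *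
  rw [Nat.add_comm, iterate_add_apply, h, h']

lemma StepsTo.one {L : Type} {M : L → MStmt K A L} (l : L) (v : Option A)
    (S : ∀ o : Option K, List (Alph K A o)) :
    StepsTo M 1 ⟨some l, v, S⟩ (TM2.stepAux (M l) v S) := rfl

/-- A machine that contains the statements of `p` at its labels executes `p`. -/
theorem Exec.stepsTo {L : Type} {M : L → MStmt K A L} {p : StackProg K A} {S S' : K → List A}
    {t : ℕ} (h : Exec p S S' t) (emb : p.Lab → L) (c : MStmt K A L)
    (hM : ∀ l, M (emb l) = p.body emb c l) (v : Option A) :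
    ∃ n ≤ t, ∃ v', StepsTo M n (TM2.stepAux (p.code emb c) v (lift S))
      (TM2.stepAux c v' (lift S')) := by
  induction h generalizing c v with
  | skip => exact ⟨0, Nat.zero_le _, v, rfl⟩
  | @push k a S t =>
    refine ⟨0, Nat.zero_le _, v, ?_⟩
    simp only [code, TM2.stepAux]
    rw [← update_lift]
    rfl
  | @seq p q S S' S'' t t' u _ _ htu ih ih' =>
    obtain ⟨n, hn, v', hs⟩ := ih (fun l => emb (.inl l)) (q.code (fun l => emb (.inr l)) c)
      (fun l => hM (.inl l)) v
    obtain ⟨n', hn', v'', hs'⟩ := ih' (fun l => emb (.inr l)) c (fun l => hM (.inr l)) v'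
    exact ⟨n + n', by omega, v'', hs.trans hs'⟩
  | @pop k f S S' t u _ htu ih =>
    obtain ⟨n, hn, v', hs⟩ := ih (fun l => emb ⟨_, some l⟩) c (fun l => hM ⟨_, some l⟩) (S k).head?
    refine ⟨1 + n, by omega, v', ?_⟩
    refine StepsTo.trans (StepsTo.one _ _ _) ?_
    rw [hM ⟨_, none⟩]
    rw [← update_lift] at hs
    exact hs
  | @loop_nil k f S u hS hu =>
    refine ⟨1, hu, none, ?_⟩
    have h1 := StepsTo.one (M := M) (emb none) v (lift S)
    rw [hM none] at h1
    simp only [body, TM2.stepAux, lift_some] at h1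
    erw [hS] at h1
    have h2 : update (lift S) (some k) ([] : List A) = lift S := by
      rw [update_lift, ← hS, update_eq_self]
    erw [h2] at h1
    exact h1
  | @loop_cons k f S S' S'' a l t t' u hS _ _ htu ih ih' =>
    obtain ⟨n, hn, v', hs⟩ := ih (fun l => emb (some ⟨a, some l⟩)) (.goto fun _ => emb none)
      (fun l => hM (some ⟨a, some l⟩)) (some a)
    obtain ⟨n', hn', v'', hs'⟩ := ih' emb c hM v'
    refine ⟨1 + (1 + n) + n', by omega, v'', ?_⟩
    refine StepsTo.trans ?_ hs'
    refine StepsTo.trans (c' := ⟨some (emb (some ⟨a, none⟩)), some a, lift (update S k l)⟩) ?_ ?_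
    · have h1 := StepsTo.one (M := M) (emb none) v (lift S)
      rw [hM none] at h1
      simp only [body, TM2.stepAux, lift_some] at h1
      erw [hS] at h1
      rw [← update_lift]
      exact h1
    · refine StepsTo.trans (StepsTo.one _ _ _) ?_
      rw [hM (some ⟨a, none⟩)]
      exact hs

/-- The Turing machine that executes `p`, with the input on the stack `inp`, and puts the Boolean
value `out o` on the output stack, where `o` is the top symbol of the stack `res` at the end. -/
noncomputable def machine [Fintype K] [Fintype A] (p : StackProg K A) (inp res : K)
    (out : Option A → Bool) : FinTM2 where
  K := Option K
  k₀ := some inp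
  k₁ := none
  Γ := Alph K A
  Λ := Option p.Lab
  ΛFin := letI := p.labFintype; inferInstance
  main := none
  σ := Option A
  initialState := none
  Γk₀Fin := inferInstanceAs (Fintype A)
  m := fun l =>
    let c : MStmt K A (Option p.Lab) :=
      .pop (some res) (fun _ o => o) (.push none out (.load (fun _ => none) .halt))
    l.elim (p.code some c) (p.body some c)

/-- A problem is decidable in polynomial time if a stack program solves it, leaving all stacks but
the result stack empty. -/
theorem polyTimeDecidable {α : Type} [Fintype K] [Fintype A] (p : StackProg K A) (inp res : K)
    (out : Option A → Bool) (enc : α → List A) (P : α → Prop) (time : Polynomial ℕ)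
    (hp : ∀ x, ∃ a, (out (some a) = true ↔ P x) ∧
      Exec p (update (fun _ => []) inp (enc x)) (update (fun _ => []) res [a])
        (time.eval (enc x).length)) :
    PolyTimeDecidable enc P := by
  classical
  refine ⟨{ tm := p.machine inp res out, inputAlphabet := Equiv.refl A,
            outputAlphabet := Equiv.refl Bool, time := time + 1, outputsFun := ?_ }⟩
  intro x
  apply Classical.choice
  obtain ⟨a, ha, hex⟩ := hp x
  let c : MStmt K A (Option p.Lab) :=
      .pop (some res) (fun _ o => o) (.push none out (.load (fun _ => none) .halt))
  obtain ⟨n, hn, v', hs⟩ := hex.stepsTo (M := (p.machine inp res out).m) some c (fun _ => rfl) none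
  refine ⟨⟨⟨1 + n, ?_⟩, ?_⟩⟩
  · have h1 := StepsTo.trans (StepsTo.one (M := (p.machine inp res out).m) none none
      (lift (update (fun _ => []) inp (enc x)))) hs
    have e1 : initList (p.machine inp res out) (List.map (Equiv.refl A).invFun (enc x)) =
        ⟨some none, none, lift (update (fun _ => []) inp (enc x))⟩ := by
      unfold initList
      congr 1
      funext k
      rcases k with _ | k
      · rfl
      · by_cases h : k = inp
        · subst h
          refine (dif_pos rfl).trans ?_
          rw [lift_some, update_self]
          exact List.map_id _
        · refine (dif_neg (show ¬ (some k = some inp) by simpa using h)).trans ?_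
          rw [lift_some, update_of_ne h]
          rfl
    have e2 : haltList (p.machine inp res out)
        (List.map (Equiv.refl Bool).invFun (Computability.encodeBool (decide (P x)))) =
        TM2.stepAux c v' (lift (update (fun _ => []) res [a])) := by
      have hout : out (some a) = decide (P x) := by
        rw [Bool.eq_iff_iff]; simpa using ha
      unfold haltList
      simp only [c, TM2.stepAux]
      congr 1
      funext k
      rcases k with _ | k
      · refine (dif_pos rfl).trans ?_
        simp [lift, Computability.encodeBool, ← hout, machine]
        rfl
      · refine (dif_neg (show ¬ (some k = none) by simp)).trans ?_
        rw [update_of_ne (by simp)]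
        by_cases h : k = res
        · subst h
          rw [update_self, lift_some, update_self]
          rfl
        · rw [update_of_ne (by simpa using h), lift_some, update_of_ne h]
          rfl
    have h2 : StepsTo (p.machine inp res out).m (1 + n) (initList (p.machine inp res out)
        (List.map (Equiv.refl A).invFun (enc x))) (haltList (p.machine inp res out)
        (List.map (Equiv.refl Bool).invFun (Computability.encodeBool (decide (P x))))) := by
      rw [e2]
      exact e1 ▸ h1
    exact h2
  · simp only [Polynomial.eval_add, Polynomial.eval_one]
    omega

end StackProg

/-! ### A language of bounded loops over a growing set of tuples -/

/-- The number variables. -/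
abbrev Var := Fin 16

/-- Arithmetic terms. -/
inductive Term where
  | const (c : ℕ)
  | var (x : Var)
  | prod (x y : Var)
  | add (s t : Term)

/-- The value of a term under an assignment of numbers to the variables. -/
def Term.val (ρ : Var → ℕ) : Term → ℕ
  | .const c => c
  | .var x => ρ x
  | .prod x y => ρ x * ρ y
  | .add s t => s.val ρ + t.val ρ

/-- Sums of terms are written with `+`. -/
instance : Add Term := ⟨Term.add⟩

/-- First-order formulae over a database of tuples; quantifiers are bounded by the input length.
The atom `mem tag ts` says that the tuple `ts` belongs to the relation with the symbol `tag`. -/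
inductive Form where
  | mem (tag : ℕ) (ts : List Term)
  | le (s t : Term)
  | neg (φ : Form)
  | conj (φ ψ : Form)
  | ex (x : Var) (φ : Form)

/-- `φ.Holds N R ρ`: the formula `φ` holds under the assignment `ρ` if quantifiers range over the
numbers below `N` and the symbol `tag` stands for the relation `R tag`. -/
def Form.Holds (N : ℕ) (R : ℕ → List ℕ → Prop) : (Var → ℕ) → Form → Prop
  | ρ, .mem tag ts => R tag (ts.map (Term.val ρ))
  | ρ, .le s t => s.val ρ ≤ t.val ρ
  | ρ, .neg φ => ¬ Form.Holds N R ρ φ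
  | ρ, .conj φ ψ => Form.Holds N R ρ φ ∧ Form.Holds N R ρ ψ
  | ρ, .ex x φ => ∃ i < N, Form.Holds N R (Function.update ρ x i) φ

/-- Programs that insert tuples into the database: `ins tag ts` adds the tuple `ts` to the relation
`tag`, `test φ s` runs `s` if `φ` holds, and `loop x s` runs `s` for all values of `x` below the
input length, in ascending order. -/
inductive Cmd where
  | ins (tag : ℕ) (ts : List Term)
  | test (φ : Form) (s : Cmd)
  | loop (x : Var) (s : Cmd)
  | seq (s s' : Cmd)

/-- The relations stored in a list of tuples, the first component of a tuple being the symbol of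
the relation. -/
def relOf (D : List (List ℕ)) (tag : ℕ) (args : List ℕ) : Prop := tag :: args ∈ D

open Classical in
/-- The database after running a command on the database `D`. A loop variable takes the values
`0, …, N - 1`. -/
noncomputable def Cmd.eval (N : ℕ) : Cmd → (Var → ℕ) → List (List ℕ) → List (List ℕ)
  | .ins tag ts, ρ, D => (tag :: ts.map (Term.val ρ)) :: D
  | .test φ s, ρ, D => if φ.Holds N (relOf D) ρ then s.eval N ρ D else D
  | .loop x s, ρ, D => N.rec D fun i D' => s.eval N (Function.update ρ x i) D'
  | .seq s s', ρ, D => s'.eval N ρ (s.eval N ρ D)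

/-- The variables that are bound in a formula. -/
def Form.bound : Form → List Var
  | .mem _ _ => []
  | .le _ _ => []
  | .neg φ => φ.bound
  | .conj φ ψ => φ.bound ++ ψ.bound
  | .ex x φ => x :: φ.bound

/-- No quantifier binds a variable in the scope of another quantifier for the same variable: each
variable has only one stack, which must be free when the variable is bound. -/
def Form.Proper : Form → Prop
  | .mem _ _ => True
  | .le _ _ => True
  | .neg φ => φ.Proper
  | .conj φ ψ => φ.Proper ∧ ψ.Proper
  | .ex x φ => x ∉ φ.bound ∧ φ.Proper

/-- The variables that are bound in a command. -/
def Cmd.bound : Cmd → List Var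
  | .ins _ _ => []
  | .test φ s => φ.bound ++ s.bound
  | .loop x s => x :: s.bound
  | .seq s s' => s.bound ++ s'.bound

/-- No variable is bound in the scope of a loop or a quantifier for the same variable. -/
def Cmd.Proper : Cmd → Prop
  | .ins _ _ => True
  | .test φ s => φ.Proper ∧ s.Proper
  | .loop x s => x ∉ s.bound ∧ s.Proper
  | .seq s s' => s.Proper ∧ s'.Proper

/-! ### Implementation of the language by stack programs -/

/-- The stacks: the input; its length; the database; auxiliary stacks; for each variable its value
and a loop counter. Numbers are written in unary. -/
inductive Stk where
  | inp | len | log | bak | qry | qbak | flag | fnd | res | tmp | aux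
  | val (x : Var)
  | cnt (x : Var)
  deriving DecidableEq, Fintype

namespace Implementation

open StackProg Function Polynomial

/-- Contents of the stacks. -/
abbrev St := Stk → List Token

/-- Programs on these stacks. -/
abbrev SP := StackProg Stk Token

/-- The unary digit. -/
abbrev one : Token := Token.item

/-- The end marker of a tuple. -/
abbrev eot : Token := Token.neg

/-- A number in unary. -/
abbrev un (n : ℕ) : List Token := List.replicate n one

lemma _root_.StackProg.Exec.mono {K A : Type} [DecidableEq K] {p : StackProg K A}
    {S S' : K → List A} {t u : ℕ}
    (h : Exec p S S' t) (htu : t ≤ u) : Exec p S S' u := by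
  cases h with
  | skip => exact .skip
  | push => exact .push
  | seq h1 h2 h3 => exact .seq h1 h2 (h3.trans htu)
  | pop h1 h2 => exact .pop h1 (h2.trans htu)
  | loop_nil h1 h2 => exact .loop_nil h1 (h2.trans htu)
  | loop_cons h1 h2 h3 h4 => exact .loop_cons h1 h2 h3 (h4.trans htu)

lemma _root_.StackProg.Exec.to {K A : Type} [DecidableEq K] {p : StackProg K A}
    {S S' S'' : K → List A} {t u : ℕ} (h : Exec p S S' t) (hS : S' = S'') (htu : t ≤ u) :
    Exec p S S'' u := hS ▸ h.mono htu

lemma eval_mono (p : Polynomial ℕ) {a b : ℕ} (h : a ≤ b) : p.eval a ≤ p.eval b := by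
  rw [eval_eq_sum_range, eval_eq_sum_range]
  gcongr

/-- Empty the stack `k`. -/
def clear (k : Stk) : SP := .loop k fun _ => .skip

lemma exec_clear (k : Stk) (S : St) : Exec (clear k) S (update S k []) (2 * (S k).length + 1) := by
  generalize hl : S k = l
  induction l generalizing S with
  | nil =>
    exact .to (.loop_nil hl le_rfl) (by rw [← hl, update_eq_self]) (by simp)
  | cons a l ih =>
    refine .loop_cons hl (.skip (t := 0)) (t' := 2 * l.length + 1) ?_ (by simp; omega)
    have := ih (update S k l) (by simp)
    rwa [update_idem] at this

/-- Pop the stack `k` and push its symbols on `d`. -/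
def move (k d : Stk) : SP := .loop k fun a => .push d a

lemma exec_move {k d : Stk} (hkd : k ≠ d) (S : St) :
    Exec (move k d) S (update (update S k []) d ((S k).reverse ++ S d)) (2 * (S k).length + 1) := by
  generalize hl : S k = l
  induction l generalizing S with
  | nil =>
    refine .to (.loop_nil hl le_rfl) ?_ (by simp)
    funext j
    simp only [update_apply]
    split_ifs <;> simp_all
  | cons a l ih =>
    refine .loop_cons hl (.push (t := 0)) (t' := 2 * l.length + 1) ?_ (by simp; omega)
    have := ih (update (update S k l) d (a :: update S k l d)) (by simp [hkd])
    refine this.to ?_ le_rfl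
    funext j
    simp only [update_apply]
    split_ifs <;> simp_all

/-- Pop the stack `k` and push its symbols on both `d` and `e`. -/
def moveBoth (k d e : Stk) : SP := .loop k fun a => .seq (.push d a) (.push e a)

lemma exec_moveBoth {k d e : Stk} (hkd : k ≠ d) (hke : k ≠ e) (hde : d ≠ e) (S : St) :
    Exec (moveBoth k d e) S (update (update (update S k []) d ((S k).reverse ++ S d)) e
      ((S k).reverse ++ S e)) (2 * (S k).length + 1) := by
  generalize hl : S k = l
  induction l generalizing S with
  | nil =>
    refine .to (.loop_nil hl le_rfl) ?_ (by simp)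
    funext j
    simp only [update_apply]
    split_ifs <;> simp_all
  | cons a l ih =>
    refine .loop_cons hl (.seq (.push (t := 0)) (.push (t := 0)) (Nat.le_refl _))
      (t' := 2 * l.length + 1) ?_ (by simp; omega)
    have := ih (update (update (update S k l) d (a :: update S k l d)) e
      (a :: (update (update S k l) d (a :: update S k l d) e))) (by simp [hkd, hke])
    refine this.to ?_ le_rfl
    funext j
    simp only [update_apply]
    split_ifs <;> simp_all

/-- Push the number on the stack `k` on the stack `d` as well. -/
def copy (k d : Stk) : SP := .seq (moveBoth k .tmp d) (move .tmp k)

lemma exec_copy {k d : Stk} {n : ℕ} {S : St} (hk : S k = un n) (ht : S .tmp = [])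
    (hkd : k ≠ d) (hkt : k ≠ .tmp) (hdt : d ≠ .tmp) :
    Exec (copy k d) S (update S d (un n ++ S d)) (4 * n + 2) := by
  refine .to (.seq (exec_moveBoth hkt hkd hdt.symm S) (exec_move hkt.symm _) le_rfl) ?_
    (by simp [hk, ht, hdt.symm]; omega)
  funext j
  simp only [update_apply]
  split_ifs <;> simp_all

/-- The stacks are ready for evaluating terms: the stacks `val x` hold the values of the variables
and the stacks used for copying are empty. -/
structure Vals (S : St) (ρ : Var → ℕ) : Prop where
  tmp : S .tmp = []
  aux : S .aux = []
  val : ∀ x, S (.val x) = un (ρ x)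

/-- A stack for output that is not used in evaluating terms. -/
structure IsOut (d : Stk) : Prop where
  tmp : d ≠ .tmp
  aux : d ≠ .aux
  val : ∀ x, d ≠ .val x

lemma Vals.update {S : St} {ρ : Var → ℕ} (h : Vals S ρ) {d : Stk} (hd : IsOut d)
    (l : List Token) : Vals (update S d l) ρ where
  tmp := by rw [update_of_ne hd.tmp.symm, h.tmp]
  aux := by rw [update_of_ne hd.aux.symm, h.aux]
  val x := by rw [update_of_ne (hd.val x).symm, h.val]

/-- Push `c` unary digits. -/
def pushUn (d : Stk) : ℕ → SP
  | 0 => .skip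
  | c + 1 => .seq (.push d one) (pushUn d c)

lemma exec_pushUn (d : Stk) (c : ℕ) (S : St) :
    Exec (pushUn d c) S (update S d (un c ++ S d)) 0 := by
  induction c generalizing S with
  | zero => exact .to (.skip (t := 0)) (by simp) le_rfl
  | succ c ih =>
    refine .to (.seq (.push (t := 0)) (ih _) le_rfl) ?_ le_rfl
    simp [List.replicate_succ']

/-- Push the value of a term. -/
def writeTerm (d : Stk) : Term → SP
  | .const c => pushUn d c
  | .var x => copy (.val x) d
  | .prod x y => .seq (copy (.val x) .aux) (.loop .aux fun _ => copy (.val y) d)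
  | .add s t => .seq (writeTerm d s) (writeTerm d t)

lemma exec_prodLoop {S : St} {ρ : Var → ℕ} (hS : Vals S ρ) {d : Stk} (hd : IsOut d) (y : Var)
    (m : ℕ) : Exec (.loop .aux fun _ => copy (.val y) d) (update S .aux (un m))
      (update S d (un (m * ρ y) ++ S d)) (m * (4 * ρ y + 4) + 1) := by
  induction m generalizing S with
  | zero =>
    have : update S .aux (un 0) = S := by
      rw [show un 0 = S .aux from hS.aux.symm, update_eq_self]
    rw [this]
    exact .to (.loop_nil hS.aux le_rfl) (by simp) (by simp)
  | succ m ih =>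
    refine .loop_cons (a := one) (l := un m) (by simp [List.replicate_succ])
      (exec_copy (n := ρ y) (by simp [hS.val]) (by simp [hS.tmp]) (hd.val y).symm (by simp) hd.tmp)
      (t' := m * (4 * ρ y + 4) + 1) ?_ (by ring_nf; omega)
    have h1 := ih (hS.update hd (un (ρ y) ++ S d))
    have h2 : update (update S .aux (un m)) d (un (ρ y) ++ update S .aux (un m) d) =
        update (update S d (un (ρ y) ++ S d)) .aux (un m) := by
      rw [update_comm hd.aux, update_of_ne hd.aux]
    rw [update_idem, h2]
    refine h1.to ?_ le_rfl
    · rw [update_idem, update_self, Nat.succ_mul, ← List.append_assoc,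
        ← List.replicate_add]

/-- A bound for the value of the term if all variables are at most the argument. -/
noncomputable def _root_.Term.bnd : Term → Polynomial ℕ
  | .const c => C c
  | .var _ => X
  | .prod _ _ => X * X
  | .add s t => s.bnd + t.bnd

lemma val_le_bnd {ρ : Var → ℕ} {N : ℕ} (h : ∀ x, ρ x ≤ N) (t : Term) :
    t.val ρ ≤ t.bnd.eval N := by
  induction t with
  | const c => simp [Term.val, Term.bnd]
  | var x => simpa [Term.val, Term.bnd] using h x
  | prod x y => simpa [Term.val, Term.bnd] using Nat.mul_le_mul (h x) (h y)
  | add s t hs ht => simpa [Term.val, Term.bnd] using Nat.add_le_add hs ht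

lemma exec_writeTerm {d : Stk} (hd : IsOut d) (t : Term) : ∃ P : Polynomial ℕ,
    ∀ (N : ℕ) (ρ : Var → ℕ) (S : St), Vals S ρ → (∀ x, ρ x ≤ N) →
      Exec (writeTerm d t) S (update S d (un (t.val ρ) ++ S d)) (P.eval N) := by
  induction t with
  | const c =>
    exact ⟨0, fun N ρ S _ _ => (exec_pushUn d c S).mono (Nat.zero_le _)⟩
  | var x =>
    refine ⟨4 * X + 2, fun N ρ S hS hρ => (exec_copy (hS.val x) hS.tmp (hd.val x).symm (by simp)
      hd.tmp).mono ?_⟩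
    have := hρ x
    simp; omega
  | prod x y =>
    refine ⟨X * (4 * X + 4) + 4 * X + 3, fun N ρ S hS hρ => ?_⟩
    refine .seq (exec_copy (hS.val x) hS.tmp (by simp) (by simp) (by simp))
      (t' := ρ x * (4 * ρ y + 4) + 1) ?_ ?_
    · rw [hS.aux, List.append_nil]
      exact exec_prodLoop hS hd y (ρ x)
    · have h1 := hρ x
      have h2 : ρ x * (4 * ρ y + 4) ≤ N * (4 * N + 4) := by
        have := hρ y
        gcongr
      simp; omega
  | add s t hs ht =>
    obtain ⟨P, hP⟩ := hs
    obtain ⟨Q, hQ⟩ := ht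
    refine ⟨P + Q, fun N ρ S hS hρ => ?_⟩
    refine .to (.seq (hP N ρ S hS hρ) (hQ N ρ _ (hS.update hd _) hρ) le_rfl) ?_ (by simp)
    rw [update_idem, update_self, Term.val, ← List.append_assoc, ← List.replicate_add,
      Nat.add_comm]

/-- A tuple of numbers as a word. -/
def encKey : List ℕ → List Token
  | [] => [eot]
  | a :: k => un a ++ Token.sep :: encKey k

/-- Push a tuple. -/
def writeKey (d : Stk) : List Term → SP
  | [] => .push d eot
  | t :: ts => .seq (writeKey d ts) (.seq (.push d .sep) (writeTerm d t))

lemma exec_writeKey {d : Stk} (hd : IsOut d) (ts : List Term) : ∃ P : Polynomial ℕ,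
    ∀ (N : ℕ) (ρ : Var → ℕ) (S : St), Vals S ρ → (∀ x, ρ x ≤ N) →
      Exec (writeKey d ts) S (update S d (encKey (ts.map (Term.val ρ)) ++ S d)) (P.eval N) := by
  induction ts with
  | nil => exact ⟨0, fun N ρ S _ _ => .push⟩
  | cons t ts ih =>
    obtain ⟨P, hP⟩ := ih
    obtain ⟨Q, hQ⟩ := exec_writeTerm hd t
    refine ⟨P + Q, fun N ρ S hS hρ => ?_⟩
    refine .to (.seq (hP N ρ S hS hρ) (.seq (.push (t := 0))
      (hQ N ρ _ ((hS.update hd _).update hd _) hρ) le_rfl) le_rfl) ?_ (by simp)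
    simp [encKey, update_idem]

lemma exists_length_encKey_le (ts : List Term) : ∃ P : Polynomial ℕ,
    ∀ (N : ℕ) (ρ : Var → ℕ), (∀ x, ρ x ≤ N) →
      (encKey (ts.map (Term.val ρ))).length ≤ P.eval N := by
  induction ts with
  | nil => exact ⟨1, fun N ρ _ => by simp [encKey]⟩
  | cons t ts ih =>
    obtain ⟨P, hP⟩ := ih
    refine ⟨t.bnd + 1 + P, fun N ρ hρ => ?_⟩
    have h1 := hP N ρ hρ
    have h2 := val_le_bnd hρ t
    simp only [encKey, List.map_cons, List.length_append, List.length_replicate,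
      List.length_cons, eval_add, eval_one]
    omega

lemma encKey_eq (k : List ℕ) : ∃ u, encKey k = u ++ [eot] ∧ eot ∉ u := by
  induction k with
  | nil => exact ⟨[], rfl, by simp⟩
  | cons a k ih =>
    obtain ⟨u, hu, hs⟩ := ih
    exact ⟨un a ++ Token.sep :: u, by simp [encKey, hu], by simp [hs]⟩

lemma encKey_injective : Function.Injective encKey := by
  intro k
  induction k with
  | nil =>
    intro k' h
    cases k' with
    | nil => rfl
    | cons a k' => cases a <;> simp [encKey, List.replicate_succ] at h
  | cons a k ih =>
    intro k' h
    cases k' with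
    | nil => cases a <;> simp [encKey, List.replicate_succ] at h
    | cons b k' =>
      have : ∀ (a b : ℕ) (l l' : List Token), un a ++ Token.sep :: l = un b ++ Token.sep :: l' →
          a = b ∧ l = l' := by
        intro a
        induction a with
        | zero => intro b l l' h; cases b <;> simp_all [List.replicate_succ]
        | succ a ih =>
          intro b l l' h
          cases b with
          | zero => simp [List.replicate_succ] at h
          | succ b =>
            have := ih b l l' (by simpa [List.replicate_succ] using h)
            exact ⟨by rw [this.1], this.2⟩
      obtain ⟨h1, h2⟩ := this _ _ _ _ h
      rw [h1, ih h2]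

end Implementation

/-! ### Searching the database -/

namespace Implementation

open StackProg Function

/-- The stacks `S`, except that those used for searching the database have the given contents. -/
def scanSt (S : St) (lg bk q qb fl fd : List Token) : St
  | .log => lg
  | .bak => bk
  | .qry => q
  | .qbak => qb
  | .flag => fl
  | .fnd => fd
  | k => S k

section
variable (S : St) (lg bk q qb fl fd l : List Token)

lemma scanSt_self : scanSt S (S .log) (S .bak) (S .qry) (S .qbak) (S .flag) (S .fnd) = S := by
  funext k; cases k <;> rfl

lemma update_scanSt_log : update (scanSt S lg bk q qb fl fd) .log l =
    scanSt S l bk q qb fl fd := by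
  funext k; cases k <;> simp [scanSt]

lemma update_scanSt_bak : update (scanSt S lg bk q qb fl fd) .bak l =
    scanSt S lg l q qb fl fd := by
  funext k; cases k <;> simp [scanSt]

lemma update_scanSt_qry : update (scanSt S lg bk q qb fl fd) .qry l =
    scanSt S lg bk l qb fl fd := by
  funext k; cases k <;> simp [scanSt]

lemma update_scanSt_qbak : update (scanSt S lg bk q qb fl fd) .qbak l =
    scanSt S lg bk q l fl fd := by
  funext k; cases k <;> simp [scanSt]

lemma update_scanSt_flag : update (scanSt S lg bk q qb fl fd) .flag l =
    scanSt S lg bk q qb l fd := by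
  funext k; cases k <;> simp [scanSt]

lemma update_scanSt_fnd : update (scanSt S lg bk q qb fl fd) .fnd l =
    scanSt S lg bk q qb fl l := by
  funext k; cases k <;> simp [scanSt]

end

/-- Compare one symbol of the database with the query. The stack `flag` is empty as long as the
current tuple agrees with the query; at the end of a matching tuple, `fnd` gets a mark. -/
def scanBody (a : Token) : SP :=
  .seq (.push .bak a) <| .seq
    (.pop .qry fun
      | some b => .seq (.push .qbak b) (if a = b then .skip else .push .flag one)
      | none => .push .flag one)
    (if a = eot then
      .seq (.pop .flag fun | none => .push .fnd one | some _ => clear .flag) (move .qbak .qry)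
    else .skip)

/-- The part of `scanBody` that consumes a symbol of the query. -/
lemma exec_compare (S : St) (lg bk q qb fl fd : List Token) (a : Token) :
    Exec (.pop .qry fun
      | some b => .seq (.push .qbak b) (if a = b then .skip else .push .flag one)
      | none => .push .flag one : SP) (scanSt S lg bk q qb fl fd)
      (scanSt S lg bk q.tail (q.head?.toList ++ qb)
        (if q.head? = some a then fl else one :: fl) fd) 1 := by
  cases q with
  | nil =>
    refine .to (.pop (.push (t := 0)) le_rfl) ?_ le_rfl
    change update (update (scanSt _ _ _ _ _ _ _) Stk.qry []) Stk.flag (one :: fl) = _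
    rw [update_scanSt_qry, update_scanSt_flag]; simp
  | cons b q =>
    by_cases h : a = b
    · refine .to (.pop (t := 0) (S' := scanSt S lg bk q (b :: qb) fl fd) ?_ le_rfl) (by simp [h])
        le_rfl
      simp only [scanSt, List.head?_cons, List.tail_cons, if_pos h]
      refine .to (.seq (.push (t := 0)) (.skip (t := 0)) le_rfl) ?_ le_rfl
      change update (update (scanSt _ _ _ _ _ _ _) Stk.qry q) Stk.qbak (b :: qb) = _
      rw [update_scanSt_qry, update_scanSt_qbak]
    · refine .to (.pop (t := 0) (S' := scanSt S lg bk q (b :: qb) (one :: fl) fd) ?_ le_rfl)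
        (by simp [Ne.symm h]) le_rfl
      simp only [scanSt, List.head?_cons, List.tail_cons, if_neg h]
      refine .to (.seq (.push (t := 0)) (.push (t := 0)) le_rfl) ?_ le_rfl
      change update (update (update (scanSt _ _ _ _ _ _ _) Stk.qry q) Stk.qbak (b :: qb))
        Stk.flag (one :: fl) = _
      rw [update_scanSt_qry, update_scanSt_qbak, update_scanSt_flag]

lemma exec_scanBody_of_ne {a : Token} (ha : a ≠ eot) (S : St) (lg bk q qb fl fd : List Token) :
    Exec (scanBody a) (scanSt S lg bk q qb fl fd)
      (scanSt S lg (a :: bk) q.tail (q.head?.toList ++ qb)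
        (if q.head? = some a then fl else one :: fl) fd) 1 := by
  refine .seq (.push (t := 0)) (.seq (t := 1) (t' := 0) (S' := scanSt S lg (a :: bk) q.tail
    (q.head?.toList ++ qb) (if q.head? = some a then fl else one :: fl) fd) ?_ ?_ le_rfl) le_rfl
  · rw [update_scanSt_bak]; exact exec_compare S _ _ _ _ _ _ _
  · rw [if_neg ha]; exact .skip

/-- At the end of a tuple the query is restored. -/
lemma exec_scanBody_eot (S : St) (lg bk q qb fl fd : List Token) :
    Exec (scanBody eot) (scanSt S lg bk q qb fl fd)
      (scanSt S lg (eot :: bk) (qb.reverse ++ q) [] []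
        (if q.head? = some eot ∧ fl = [] then one :: fd else fd))
      (2 * fl.length + 2 * qb.length + 8) := by
  refine .seq (.push (t := 0)) (.seq (t := 1) (t' := 2 * fl.length + 2 * qb.length + 7)
    (S' := scanSt S lg (eot :: bk) q.tail (q.head?.toList ++ qb)
      (if q.head? = some eot then fl else one :: fl) fd) ?_ ?_ le_rfl) (by omega)
  · rw [update_scanSt_bak]; exact exec_compare S _ _ _ _ _ _ _
  · rw [if_pos rfl]
    have hq : q.head?.toList ++ q.tail = q := by cases q <;> simp
    have hlen : (q.head?.toList ++ qb).length ≤ qb.length + 1 := by cases q <;> simp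
    refine .seq (u := 2 * fl.length + 2 * qb.length + 7) (t := 2 * fl.length + 4)
      (S' := scanSt S lg (eot :: bk) q.tail (q.head?.toList ++ qb) []
        (if q.head? = some eot ∧ fl = [] then one :: fd else fd)) ?_
      (.to (exec_move (by simp) _) ?_ le_rfl) ?_
    · by_cases h : q.head? = some eot ∧ fl = []
      · obtain ⟨h1, h2⟩ := h
        subst h2
        simp only [h1, if_true, and_self]
        refine .to (.pop (.push (t := 0)) le_rfl) ?_ (by omega)
        change update (update (scanSt _ _ _ _ _ _ _) Stk.flag []) Stk.fnd (one :: fd) = _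
        rw [update_scanSt_flag, update_scanSt_fnd]
      · rw [if_neg h]
        obtain ⟨b, f, hf⟩ : ∃ b f, (if q.head? = some eot then fl else one :: fl) = b :: f := by
          split_ifs with h1
          · cases fl with
            | nil => simp [h1] at h
            | cons b f => exact ⟨b, f, rfl⟩
          · exact ⟨_, _, rfl⟩
        have hfl : f.length ≤ fl.length := by
          have := congrArg List.length hf
          split_ifs at this <;> simp at this <;> omega
        rw [hf]
        refine .to (.pop (exec_clear .flag _) le_rfl) ?_ ?_
        · change update (update (scanSt _ _ _ _ _ _ _) Stk.flag f) Stk.flag [] = _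
          rw [update_idem, update_scanSt_flag]
        · change 2 * (update (scanSt _ _ _ _ _ _ _) Stk.flag f .flag).length + 1 + 1 ≤ _
          rw [update_self]; omega
    · change update (update (scanSt _ _ _ _ _ _ _) Stk.qbak []) Stk.qry
        ((q.head?.toList ++ qb).reverse ++ q.tail) = _
      rw [update_scanSt_qbak, update_scanSt_qry, List.reverse_append, List.append_assoc]
      congr 2
      rw [← hq]
      cases q <;> simp
    · change 2 * fl.length + 4 + (2 * (q.head?.toList ++ qb).length + 1) ≤ _
      omega

/-- The search goes over one tuple of the database. Here `r` is the rest of the query. -/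
lemma exec_scan_entry (S : St) {u : List Token} (hu : eot ∉ u) {S' : St} {T : ℕ}
    (lg bk r qb fl fd : List Token)
    (hr : (∃ v, r = v ++ [eot] ∧ eot ∉ v) ∨ (r = [] ∧ fl ≠ []))
    (h : Exec (.loop .log scanBody) (scanSt S lg (eot :: u.reverse ++ bk) (qb.reverse ++ r) [] []
      (if fl = [] ∧ u ++ [eot] = r then one :: fd else fd)) S' T) :
    Exec (.loop .log scanBody) (scanSt S (u ++ eot :: lg) bk r qb fl fd) S'
      (T + 7 * u.length + 2 * fl.length + 2 * qb.length + 10) := by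
  induction u generalizing bk r qb fl with
  | nil =>
    refine .loop_cons (a := eot) (l := lg) (t := 2 * fl.length + 2 * qb.length + 8) rfl ?_ h ?_
    · rw [update_scanSt_log]
      refine (exec_scanBody_eot S lg bk r qb fl fd).to ?_ le_rfl
      have : (r.head? = some eot ∧ fl = []) ↔ (fl = [] ∧ [] ++ [eot] = r) := by
        rcases hr with ⟨v, hv, hs⟩ | ⟨hr, hf⟩
        · subst hv
          cases v with
          | nil => simp
          | cons b v =>
            have : b ≠ eot := fun h => hs (by simp [h])
            simp [this, this.symm]
        · simp [hr]
      simp only [this]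
      rfl
    · simp; omega
  | cons a u ih =>
    have ha : a ≠ eot := fun h => hu (by simp [h])
    refine .loop_cons (a := a) (l := u ++ eot :: lg) rfl
      (update_scanSt_log S _ bk r qb fl fd _ ▸ exec_scanBody_of_ne ha S _ bk r qb fl fd)
      (ih (fun h => hu (List.mem_cons_of_mem _ h)) (a :: bk) r.tail (r.head?.toList ++ qb)
        (if r.head? = some a then fl else one :: fl) ?_ ?_) ?_
    · rcases hr with ⟨v, hv, hs⟩ | ⟨hr, hf⟩
      · subst hv
        cases v with
        | nil => right; simp [ha.symm]
        | cons b v => left; exact ⟨v, by simp, fun h => hs (by simp [h])⟩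
      · right; simp [hr]
    · have e1 : (r.head?.toList ++ qb).reverse ++ r.tail = qb.reverse ++ r := by
        cases r <;> simp
      have e2 : (((if r.head? = some a then fl else one :: fl) = []) ∧ u ++ [eot] = r.tail) ↔
          (fl = [] ∧ (a :: u) ++ [eot] = r) := by
        cases r with
        | nil => simp
        | cons b r =>
          by_cases hab : b = a
          · subst hab; simp
          · simp [hab, Ne.symm hab]
      simp only [e1, e2]
      simpa using h
    · have h1 : (r.head?.toList ++ qb).length ≤ qb.length + 1 := by cases r <;> simp
      have h2 : (if r.head? = some a then fl else one :: fl).length ≤ fl.length + 1 := by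
        split_ifs <;> simp
      simp only [List.length_cons]
      omega

/-- A database as a word. -/
def encLog (D : List (List ℕ)) : List Token := D.flatMap encKey

lemma exec_scan_loop (S : St) (k : List ℕ) (D : List (List ℕ)) (bk fd : List Token) :
    ∃ fd', (fd' = [] ↔ fd = [] ∧ k ∉ D) ∧ fd'.length ≤ fd.length + D.length ∧
      Exec (.loop .log scanBody) (scanSt S (encLog D) bk (encKey k) [] [] fd)
        (scanSt S [] ((encLog D).reverse ++ bk) (encKey k) [] [] fd')
        (10 * (encLog D).length + 1) := by
  induction D generalizing bk fd with
  | nil => exact ⟨fd, by simp, by simp, .loop_nil rfl (by simp)⟩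
  | cons e D ih =>
    obtain ⟨u, hu, hs⟩ := encKey_eq e
    obtain ⟨fd', h1, h2, h3⟩ := ih (eot :: u.reverse ++ bk)
      (if u ++ [eot] = encKey k then one :: fd else fd)
    have hek : u ++ [eot] = encKey k ↔ k = e := by
      rw [← hu]
      exact ⟨fun h => (encKey_injective h).symm, fun h => by rw [h]⟩
    have he : encLog (e :: D) = u ++ eot :: encLog D := by
      rw [encLog, List.flatMap_cons, hu]; simp [encLog]
    refine ⟨fd', ?_, ?_, ?_⟩
    · rw [h1]
      by_cases h : k = e
      · rw [if_pos (hek.2 h)]; simp [h]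
      · rw [if_neg (fun h' => h (hek.1 h'))]; simp [h]
    · split_ifs at h2 <;> simp at h2 ⊢ <;> omega
    · obtain ⟨v, hv, hvs⟩ := encKey_eq k
      have := exec_scan_entry S hs (encLog D) bk (encKey k) [] [] fd (.inl ⟨v, hv, hvs⟩)
        (S' := scanSt S [] ((encLog (e :: D)).reverse ++ bk) (encKey k) [] [] fd')
        (T := 10 * (encLog D).length + 1) (by
          simp only [List.reverse_nil, List.nil_append, true_and]
          refine h3.to ?_ le_rfl
          rw [he]; simp)
      rw [he] at this ⊢
      refine this.mono ?_
      simp; omega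

/-- Push a Boolean value on the result stack. -/
def pushRes (b : Bool) : SP := .push .res (.bit b)

/-- Search the database for the tuple on the stack `qry`. -/
def scan : SP :=
  .seq (.loop .log scanBody) <| .seq (move .bak .log) <| .seq (clear .qry) <|
    .pop .fnd fun
      | none => pushRes false
      | some _ => .seq (clear .fnd) (pushRes true)

/-- The auxiliary stacks are empty. -/
structure Clean (S : St) : Prop where
  bak : S .bak = []
  qry : S .qry = []
  qbak : S .qbak = []
  flag : S .flag = []
  fnd : S .fnd = []

lemma length_le_encLog (D : List (List ℕ)) : D.length ≤ (encLog D).length := by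
  induction D with
  | nil => simp
  | cons e D ih =>
    obtain ⟨u, hu, _⟩ := encKey_eq e
    simp only [encLog, List.flatMap_cons, List.length_append, List.length_cons, hu] at ih ⊢
    simp at ih ⊢; omega

open Classical in
lemma exec_scan {S : St} (hS : Clean S) {D : List (List ℕ)} (hD : S .log = encLog D)
    (k : List ℕ) :
    Exec scan (update S .qry (encKey k))
      (update S .res (.bit (decide (k ∈ D)) :: S .res))
      (14 * (encLog D).length + 2 * (encKey k).length + 10) := by
  obtain ⟨fd, h1, h2, h3⟩ := exec_scan_loop S k D [] []
  have hlen := length_le_encLog D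
  have e0 : update S .qry (encKey k) = scanSt S (encLog D) [] (encKey k) [] [] [] := by
    conv_lhs => rw [← scanSt_self S]
    rw [update_scanSt_qry, hD, hS.bak, hS.qbak, hS.flag, hS.fnd]
  have e1 : scanSt S (encLog D) [] [] [] [] [] = S := by
    conv_rhs => rw [← scanSt_self S]
    rw [hD, hS.bak, hS.qbak, hS.flag, hS.fnd, hS.qry]
  rw [e0]
  refine .to (.seq h3 (.seq (.to (exec_move (by simp) _)
    (S'' := scanSt S (encLog D) [] (encKey k) [] [] fd) ?_ le_rfl)
    (.seq (.to (exec_clear _ _) (S'' := scanSt S (encLog D) [] [] [] [] fd) ?_ le_rfl)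
      (.pop (t := 2 * D.length + 1)
        (S' := update S .res (.bit (decide (k ∈ D)) :: S .res)) ?_ le_rfl) le_rfl) le_rfl)
        le_rfl) rfl ?_
  · change update (update (scanSt _ _ _ _ _ _ _) Stk.bak []) Stk.log
      (((encLog D).reverse ++ []).reverse ++ []) = _
    rw [update_scanSt_bak, update_scanSt_log]; simp
  · rw [update_scanSt_qry]
  · cases fd with
    | nil =>
      have hk : k ∉ D := (h1.1 rfl).2
      change Exec (pushRes false) (update (scanSt _ _ _ _ _ _ _) Stk.fnd []) _ _
      rw [update_scanSt_fnd, e1]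
      refine .to (.push (t := 0)) (by simp [hk]) (Nat.zero_le _)
    | cons b f =>
      have hk : k ∈ D := by
        by_contra h
        have := h1.2 ⟨rfl, h⟩
        simp at this
      change Exec (.seq (clear .fnd) (pushRes true)) (update (scanSt _ _ _ _ _ _ _) Stk.fnd f) _ _
      refine .to (.seq (exec_clear _ _) (.push (t := 0)) le_rfl) ?_ ?_
      · rw [update_idem, update_scanSt_fnd, e1]; simp [hk]
      · rw [update_self]
        simp at h2 ⊢; omega
  · change _ + (2 * ((encLog D).reverse ++ []).length + 1 + (2 * (encKey k).length + 1 + _)) ≤ _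
    simp; omega

/-- Compare the numbers on the stacks `qry` and `qbak`. -/
def compareLe : SP :=
  .seq (.loop .qry fun _ => .pop .qbak fun | none => .push .flag one | some _ => .skip) <|
  .seq (clear .qbak) <|
    .pop .flag fun
      | none => pushRes true
      | some _ => .seq (clear .flag) (pushRes false)

lemma exec_compareLoop (S : St) (lg bk fl fd : List Token) (a b : ℕ) :
    Exec (.loop .qry fun _ => .pop .qbak fun | none => .push .flag one | some _ => .skip : SP)
      (scanSt S lg bk (un a) (un b) fl fd)
      (scanSt S lg bk [] (un (b - a)) (un (a - b) ++ fl) fd) (3 * a + 1) := by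
  induction a generalizing b fl with
  | zero => refine .to (.loop_nil rfl le_rfl) (by simp [un]) le_rfl
  | succ a ih =>
    cases b with
    | zero =>
      refine .loop_cons (a := one) (l := un a) rfl (.pop (.push (t := 0)) le_rfl) (t' := 3 * a + 1)
        (S'' := scanSt S lg bk [] (un (0 - (a + 1))) (un (a + 1 - 0) ++ fl) fd)
        (.to (S' := scanSt S lg bk [] (un (0 - a)) (un (a - 0) ++ one :: fl) fd) ?_ ?_ le_rfl)
        (by omega)
      · refine cast ?_ (ih (one :: fl) 0)
        congr 1
        change _ = update (update (update (scanSt _ _ _ _ _ _ _) Stk.qry (un a)) Stk.qbak [])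
          Stk.flag (one :: fl)
        rw [update_scanSt_qry, update_scanSt_qbak, update_scanSt_flag]; rfl
      · simp [un, List.replicate_succ']
    | succ b =>
      refine .loop_cons (a := one) (l := un a) rfl (.pop (.skip (t := 0)) le_rfl) (t' := 3 * a + 1)
        (S'' := scanSt S lg bk [] (un (b + 1 - (a + 1))) (un (a + 1 - (b + 1)) ++ fl) fd)
        (.to (S' := scanSt S lg bk [] (un (b - a)) (un (a - b) ++ fl) fd) ?_ ?_ le_rfl)
        (by omega)
      · refine cast ?_ (ih fl b)
        congr 1
        change _ = update (update (scanSt _ _ _ _ _ _ _) Stk.qry (un a)) Stk.qbak (un b)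
        rw [update_scanSt_qry, update_scanSt_qbak]
      · simp [un]

lemma exec_compareLe {S : St} (hS : Clean S) (a b : ℕ) :
    Exec compareLe (update (update S .qry (un a)) .qbak (un b))
      (update S .res (.bit (decide (a ≤ b)) :: S .res)) (5 * a + 2 * b + 10) := by
  have e0 : update (update S .qry (un a)) .qbak (un b) =
      scanSt S (S .log) [] (un a) (un b) [] [] := by
    conv_lhs => rw [← scanSt_self S]
    rw [update_scanSt_qry, update_scanSt_qbak, hS.bak, hS.flag, hS.fnd]
  have e1 : scanSt S (S .log) [] [] [] [] [] = S := by
    conv_rhs => rw [← scanSt_self S]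
    rw [hS.bak, hS.qbak, hS.flag, hS.fnd, hS.qry]
  rw [e0]
  refine .seq (exec_compareLoop S _ _ _ _ a b) (.seq
    (.to (exec_clear _ _) (S'' := scanSt S (S .log) [] [] [] (un (a - b)) []) ?_ le_rfl)
      (.pop (t := 2 * a + 1) (S' := update S .res (.bit (decide (a ≤ b)) :: S .res)) ?_ le_rfl)
      le_rfl) ?_
  · rw [update_scanSt_qbak, List.append_nil]
  · rcases h : a - b with _ | c
    · change Exec (pushRes true) (update (scanSt _ _ _ _ _ _ _) Stk.flag []) _ _
      rw [update_scanSt_flag, e1]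
      have : a ≤ b := by omega
      exact .to (.push (t := 0)) (by simp [this]) (by omega)
    · change Exec (.seq (clear .flag) (pushRes false))
        (update (scanSt _ _ _ _ _ _ _) Stk.flag (un c)) _ _
      refine .to (.seq (exec_clear _ _) (.push (t := 0)) le_rfl) ?_ ?_
      · have : ¬ a ≤ b := by omega
        rw [update_idem, update_scanSt_flag, e1]; simp [this]
      · simp; omega
  · change _ + (2 * (un (b - a)).length + 1 + _) ≤ _
    simp; omega

end Implementation

/-! ### Executing formulae and commands -/

namespace Implementation

open StackProg Function

/-- Run `body` for all values of `x` below the number on the stack `len`, in ascending order. -/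
def forLoop (x : Var) (body : SP) : SP :=
  .seq (copy .len (.cnt x)) <|
  .seq (.loop (.cnt x) fun _ => .seq body (.push (.val x) one)) (clear (.val x))

section
variable {x : Var} {body : SP} {N T : ℕ} {F : ℕ → St}

lemma exec_forLoop_aux (hc : ∀ i ≤ N, F i (.cnt x) = [])
    (hstep : ∀ i < N, ∀ j, Exec body (update (update (F i) (.cnt x) (un j)) (.val x) (un i))
      (update (update (F (i + 1)) (.cnt x) (un j)) (.val x) (un i)) T) (j i : ℕ) (hij : i + j = N) :
    Exec (.loop (.cnt x) fun _ => .seq body (.push (.val x) one))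
      (update (update (F i) (.cnt x) (un j)) (.val x) (un i))
      (update (F N) (.val x) (un N)) (j * (T + 2) + 1) := by
  induction j generalizing i with
  | zero =>
    obtain rfl : i = N := by omega
    have : update (F i) (.cnt x) (un 0) = F i := by
      rw [show un 0 = F i (.cnt x) from (hc i le_rfl).symm, update_eq_self]
    rw [this]
    exact .loop_nil (by rw [update_of_ne (by simp), hc i le_rfl]) (by simp)
  | succ j ih =>
    have e : update (update (update (F i) (.cnt x) (un (j + 1))) (.val x) (un i)) (.cnt x) (un j) =
        update (update (F i) (.cnt x) (un j)) (.val x) (un i) := by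
      rw [update_comm (by simp), update_idem]
    refine .loop_cons (a := one) (l := un j) (t := T) (t' := j * (T + 2) + 1)
      (S' := update (update (F (i + 1)) (.cnt x) (un j)) (.val x) (un (i + 1)))
      (by simp [List.replicate_succ]) ?_ (ih (i + 1) (by omega)) (by rw [Nat.succ_mul]; omega)
    rw [e]
    refine .to (.seq (hstep i (by omega) j) (.push (t := 0)) le_rfl) ?_ le_rfl
    rw [update_idem, update_self]
    rfl

lemma exec_forLoop (hc : ∀ i ≤ N, F i (.cnt x) = []) (hv : ∀ i ≤ N, F i (.val x) = [])
    (hl : F 0 .len = un N) (ht : F 0 .tmp = [])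
    (hstep : ∀ i < N, ∀ j, Exec body (update (update (F i) (.cnt x) (un j)) (.val x) (un i))
      (update (update (F (i + 1)) (.cnt x) (un j)) (.val x) (un i)) T) :
    Exec (forLoop x body) (F 0) (F N) (N * (T + 8) + 4) := by
  have h1 := exec_forLoop_aux hc hstep N 0 (by omega)
  have e1 : update (update (F 0) (.cnt x) (un N)) (.val x) (un 0) =
      update (F 0) (.cnt x) (un N ++ F 0 (.cnt x)) := by
    rw [hc 0 (Nat.zero_le _), List.append_nil]
    conv_rhs => rw [← update_eq_self (.val x) (update (F 0) (.cnt x) (un N))]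
    rw [update_of_ne (show Stk.val x ≠ .cnt x by simp), hv 0 (Nat.zero_le _)]
    rfl
  rw [e1] at h1
  refine .to (.seq (exec_copy hl ht (by simp) (by simp) (by simp)) (.seq h1 (exec_clear _ _) le_rfl)
    le_rfl) ?_ ?_
  · rw [update_idem]
    conv_rhs => rw [← update_eq_self (.val x) (F N), hv N le_rfl]
  · simp; ring_nf; omega

end

/-- The number of a token, which is also the symbol of the relation of the positions of this
token. -/
def _root_.Token.code : Token → ℕ
  | .bit false => 0
  | .bit true => 1
  | .sep => 2
  | .item => 3
  | .neg => 4
  | .conj => 5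
  | .next => 6
  | .untl => 7

/-- Evaluate a formula and push the truth value on the result stack. -/
def evalForm : Form → SP
  | .mem tag ts => .seq (writeKey .qry (.const tag :: ts)) scan
  | .le s t => .seq (writeTerm .qry s) (.seq (writeTerm .qbak t) compareLe)
  | .neg φ => .seq (evalForm φ)
      (.pop .res fun o => if o = some (.bit true) then pushRes false else pushRes true)
  | .conj φ ψ => .seq (evalForm φ)
      (.pop .res fun o => if o = some (.bit true) then evalForm ψ else pushRes false)
  | .ex x φ => .seq (pushRes false) <| forLoop x <| .seq (evalForm φ) <|
      .pop .res fun o =>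
        if o = some (.bit true) then .pop .res (fun _ => pushRes true) else .skip

/-- Execute a command. -/
def runCmd : Cmd → SP
  | .ins tag ts => writeKey .log (.const tag :: ts)
  | .test φ s => .seq (evalForm φ)
      (.pop .res fun o => if o = some (.bit true) then runCmd s else .skip)
  | .loop x s => forLoop x (runCmd s)
  | .seq s s' => .seq (runCmd s) (runCmd s')

/-- The stacks represent an input of length `N`, the assignment `ρ` and the database `D`. -/
structure Env (S : St) (N : ℕ) (ρ : Var → ℕ) (D : List (List ℕ)) : Prop where
  vals : Vals S ρ
  clean : Clean S
  len : S .len = un N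
  log : S .log = encLog D

lemma Env.update_res {S : St} {N : ℕ} {ρ : Var → ℕ} {D : List (List ℕ)} (h : Env S N ρ D)
    (l : List Token) : Env (update S .res l) N ρ D :=
  ⟨⟨by simp [h.vals.tmp], by simp [h.vals.aux], by simp [h.vals.val]⟩,
   ⟨by simp [h.clean.bak], by simp [h.clean.qry], by simp [h.clean.qbak],
    by simp [h.clean.flag], by simp [h.clean.fnd]⟩, by simp [h.len], by simp [h.log]⟩

lemma Env.update_log {S : St} {N : ℕ} {ρ : Var → ℕ} {D : List (List ℕ)} (h : Env S N ρ D)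
    (D' : List (List ℕ)) : Env (update S .log (encLog D')) N ρ D' :=
  ⟨⟨by simp [h.vals.tmp], by simp [h.vals.aux], by simp [h.vals.val]⟩,
   ⟨by simp [h.clean.bak], by simp [h.clean.qry], by simp [h.clean.qbak],
    by simp [h.clean.flag], by simp [h.clean.fnd]⟩, by simp [h.len], by simp⟩

lemma Env.update_var {S : St} {N : ℕ} {ρ : Var → ℕ} {D : List (List ℕ)} (h : Env S N ρ D)
    (x : Var) (i : ℕ) (l : List Token) :
    Env (update (update S (.cnt x) l) (.val x) (un i)) N (update ρ x i) D :=
  ⟨⟨by simp [h.vals.tmp], by simp [h.vals.aux], fun y => by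
      by_cases hy : y = x
      · subst hy; simp
      · simp [hy, h.vals.val]⟩,
   ⟨by simp [h.clean.bak], by simp [h.clean.qry], by simp [h.clean.qbak],
    by simp [h.clean.flag], by simp [h.clean.fnd]⟩, by simp [h.len], by simp [h.log]⟩

lemma isOut_qry : IsOut .qry := ⟨by simp, by simp, by simp⟩
lemma isOut_qbak : IsOut .qbak := ⟨by simp, by simp, by simp⟩
lemma isOut_log : IsOut .log := ⟨by simp, by simp, by simp⟩

/-- The stacks of the given variables are free for use. -/
def Free (S : St) (l : List Var) : Prop := ∀ x ∈ l, S (.val x) = [] ∧ S (.cnt x) = []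

lemma Free.update_var {S : St} {l : List Var} {x : Var} (h : Free S (x :: l)) (hx : x ∉ l)
    (a b : List Token) : Free (update (update S (.cnt x) a) (.val x) b) l := by
  intro y hy
  have hyx : y ≠ x := fun h => hx (h ▸ hy)
  simpa [hyx] using h y (List.mem_cons_of_mem _ hy)

lemma Free.update_of_ne {S : St} {l : List Var} (h : Free S l) {k : Stk}
    (h1 : ∀ x, k ≠ .val x) (h2 : ∀ x, k ≠ .cnt x) (a : List Token) : Free (update S k a) l := by
  intro y hy
  rw [Function.update_of_ne (h1 y).symm, Function.update_of_ne (h2 y).symm]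
  exact h y hy

lemma update_var_le {ρ : Var → ℕ} {N : ℕ} (h : ∀ x, ρ x ≤ N) (x : Var) {i : ℕ} (hi : i ≤ N) :
    ∀ y, update ρ x i y ≤ N := by
  intro y
  by_cases hy : y = x
  · subst hy; simpa using hi
  · simpa [hy] using h y

open Classical in
/-- The formula evaluator is correct and runs in time polynomial in the length of the input and
the size of the database. -/
theorem exec_evalForm (φ : Form) (hφ : φ.Proper) : ∃ P : Polynomial ℕ,
    ∀ (N : ℕ) (ρ : Var → ℕ) (D : List (List ℕ)) (S : St), Env S N ρ D → (∀ x, ρ x ≤ N) →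
      Free S φ.bound →
      Exec (evalForm φ) S
        (update S .res (.bit (decide (φ.Holds N (relOf D) ρ)) :: S .res))
        (P.eval (N + (encLog D).length)) := by
  induction φ with
  | mem tag ts =>
    obtain ⟨P, hP⟩ := exec_writeKey isOut_qry (.const tag :: ts)
    obtain ⟨Q, hQ⟩ := exists_length_encKey_le (.const tag :: ts)
    refine ⟨P + (14 * .X + 2 * Q + 10), fun N ρ D S hS hρ _ => ?_⟩
    have h1 := hP N ρ S hS.vals hρ
    rw [hS.clean.qry, List.append_nil] at h1
    refine .to (.seq h1 (exec_scan hS.clean hS.log _) le_rfl) ?_ ?_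
    · exact congrArg (fun b => update S .res (.bit b :: S .res)) (decide_eq_decide.2 Iff.rfl)
    · have h2 := hQ N ρ hρ
      have h3 := eval_mono P (show N ≤ N + (encLog D).length by omega)
      have h4 := eval_mono Q (show N ≤ N + (encLog D).length by omega)
      simp only [Polynomial.eval_add, Polynomial.eval_mul, Polynomial.eval_X,
        Polynomial.eval_ofNat]
      omega
  | le s t =>
    obtain ⟨P, hP⟩ := exec_writeTerm isOut_qry s
    obtain ⟨Q, hQ⟩ := exec_writeTerm isOut_qbak t
    refine ⟨P + (Q + (5 * s.bnd + 2 * t.bnd + 10)), fun N ρ D S hS hρ _ => ?_⟩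
    have h1 := hP N ρ S hS.vals hρ
    have h2 := hQ N ρ _ (hS.vals.update isOut_qry (un (s.val ρ))) hρ
    rw [hS.clean.qry, List.append_nil] at h1
    rw [Function.update_of_ne (by simp), hS.clean.qbak, List.append_nil] at h2
    refine .to (.seq h1 (.seq h2 (exec_compareLe hS.clean _ _) le_rfl) le_rfl) ?_ ?_
    · exact congrArg (fun b => update S .res (.bit b :: S .res)) (decide_eq_decide.2 Iff.rfl)
    · have h3 := eval_mono P (show N ≤ N + (encLog D).length by omega)
      have h4 := eval_mono Q (show N ≤ N + (encLog D).length by omega)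
      have h5 := (val_le_bnd hρ s).trans (eval_mono _ (show N ≤ N + (encLog D).length by omega))
      have h6 := (val_le_bnd hρ t).trans (eval_mono _ (show N ≤ N + (encLog D).length by omega))
      simp only [Polynomial.eval_add, Polynomial.eval_mul, Polynomial.eval_ofNat]
      omega
  | neg φ ih =>
    obtain ⟨P, hP⟩ := ih hφ
    refine ⟨P + 1, fun N ρ D S hS hρ hf => ?_⟩
    refine .to (.seq (hP N ρ D S hS hρ hf) (.pop (t := 0) (S' := update S .res (.bit (decide
      (Form.Holds N (relOf D) ρ (.neg φ))) :: S .res)) ?_ le_rfl) le_rfl) rfl (by simp)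
    rw [update_self, update_idem, List.head?_cons, List.tail_cons, update_eq_self]
    by_cases h : φ.Holds N (relOf D) ρ
    · simp only [h, Form.Holds, decide_true, if_true, not_true, decide_false]; exact .push
    · simp only [h, Form.Holds, decide_false, Option.some.injEq, Token.bit.injEq, not_false_eq_true,
        Bool.false_eq_true, if_false, decide_true]; exact .push
  | conj φ ψ ih ih' =>
    obtain ⟨P, hP⟩ := ih hφ.1
    obtain ⟨Q, hQ⟩ := ih' hφ.2
    refine ⟨P + (Q + 1), fun N ρ D S hS hρ hf => ?_⟩
    refine .to (.seq (hP N ρ D S hS hρ fun x hx => hf x (List.mem_append_left _ hx))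
      (.pop (t := Q.eval (N + (encLog D).length)) (S' := update S .res (.bit (decide
      (Form.Holds N (relOf D) ρ (.conj φ ψ))) :: S .res)) ?_ le_rfl) le_rfl) rfl (by simp)
    rw [update_self, update_idem, List.head?_cons, List.tail_cons, update_eq_self]
    by_cases h : φ.Holds N (relOf D) ρ
    · simp only [h, Form.Holds, decide_true, if_true, true_and]
      exact hQ N ρ D S hS hρ fun x hx => hf x (List.mem_append_right _ hx)
    · simp only [h, Form.Holds, decide_false, Option.some.injEq, Token.bit.injEq,
        Bool.false_eq_true, if_false, false_and]; exact .push
  | ex x φ ih =>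
    obtain ⟨P, hP⟩ := ih hφ.2
    refine ⟨.X * (P + 10) + 4, fun N ρ D S hS hρ hf => ?_⟩
    let F : ℕ → St := fun i => update S .res
      (.bit (decide (∃ j < i, φ.Holds N (relOf D) (update ρ x j))) :: S .res)
    have hx := hf x List.mem_cons_self
    have e0 : update S .res (.bit false :: S .res) = F 0 := by simp [F]
    have hloop : Exec (forLoop x <| .seq (evalForm φ) <| .pop .res fun o =>
        if o = some (.bit true) then .pop .res (fun _ => pushRes true) else .skip) (F 0) (F N)
        (N * (P.eval (N + (encLog D).length) + 2 + 8) + 4) := by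
      refine exec_forLoop ?_ ?_ ?_ ?_ ?_
      · simp [F, hx]
      · simp [F, hx]
      · simp [F, hS.len]
      · simp [F, hS.vals.tmp]
      · intro i hi j
        have hE : Env (update (update (F i) (.cnt x) (un j)) (.val x) (un i)) N (update ρ x i) D :=
          (hS.update_res _).update_var x i _
        have hFr : Free (update (update (F i) (.cnt x) (un j)) (.val x) (un i)) φ.bound :=
          (hf.update_of_ne (by simp) (by simp) _).update_var hφ.1 _ _
        refine .to (.seq (hP N _ D _ hE (update_var_le hρ x hi.le) hFr)
          (.pop (t := 1) (S' := update (update (F (i + 1)) (.cnt x) (un j)) (.val x) (un i))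
            ?_ le_rfl) le_rfl) rfl le_rfl
        rw [update_self, update_idem, List.head?_cons, List.tail_cons, update_eq_self]
        by_cases h : φ.Holds N (relOf D) (update ρ x i)
        · simp only [h, decide_true, if_true]
          refine .to (.pop (.push (t := 0)) le_rfl) ?_ le_rfl
          have h2 : ∃ k < i + 1, φ.Holds N (relOf D) (update ρ x k) := ⟨i, by omega, h⟩
          funext k
          cases k <;> simp [F, update_apply]
          exact ⟨i, le_rfl, h⟩
        · simp only [h, decide_false, Option.some.injEq, Token.bit.injEq, Bool.false_eq_true,
            if_false]
          have h2 : (∃ k < i + 1, φ.Holds N (relOf D) (update ρ x k)) ↔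
              ∃ k < i, φ.Holds N (relOf D) (update ρ x k) := by
            constructor
            · rintro ⟨k, hk, hh⟩
              refine ⟨k, ?_, hh⟩
              rcases Nat.lt_succ_iff_lt_or_eq.1 hk with hk | rfl
              · exact hk
              · exact absurd hh h
            · rintro ⟨k, hk, hh⟩
              exact ⟨k, by omega, hh⟩
          simp only [F, h2]
          exact .skip
    rw [← e0] at hloop
    refine .to (.seq (.push (t := 0)) hloop le_rfl)
      (congrArg (fun b => update S .res (.bit b :: S .res)) (decide_eq_decide.2 Iff.rfl)) ?_
    · simp only [Polynomial.eval_add, Polynomial.eval_mul, Polynomial.eval_X,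
        Polynomial.eval_ofNat]
      have : N * (P.eval (N + (encLog D).length) + 10) ≤
        (N + (encLog D).length) * (P.eval (N + (encLog D).length) + 10) := by gcongr; omega
      change 0 + (N * (P.eval (N + (encLog D).length) + 10) + 4) ≤ _
      omega

lemma length_encLog_cons (k : List ℕ) (D : List (List ℕ)) :
    (encLog (k :: D)).length = (encKey k).length + (encLog D).length := by
  simp [encLog]

open Classical in
/-- The interpreter is correct, runs in polynomial time, and the database grows by a polynomial
amount in the length of the input only. -/
theorem exec_runCmd (s : Cmd) (hs : s.Proper) : ∃ P Q : Polynomial ℕ,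
    ∀ (N : ℕ) (ρ : Var → ℕ) (D : List (List ℕ)) (S : St), Env S N ρ D → (∀ x, ρ x ≤ N) →
      Free S s.bound →
      (encLog (s.eval N ρ D)).length ≤ (encLog D).length + Q.eval N ∧
      Exec (runCmd s) S (update S .log (encLog (s.eval N ρ D)))
        (P.eval (N + (encLog D).length)) := by
  induction s with
  | ins tag ts =>
    obtain ⟨P, hP⟩ := exec_writeKey isOut_log (.const tag :: ts)
    obtain ⟨Q, hQ⟩ := exists_length_encKey_le (.const tag :: ts)
    refine ⟨P, Q, fun N ρ D S hS hρ _ => ⟨?_, ?_⟩⟩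
    · have := hQ N ρ hρ
      rw [Cmd.eval, length_encLog_cons]
      simp only [List.map_cons, Term.val] at this
      omega
    · refine (hP N ρ S hS.vals hρ).to ?_ (eval_mono P (by omega))
      rw [hS.log]
      rfl
  | test φ s ih =>
    obtain ⟨P, hP⟩ := exec_evalForm φ hs.1
    obtain ⟨P', Q, hP'⟩ := ih hs.2
    refine ⟨P + (P' + 1), Q, fun N ρ D S hS hρ hf => ?_⟩
    have h1 := hP N ρ D S hS hρ fun x hx => hf x (List.mem_append_left _ hx)
    have h2 := hP' N ρ D S hS hρ fun x hx => hf x (List.mem_append_right _ hx)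
    refine ⟨?_, .to (.seq h1 (.pop (t := P'.eval (N + (encLog D).length))
      (S' := update S .log (encLog (Cmd.eval N (.test φ s) ρ D))) ?_ le_rfl) le_rfl) rfl (by simp)⟩
    · rw [Cmd.eval]
      split_ifs
      · exact h2.1
      · omega
    · rw [update_self, update_idem, List.head?_cons, List.tail_cons, update_eq_self]
      by_cases h : φ.Holds N (relOf D) ρ
      · simp only [h, decide_true, if_true, Cmd.eval]
        exact h2.2
      · simp only [h, decide_false, Option.some.injEq, Token.bit.injEq, Bool.false_eq_true,
          if_false, Cmd.eval]
        rw [← hS.log, update_eq_self]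
        exact .skip
  | loop x s ih =>
    obtain ⟨P, Q, hP⟩ := ih hs.2
    refine ⟨.X * (P.comp (.X + .X * Q) + 8) + 4, .X * Q, fun N ρ D S hS hρ hf => ?_⟩
    let E : ℕ → List (List ℕ) := fun i =>
      Nat.rec D (fun i D' => s.eval N (update ρ x i) D') i
    let F : ℕ → St := fun i => update S .log (encLog (E i))
    have hE : ∀ i j, Env (update (update (F i) (.cnt x) (un j)) (.val x) (un i)) N
        (update ρ x i) (E i) := fun i j => (hS.update_log _).update_var x i _
    have hFr : ∀ i j, Free (update (update (F i) (.cnt x) (un j)) (.val x) (un i)) s.bound :=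
      fun i j => (hf.update_of_ne (by simp) (by simp) _).update_var hs.1 _ _
    have hlen : ∀ i ≤ N, (encLog (E i)).length ≤ (encLog D).length + i * Q.eval N := by
      intro i
      induction i with
      | zero => intro _; simp [E]
      | succ i ihi =>
        intro hi
        have h1 := (hP N _ (E i) _ (hE i 0) (update_var_le hρ x (by omega)) (hFr i 0)).1
        have h2 := ihi (by omega)
        have h3 : E (i + 1) = s.eval N (update ρ x i) (E i) := rfl
        rw [h3]
        ring_nf at h1 h2 ⊢
        omega
    have hx := hf x List.mem_cons_self
    have e0 : F 0 = S := by
      change update S .log (encLog D) = S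
      rw [← hS.log, update_eq_self]
    refine ⟨?_, ?_⟩
    · rw [Polynomial.eval_mul, Polynomial.eval_X]
      exact hlen N le_rfl
    · have h1 : Exec (forLoop x (runCmd s)) (F 0) (F N)
          (N * (P.eval (N + ((encLog D).length + N * Q.eval N)) + 8) + 4) := by
        refine exec_forLoop ?_ ?_ ?_ ?_ ?_
        · simp [F, hx]
        · simp [F, hx]
        · simp [F, hS.len]
        · simp [F, hS.vals.tmp]
        · intro i hi j
          refine (hP N _ (E i) _ (hE i j) (update_var_le hρ x hi.le) (hFr i j)).2.to ?_
            (eval_mono P ?_)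
          · funext k
            cases k <;> simp [F, update_apply, E]
          · have h1 := hlen i hi.le
            have h2 : i * Q.eval N ≤ N * Q.eval N := by gcongr
            omega
      rw [e0] at h1
      refine h1.to rfl ?_
      simp only [Polynomial.eval_add, Polynomial.eval_mul, Polynomial.eval_X, Polynomial.eval_comp,
        Polynomial.eval_ofNat]
      have h2 : Q.eval N ≤ Q.eval (N + (encLog D).length) := eval_mono Q (by omega)
      have h3 : N + ((encLog D).length + N * Q.eval N) ≤
          N + (encLog D).length + (N + (encLog D).length) * Q.eval (N + (encLog D).length) := by
        rw [← Nat.add_assoc]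
        gcongr
        omega
      have h4 := eval_mono P h3
      gcongr
      omega
  | seq s s' ih ih' =>
    obtain ⟨P, Q, hP⟩ := ih hs.1
    obtain ⟨P', Q', hP'⟩ := ih' hs.2
    refine ⟨P + P'.comp (.X + Q), Q + Q', fun N ρ D S hS hρ hf => ?_⟩
    have h1 := hP N ρ D S hS hρ fun x hx => hf x (List.mem_append_left _ hx)
    have h2 := hP' N ρ (s.eval N ρ D) _ (hS.update_log _) hρ
      (Free.update_of_ne (fun x hx => hf x (List.mem_append_right _ hx)) (by simp) (by simp) _)
    refine ⟨?_, .to (.seq h1.2 h2.2 le_rfl) ?_ ?_⟩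
    · have h3 := h1.1
      have h4 := h2.1
      simp only [Cmd.eval, Polynomial.eval_add]
      omega
    · rw [update_idem]; rfl
    · simp only [Polynomial.eval_add, Polynomial.eval_comp, Polynomial.eval_X]
      have h3 : Q.eval N ≤ Q.eval (N + (encLog D).length) := eval_mono Q (by omega)
      have h4 : N + (encLog (s.eval N ρ D)).length ≤
          N + (encLog D).length + Q.eval (N + (encLog D).length) := by
        have := h1.1
        omega
      have h5 := eval_mono P' h4
      omega

/-- The database with the tuples `(code a, i)` for the tokens `a` of the input at the positions
`i`, where the first position is `i`. -/
def _root_.inputDB : ℕ → List Token → List (List ℕ) → List (List ℕ)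
  | _, [], D => D
  | i, a :: w, D => inputDB (i + 1) w ([a.code, i] :: D)

/-- Read the input into the database. -/
def readInput : SP :=
  .loop .inp fun a => .seq (.push .log eot) <| .seq (.push .log .sep) <| .seq (copy .len .log) <|
    .seq (.push .log .sep) <| .seq (pushUn .log a.code) (.push .len one)

/-- The stacks hold the unread part of the input, its position, and the database. -/
def inputSt (w : List Token) (i : ℕ) (D : List (List ℕ)) : St
  | .inp => w
  | .len => un i
  | .log => encLog D
  | _ => []

lemma exec_readInput (w : List Token) (i : ℕ) (D : List (List ℕ)) :
    Exec readInput (inputSt w i D) (inputSt [] (i + w.length) (inputDB i w D))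
      (w.length * (4 * (i + w.length) + 4) + 1) ∧
    (encLog (inputDB i w D)).length ≤ (encLog D).length + w.length * (i + w.length + 10) := by
  induction w generalizing i D with
  | nil => exact ⟨.loop_nil rfl (by simp), by simp [inputDB]⟩
  | cons a w ih =>
    obtain ⟨h1, h2⟩ := ih (i + 1) ([a.code, i] :: D)
    refine ⟨.loop_cons (t := 4 * i + 2) (S' := inputSt w (i + 1) ([a.code, i] :: D))
      (a := a) (l := w) rfl ?_ (t' := w.length * (4 * (i + 1 + w.length) + 4) + 1) ?_ ?_, ?_⟩
    · refine .to (.seq (.push (t := 0)) (.seq (.push (t := 0)) (.seq (exec_copy (n := i) ?_ ?_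
        (by simp) (by simp) (by simp)) (.seq (.push (t := 0)) (.seq (exec_pushUn _ _ _)
          (.push (t := 0)) le_rfl) le_rfl) le_rfl) le_rfl) le_rfl) ?_ (by omega)
      · simp [inputSt]
      · simp [inputSt]
      · funext k
        cases k <;> simp [inputSt, encLog, encKey, List.replicate_succ]
    · have : i + (a :: w).length = i + 1 + w.length := by simp; omega
      rw [this]
      exact h1
    · simp only [List.length_cons]; ring_nf; omega
    · rw [inputDB]
      refine h2.trans ?_
      have : (encKey [a.code, i]).length ≤ i + 10 := by
        have : a.code ≤ 7 := by
          cases a with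
          | bit b => cases b <;> simp [Token.code]
          | _ => simp [Token.code]
        simp [encKey]; omega
      rw [length_encLog_cons, List.length_cons]
      ring_nf
      omega

lemma relOf_inputDB (w : List Token) (i : ℕ) (D : List (List ℕ)) (tag : ℕ) (args : List ℕ) :
    relOf (inputDB i w D) tag args ↔
      relOf D tag args ∨ ∃ j a, w[j]? = some a ∧ tag = a.code ∧ args = [i + j] := by
  induction w generalizing i D with
  | nil => simp [inputDB]
  | cons b w ih =>
    rw [inputDB, ih]
    constructor
    · rintro (h | ⟨j, a, h1, h2, h3⟩)
      · rcases List.mem_cons.1 h with h | h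
        · right
          obtain ⟨h1, h2⟩ := List.cons.inj h
          exact ⟨0, b, rfl, h1, h2⟩
        · exact .inl h
      · exact .inr ⟨j + 1, a, by simpa using h1, h2, by rw [h3]; congr 1; omega⟩
    · rintro (h | ⟨j, a, h1, h2, h3⟩)
      · exact .inl (List.mem_cons_of_mem _ h)
      · cases j with
        | zero =>
          obtain rfl : b = a := by simpa using h1
          exact .inl (List.mem_cons.2 (.inl (by rw [h2, h3]; simp)))
        | succ j => exact .inr ⟨j, a, by simpa using h1, h2, by rw [h3]; congr 1; omega⟩

/-- Read the input, run the command, evaluate the formula, and tidy up. -/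
def mainProg (s : Cmd) (φ : Form) : SP :=
  .seq readInput <| .seq (runCmd s) <| .seq (evalForm φ) <| .seq (clear .len) (clear .log)

open Classical in
/-- A problem is decidable in polynomial time if a command and a formula of the language of bounded
loops solve it. -/
theorem _root_.polyTimeDecidable_of_cmd {α : Type} (s : Cmd) (φ : Form) (hs : s.Proper)
    (hφ : φ.Proper) (enc : α → List Token) (P : α → Prop)
    (h : ∀ x, φ.Holds (enc x).length
      (relOf (s.eval (enc x).length (fun _ => 0) (inputDB 0 (enc x) []))) (fun _ => 0) ↔ P x) :
    PolyTimeDecidable enc P := by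
  obtain ⟨P₁, Q₁, h₁⟩ := exec_runCmd s hs
  obtain ⟨P₂, h₂⟩ := exec_evalForm φ hφ
  obtain ⟨R, hR⟩ : ∃ R : Polynomial ℕ, ∀ N, R.eval N = N + N * (N + 10) :=
    ⟨.X + .X * (.X + 10), by simp⟩
  refine polyTimeDecidable (mainProg s φ) .inp .res (fun o => o = some (.bit true)) enc P
    (.X * (4 * .X + 4) + 1 + P₁.comp R + P₂.comp (R + Q₁) + 2 * .X + 2 * (R + Q₁) + 2) ?_
  intro x
  refine ⟨.bit (decide (P x)), by simp, ?_⟩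
  set w := enc x
  set N := w.length
  obtain ⟨hr, hlen⟩ := exec_readInput w 0 []
  set D := inputDB 0 w []
  have e0 : update (fun _ => []) .inp w = inputSt w 0 [] := by
    funext k; cases k <;> simp [inputSt, encLog]
  rw [Nat.zero_add] at hr hlen
  have hE : Env (inputSt [] N D) N (fun _ => 0) D :=
    ⟨⟨rfl, rfl, fun _ => rfl⟩, ⟨rfl, rfl, rfl, rfl, rfl⟩, rfl, rfl⟩
  have hlen' : (encLog D).length ≤ N * (N + 10) := by simpa [encLog] using hlen
  obtain ⟨h3, h4⟩ := h₁ N _ D _ hE (fun _ => Nat.zero_le _) (fun _ _ => ⟨rfl, rfl⟩)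
  have h5 := h₂ N _ _ _ (hE.update_log (s.eval N (fun _ => 0) D)) (fun _ => Nat.zero_le _)
    (Free.update_of_ne (fun _ _ => ⟨rfl, rfl⟩) (by simp) (by simp) _)
  rw [e0]
  refine .to (.seq hr (.seq h4 (.seq h5 (.seq (exec_clear _ _) (exec_clear _ _) le_rfl) le_rfl)
    le_rfl) le_rfl) ?_ ?_
  · funext k
    cases k <;> simp [inputSt, h x, w, N, D]
  · have e1 : (encLog D).length + N ≤ R.eval N := by rw [hR]; omega
    have e2 := eval_mono P₁ (show N + (encLog D).length ≤ R.eval N by omega)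
    have e3 := eval_mono P₂ (show N + (encLog (s.eval N (fun _ => 0) D)).length ≤
      R.eval N + Q₁.eval N by omega)
    simp only [Polynomial.eval_add, Polynomial.eval_mul, Polynomial.eval_X, Polynomial.eval_comp,
      Polynomial.eval_ofNat, Polynomial.eval_one]
    simp [inputSt]
    change N * (4 * N + 4) + 1 + _ ≤ _
    omega

end Implementation

/-! ### Treks and d-separation -/

namespace DSeparation

open Relation

variable {N : Type*}

/-- There is a directed path from the first to the second node on which no node, except possibly
the last one, lies in `Z`. -/
def Directed (r : N → N → Prop) (Z : Set N) : N → N → Prop :=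
  ReflTransGen fun a b => r a b ∧ a ∉ Z

/-- A trek: two directed paths from a common source outside `Z`, avoiding `Z` except possibly at
their ends. -/
def Trek (r : N → N → Prop) (Z : Set N) (u v : N) : Prop :=
  ∃ c ∉ Z, Directed r Z c u ∧ Directed r Z c v

/-- The nodes that are reached from `X` by steps of the relation `K` all of which end in `Z`. -/
inductive Linked (K : N → N → Prop) (X Z : Set N) : N → Prop
  | base {x} : x ∈ X → Linked K X Z x
  | step {u z} : Linked K X Z u → K u z → z ∈ Z → Linked K X Z z

/-- The ends of d-paths from `X`. The Boolean value is `false` if the last edge of the path points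
towards its end. -/
inductive Active (r : N → N → Prop) (X Z : Set N) : N → Bool → Prop
  | start {x} : x ∈ X → Active r X Z x true
  | up {v w} : Active r X Z v true → v ∉ Z → r w v → Active r X Z w true
  | down {v w b} : Active r X Z v b → v ∉ Z → r v w → Active r X Z w false
  | collide {v w d} : Active r X Z v false → d ∈ Z → ReflTransGen r v d → r w v →
      Active r X Z w true

variable {r : N → N → Prop} {X Y Z : Set N}

lemma active_of_isDPath (hXZ : Disjoint X Z) {k : ℕ} {W : ℕ → N} (h : IsDPath r X Y Z k W) :
    ∃ b, Active r X Z (W k) b := by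
  have key : ∀ i ≤ k, ∃ b, Active r X Z (W i) b ∧
      (b = true → i = 0 ∨ ∃ j, i = j + 1 ∧ r (W i) (W j)) ∧
      (b = false → ∃ j, i = j + 1 ∧ r (W j) (W i)) := by
    intro i
    induction i with
    | zero => exact fun _ => ⟨true, .start h.start_mem, by simp, by simp⟩
    | succ i ih =>
      intro hi
      obtain ⟨b, hb, h1, h2⟩ := ih (by omega)
      have hadj := h.adj i (by omega)
      cases b with
      | true =>
        have hz : W i ∉ Z := by
          rcases h1 rfl with h0 | ⟨j, hj, hr⟩
          · subst h0
            exact Set.disjoint_left.1 hXZ h.start_mem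
          · subst hj
            exact h.noncollider j (by omega) (.inl hr)
        rcases hadj with hr | hr
        · exact ⟨false, hb.down hz hr, by simp, fun _ => ⟨i, rfl, hr⟩⟩
        · exact ⟨true, hb.up hz hr, fun _ => .inr ⟨i, rfl, hr⟩, by simp⟩
      | false =>
        obtain ⟨j, hj, hr'⟩ := h2 rfl
        subst hj
        rcases hadj with hr | hr
        · exact ⟨false, hb.down (h.noncollider j (by omega) (.inr hr)) hr, by simp,
            fun _ => ⟨_, rfl, hr⟩⟩
        · obtain ⟨d, hd, hp⟩ := h.collider j (by omega) ⟨hr', hr⟩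
          exact ⟨true, hb.collide hd hp hr, fun _ => .inr ⟨_, rfl, hr⟩, by simp⟩
  obtain ⟨b, hb, _⟩ := key k le_rfl
  exact ⟨b, hb⟩

lemma isDPath_extend {k : ℕ} {W : ℕ → N} {w : N} (h : IsDPath r X {W k} Z k W)
    (hadj : r (W k) w ∨ r w (W k))
    (hn : ∀ j, k = j + 1 → (r (W k) (W j) ∨ r (W k) w) → W k ∉ Z)
    (hc : ∀ j, k = j + 1 → (r (W j) (W k) ∧ r w (W k)) → ∃ d ∈ Z, ReflTransGen r (W k) d) :
    IsDPath r X {w} Z (k + 1) (fun i => if i ≤ k then W i else w) where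
  start_mem := by simpa using h.start_mem
  end_mem := by simp
  adj i hi := by
    rcases Nat.lt_succ_iff_lt_or_eq.1 hi with hi | rfl
    · have h1 : i + 1 ≤ k := hi
      simpa [h1, hi.le] using h.adj i hi
    · simpa using hadj
  noncollider i hi := by
    have h1 : i + 1 ≤ k := by omega
    have h0 : i ≤ k := by omega
    rcases Nat.lt_or_eq_of_le h1 with h2 | h2
    · have h2' : i + 2 ≤ k := h2
      simpa [h1, h0, h2'] using h.noncollider i h2
    · have h3 : ¬ i + 2 ≤ k := by omega
      simp only [h1, h0, h3, if_true, if_false]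
      intro hh
      rw [h2] at hh ⊢
      exact hn i h2.symm hh
  collider i hi := by
    have h1 : i + 1 ≤ k := by omega
    have h0 : i ≤ k := by omega
    rcases Nat.lt_or_eq_of_le h1 with h2 | h2
    · have h2' : i + 2 ≤ k := h2
      simpa [h1, h0, h2'] using h.collider i h2
    · have h3 : ¬ i + 2 ≤ k := by omega
      simp only [h1, h0, h3, if_true, if_false]
      intro hh
      rw [h2] at hh ⊢
      exact hc i h2.symm hh

lemma isDPath_of_active (hasym : ∀ a b, r a b → ¬ r b a) {v : N} {b : Bool}
    (h : Active r X Z v b) : ∃ k W, W k = v ∧ IsDPath r X {W k} Z k W ∧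
      (b = true → k = 0 ∨ ∃ j, k = j + 1 ∧ r (W k) (W j)) ∧
      (b = false → ∃ j, k = j + 1 ∧ r (W j) (W k)) := by
  have ext : ∀ {k : ℕ} {W : ℕ → N} {w : N}, IsDPath r X {W k} Z k W →
      (r (W k) w ∨ r w (W k)) →
      (∀ j, k = j + 1 → (r (W k) (W j) ∨ r (W k) w) → W k ∉ Z) →
      (∀ j, k = j + 1 → (r (W j) (W k) ∧ r w (W k)) → ∃ d ∈ Z, ReflTransGen r (W k) d) →
      ∃ W', W' (k + 1) = w ∧ W' k = W k ∧ IsDPath r X {W' (k + 1)} Z (k + 1) W' := by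
    intro k W w h1 h2 h3 h4
    refine ⟨fun i => if i ≤ k then W i else w, by simp, by simp, ?_⟩
    have := isDPath_extend h1 h2 h3 h4
    simpa using this
  induction h with
  | @start x hx =>
    exact ⟨0, fun _ => x, rfl, ⟨hx, rfl, by simp, by simp, by simp⟩, by simp, by simp⟩
  | @up v w hv hz hr ih =>
    obtain ⟨k, W, rfl, hd, h1, _⟩ := ih
    obtain ⟨W', h2, h3, h4⟩ := ext hd (.inr hr) (fun _ _ _ => hz) (by
      rintro j rfl ⟨h5, _⟩
      rcases h1 rfl with h | ⟨j', hj, h6⟩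
      · omega
      · obtain rfl : j = j' := by omega
        exact absurd h5 (hasym _ _ h6))
    exact ⟨k + 1, W', h2, h4, fun _ => .inr ⟨k, rfl, by rw [h2, h3]; exact hr⟩, by simp⟩
  | @down v w b hv hz hr ih =>
    obtain ⟨k, W, rfl, hd, h1, _⟩ := ih
    obtain ⟨W', h2, h3, h4⟩ := ext hd (.inl hr) (fun _ _ _ => hz)
      (fun j _ h => absurd h.2 (hasym _ _ hr))
    exact ⟨k + 1, W', h2, h4, by simp, fun _ => ⟨k, rfl, by rw [h2, h3]; exact hr⟩⟩
  | @collide v w d hv hdZ hp hr ih =>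
    obtain ⟨k, W, rfl, hd, _, h1⟩ := ih
    obtain ⟨W', h2, h3, h4⟩ := ext hd (.inr hr) (by
      rintro j rfl (h5 | h5)
      · obtain ⟨j', hj, h6⟩ := h1 rfl
        obtain rfl : j = j' := by omega
        exact absurd h5 (hasym _ _ h6)
      · exact absurd hr (hasym _ _ h5)) (fun _ _ _ => ⟨d, hdZ, hp⟩)
    exact ⟨k + 1, W', h2, h4, fun _ => .inr ⟨k, rfl, by rw [h2, h3]; exact hr⟩, by simp⟩

/-- A node with a descendant in `Z` has a directed path to the first such descendant. -/
lemma exists_directed_of_reflTransGen {v d : N} (h : ReflTransGen r v d) (hd : d ∈ Z) :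
    ∃ z ∈ Z, Directed r Z v z := by
  induction h using ReflTransGen.head_induction_on with
  | refl => exact ⟨d, hd, .refl⟩
  | @head a c hac _ ih =>
    by_cases ha : a ∈ Z
    · exact ⟨a, ha, .refl⟩
    · obtain ⟨z, hz, hp⟩ := ih
      exact ⟨z, hz, .head ⟨hac, ha⟩ hp⟩

lemma Directed.map {M : Type*} {s : M → M → Prop} {Z' : Set M} (f : N → M)
    (h : ∀ a b, r a b → a ∉ Z → s (f a) (f b) ∧ f a ∉ Z') {a b : N} (hab : Directed r Z a b) :
    Directed s Z' (f a) (f b) := by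
  induction hab with
  | refl => exact .refl
  | tail _ hr ih => exact ReflTransGen.tail ih (h _ _ hr.1 hr.2)

lemma Directed.eq_of_mem {v w : N} (h : Directed r Z v w) (hv : v ∈ Z) : v = w := by
  rcases ReflTransGen.cases_head h with h | ⟨c, hc, _⟩
  · exact h
  · exact absurd hv hc.2

lemma linked_of_active {v : N} {b : Bool} (h : Active r X Z v b) :
    (b = true → v ∉ Z → ∃ u, Linked (Trek r Z) X Z u ∧ Directed r Z v u) ∧
    (b = false → ∃ u, Linked (Trek r Z) X Z u ∧ Trek r Z u v) := by
  induction h with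
  | start hx => exact ⟨fun _ _ => ⟨_, .base hx, .refl⟩, by simp⟩
  | @up v w _ hz hr ih =>
    refine ⟨fun _ hw => ?_, by simp⟩
    obtain ⟨u, hu, hd⟩ := ih.1 rfl hz
    exact ⟨u, hu, .head ⟨hr, hw⟩ hd⟩
  | @down v w b _ hz hr ih =>
    refine ⟨by simp, fun _ => ?_⟩
    cases b with
    | true =>
      obtain ⟨u, hu, hd⟩ := ih.1 rfl hz
      exact ⟨u, hu, v, hz, hd, .single ⟨hr, hz⟩⟩
    | false =>
      obtain ⟨u, hu, c, hc, h1, h2⟩ := ih.2 rfl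
      exact ⟨u, hu, c, hc, h1, h2.tail ⟨hr, hz⟩⟩
  | @collide v w d _ hd hp hr ih =>
    refine ⟨fun _ hw => ?_, by simp⟩
    obtain ⟨u, hu, c, hc, h1, h2⟩ := ih.2 rfl
    obtain ⟨z, hz, h3⟩ := exists_directed_of_reflTransGen hp hd
    have h4 : Directed r Z c z := ReflTransGen.trans h2 h3
    exact ⟨z, hu.step ⟨c, hc, h1, h4⟩ hz, .head ⟨hr, hw⟩ h3⟩

lemma active_of_directed {c v : N} (h : Active r X Z c true) (hp : Directed r Z c v) :
    v = c ∨ Active r X Z v false := by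
  induction hp with
  | refl => exact .inl rfl
  | @tail v w _ hr ih =>
    rcases ih with rfl | ih
    · exact .inr (h.down hr.2 hr.1)
    · exact .inr (ih.down hr.2 hr.1)

lemma active_of_linked (hXZ : Disjoint X Z) {u : N} (h : Linked (Trek r Z) X Z u) :
    ∀ c ∉ Z, Directed r Z c u → Active r X Z c true := by
  -- It suffices to know that all parents of the node are active.
  have key : ∀ u : N, (∀ w, r w u → Active r X Z w true) → (u ∉ Z → Active r X Z u true) →
      ∀ c ∉ Z, Directed r Z c u → Active r X Z c true := by
    intro u hw hu c hc hp
    induction hp using ReflTransGen.head_induction_on with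
    | refl => exact hu hc
    | @head a b hab hbu ih =>
      by_cases hb : b ∈ Z
      · obtain rfl := Directed.eq_of_mem hbu hb
        exact hw _ hab.1
      · exact (ih hb).up hb hab.1
  induction h with
  | @base x hx =>
    have hxz := Set.disjoint_left.1 hXZ hx
    exact key x (fun w hw => (Active.start hx).up hxz hw) (fun _ => .start hx)
  | @step u z _ hK hz ih =>
    obtain ⟨c, hc, h1, h2⟩ := hK
    rcases active_of_directed (ih c hc h1) h2 with rfl | h3
    · exact absurd hz hc
    · exact key z (fun w hw => h3.collide hz .refl hw) (fun h => absurd hz h)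

/-- Dependence is witnessed by a sequence of treks that meet in `Z`. -/
theorem dSep_iff (hasym : ∀ a b, r a b → ¬ r b a) (hXZ : Disjoint X Z) (hYZ : Disjoint Y Z) :
    DSep r X Y Z ↔ ¬ ∃ y ∈ Y, ∃ u, Linked (Trek r Z) X Z u ∧ Trek r Z u y := by
  rw [DSep, not_iff_not]
  constructor
  · rintro ⟨k, W, h⟩
    obtain ⟨b, hb⟩ := active_of_isDPath hXZ h
    refine ⟨W k, h.end_mem, ?_⟩
    have hz := Set.disjoint_left.1 hYZ h.end_mem
    cases b with
    | true =>
      obtain ⟨u, hu, hd⟩ := (linked_of_active hb).1 rfl hz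
      exact ⟨u, hu, W k, hz, hd, .refl⟩
    | false => exact (linked_of_active hb).2 rfl
  · rintro ⟨y, hy, u, hu, c, hc, h1, h2⟩
    have hca := active_of_linked hXZ hu c hc h1
    obtain ⟨b, hb⟩ : ∃ b, Active r X Z y b := by
      rcases active_of_directed hca h2 with rfl | h
      · exact ⟨_, hca⟩
      · exact ⟨_, h⟩
    obtain ⟨k, W, rfl, hd, _⟩ := isDPath_of_active hasym hb
    exact ⟨k, W, hd.1, hy, hd.3, hd.4, hd.5⟩

/-! ### Treks in the unfolding of a template -/

variable {V : Type*}

/-- Treks between nodes of one time slice with edge relation `E`, where `I` holds the edges from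
the slice before and `P` the treks between nodes of earlier slices. -/
def stepTrek (E I : V → V → Prop) (Z : Set V) (P : V → V → Prop) (u v : V) : Prop :=
  (∃ c ∉ Z, Directed E Z c u ∧ Directed E Z c v) ∨
  ∃ a a' b b', P a a' ∧ I a b ∧ I a' b' ∧ Directed E Z b u ∧ Directed E Z b' v

end DSeparation

namespace DBNTemplate

open DSeparation Relation

variable {V : Type*} (T : DBNTemplate V)

/-- Edges of the first time slice. -/
def edge0 (x y : V) : Prop := (x, y) ∈ T.E0

/-- Edges between nodes of a later time slice. -/
def edge1 (x y : V) : Prop := (Sum.inr x, y) ∈ T.Estep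

/-- Edges from one time slice to the next. -/
def edgeI (x y : V) : Prop := (Sum.inl x, y) ∈ T.Estep

/-- Two variables have a common ancestor at time `t`. -/
def coAnc : ℕ → V → V → Prop
  | 0 => stepTrek T.edge0 T.edgeI ∅ fun _ _ => False
  | t + 1 => stepTrek T.edge1 T.edgeI ∅ (coAnc t)

/-- Treks between variables at time `t` which avoid the copies of `Z` in the last slice. -/
def lastTrek (Z : Set V) : ℕ → V → V → Prop
  | 0 => stepTrek T.edge0 T.edgeI Z fun _ _ => False
  | t + 1 => stepTrek T.edge1 T.edgeI Z (T.coAnc t)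

lemma coAnc_eq (t : ℕ) : T.coAnc t = T.lastTrek ∅ t := by cases t <;> rfl

lemma unfolding_asymm (t : ℕ) (a b : V × Fin (t + 1)) (h : T.unfolding t a b) :
    ¬ T.unfolding t b a := by
  intro h'
  rcases h with ⟨h1, h2, h3⟩ | ⟨h1, h2, h3⟩ | ⟨h1, h2⟩ <;>
    rcases h' with ⟨k1, k2, k3⟩ | ⟨k1, k2, k3⟩ | ⟨k1, k2⟩ <;> try omega
  · exact T.dag_E0 a.1 (.tail (.single h3) k3)
  · exact T.dag_Estep (Sum.inr a.1) (.tail (.single ⟨_, rfl, h3⟩) ⟨_, rfl, k3⟩)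

/-- Copies of the elements of `Z` in the last slice. -/
def lastCopy (t : ℕ) (Z : Set V) : Set (V × Fin (t + 1)) := {a | a.1 ∈ Z ∧ a.2 = Fin.last t}

lemma directed_zero_iff (Z : Set V) (x : V) (i : Fin 1) (v : V) :
    Directed (T.unfolding 0) (lastCopy 0 Z) (x, i) (v, Fin.last 0) ↔
      Directed T.edge0 Z x v := by
  have hi : ∀ i : Fin 1, i = Fin.last 0 := fun i => by omega
  constructor
  · intro h
    refine Directed.map (fun a : V × Fin 1 => a.1) (fun a b hab ha => ?_) h
    refine ⟨?_, fun hz => ha ⟨hz, hi _⟩⟩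
    rcases hab with h | h | h
    · exact h.2.2
    · omega
    · omega
  · intro h
    rw [hi i]
    exact Directed.map (fun x : V => (x, Fin.last 0))
      (fun a b hab ha => ⟨.inl ⟨rfl, rfl, hab⟩, fun hz => ha hz.1⟩) h

lemma directed_succ_of_last (Z : Set V) {t : ℕ} {x v : V} (h : Directed T.edge1 Z x v) :
    Directed (T.unfolding (t + 1)) (lastCopy (t + 1) Z) (x, Fin.last (t + 1))
      (v, Fin.last (t + 1)) :=
  Directed.map (fun x : V => (x, Fin.last (t + 1)))
    (fun _ _ hab ha => ⟨.inr (.inl ⟨by simp, rfl, hab⟩), fun hz => ha hz.1⟩) h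

/-- A directed path to the last slice either stays there or enters it by an edge from the slice
before, which it reaches within the shorter unfolding. -/
lemma directed_succ_iff (Z : Set V) (t : ℕ) (c : V × Fin (t + 2)) (v : V) :
    Directed (T.unfolding (t + 1)) (lastCopy (t + 1) Z) c (v, Fin.last (t + 1)) ↔
      (c.2 = Fin.last (t + 1) ∧ Directed T.edge1 Z c.1 v) ∨
      ∃ i : Fin (t + 1), c.2 = i.castSucc ∧ ∃ a b,
        Directed (T.unfolding t) (lastCopy t ∅) (c.1, i) (a, Fin.last t) ∧ T.edgeI a b ∧
        Directed T.edge1 Z b v := by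
  constructor
  · intro h
    induction h using ReflTransGen.head_induction_on with
    | refl => exact .inl ⟨rfl, .refl⟩
    | @head c d hcd _ ih =>
      obtain ⟨hr, hz⟩ := hcd
      rcases ih with ⟨h1, h2⟩ | ⟨i, h1, a, b, h2, h3, h4⟩
      · have hd : d.2.val = t + 1 := by rw [h1]; rfl
        rcases hr with ⟨k1, k2, k3⟩ | ⟨k1, k2, k3⟩ | ⟨k1, k2⟩
        · omega
        · have hc : c.2 = Fin.last (t + 1) := Fin.ext (by rw [k2, hd]; rfl)
          exact .inl ⟨hc, .head ⟨k3, fun h => hz ⟨h, hc⟩⟩ h2⟩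
        · have hc : c.2 = (Fin.last t).castSucc := Fin.ext (by simp; omega)
          exact .inr ⟨Fin.last t, hc, c.1, d.1, .refl, k2, h2⟩
      · have hd : d.2.val = i.val := by rw [h1]; rfl
        have hi := i.2
        have hcle : c.2.val < t + 1 := by
          rcases hr with ⟨k1, k2, k3⟩ | ⟨k1, k2, k3⟩ | ⟨k1, k2⟩ <;> omega
        refine .inr ⟨⟨c.2.val, hcle⟩, Fin.ext rfl, a, b, .head ⟨?_, by simp [lastCopy]⟩ h2, h3, h4⟩
        rcases hr with ⟨k1, k2, k3⟩ | ⟨k1, k2, k3⟩ | ⟨k1, k2⟩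
        · exact .inl ⟨k1, hd ▸ k2, k3⟩
        · exact .inr (.inl ⟨hd ▸ k1, hd ▸ k2, k3⟩)
        · exact .inr (.inr ⟨hd ▸ k1, k2⟩)
  · obtain ⟨x, j⟩ := c
    rintro (⟨rfl, h⟩ | ⟨i, rfl, a, b, h1, h2, h3⟩)
    · exact T.directed_succ_of_last Z h
    · have h4 : Directed (T.unfolding (t + 1)) (lastCopy (t + 1) Z) (x, i.castSucc)
          (a, (Fin.last t).castSucc) :=
        Directed.map (a := (x, i)) (b := (a, Fin.last t))
          (fun p : V × Fin (t + 1) => (p.1, p.2.castSucc))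
          (fun p q hpq _ => ⟨hpq, fun hz : _ ∈ lastCopy (t + 1) Z =>
            (Fin.castSucc_lt_last p.2).ne hz.2⟩) h1
      have h5 : T.unfolding (t + 1) (a, (Fin.last t).castSucc) (b, Fin.last (t + 1)) :=
        .inr (.inr ⟨rfl, h2⟩)
      have h6 : (a, (Fin.last t).castSucc) ∉ lastCopy (t + 1) Z :=
        fun hz => (Fin.castSucc_lt_last _).ne hz.2
      exact (ReflTransGen.tail h4 ⟨h5, h6⟩).trans
        (T.directed_succ_of_last Z h3)

/-- The recursion `lastTrek` describes the treks between nodes of the last slice: the source of a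
trek lies in the last slice, or both paths enter this slice from the one before. -/
theorem trek_iff (t : ℕ) (Z : Set V) (u v : V) :
    Trek (T.unfolding t) (lastCopy t Z) (u, Fin.last t) (v, Fin.last t) ↔ T.lastTrek Z t u v := by
  induction t generalizing Z u v with
  | zero =>
    constructor
    · rintro ⟨⟨x, i⟩, hc, h1, h2⟩
      rw [directed_zero_iff] at h1 h2
      exact .inl ⟨x, fun h => hc ⟨h, by omega⟩, h1, h2⟩
    · rintro (⟨x, hx, h1, h2⟩ | ⟨_, _, _, _, h, _⟩)
      · exact ⟨(x, Fin.last 0), fun h => hx h.1, (T.directed_zero_iff Z _ _ _).2 h1,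
          (T.directed_zero_iff Z _ _ _).2 h2⟩
      · exact h.elim
  | succ t ih =>
    constructor
    · rintro ⟨c, hc, h1, h2⟩
      rw [directed_succ_iff] at h1 h2
      rcases h1 with ⟨h1, h3⟩ | ⟨i, h1, a, b, h3, h4, h5⟩
      · rcases h2 with ⟨_, h6⟩ | ⟨i, h2, _⟩
        · exact .inl ⟨c.1, fun h => hc ⟨h, h1⟩, h3, h6⟩
        · exact absurd (h2.symm.trans h1) (Fin.castSucc_lt_last i).ne
      · rcases h2 with ⟨h2, _⟩ | ⟨i', h2, a', b', h3', h4', h5'⟩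
        · exact absurd (h1.symm.trans h2) (Fin.castSucc_lt_last i).ne
        · obtain rfl : i = i' := Fin.castSucc_injective _ (h1.symm.trans h2)
          refine .inr ⟨a, a', b, b', ?_, h4, h4', h5, h5'⟩
          rw [coAnc_eq, ← ih]
          exact ⟨(c.1, i), by simp [lastCopy], h3, h3'⟩
    · rintro (⟨x, hx, h1, h2⟩ | ⟨a, a', b, b', h, h4, h4', h5, h5'⟩)
      · exact ⟨(x, Fin.last _), fun h => hx h.1, T.directed_succ_of_last Z h1,
          T.directed_succ_of_last Z h2⟩
      · rw [coAnc_eq, ← ih] at h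
        obtain ⟨⟨x, i⟩, _, h1, h2⟩ := h
        exact ⟨(x, i.castSucc), fun hz => (Fin.castSucc_lt_last i).ne hz.2,
          (T.directed_succ_iff Z t _ _).2 (.inr ⟨i, rfl, a, b, h1, h4, h5⟩),
          (T.directed_succ_iff Z t _ _).2 (.inr ⟨i, rfl, a', b', h2, h4', h5'⟩)⟩

/-- All nodes of a chain of treks lie in the last slice, since the treks meet in `Z`. -/
lemma linked_iff (t : ℕ) (X Z : Set V) (a : V × Fin (t + 1)) :
    Linked (Trek (T.unfolding t) (lastCopy t Z)) (lastCopy t X) (lastCopy t Z) a ↔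
      a.2 = Fin.last t ∧ Linked (T.lastTrek Z t) X Z a.1 := by
  constructor
  · intro h
    induction h with
    | base hx => exact ⟨hx.2, .base hx.1⟩
    | @step u z _ hK hz ih =>
      refine ⟨hz.2, ih.2.step ?_ hz.1⟩
      obtain ⟨z, j⟩ := z
      obtain ⟨u, i⟩ := u
      obtain ⟨rfl, -⟩ := ih
      obtain rfl : j = Fin.last t := hz.2
      exact (T.trek_iff t Z u z).1 hK
  · rintro ⟨h1, h2⟩
    obtain ⟨x, i⟩ := a
    obtain rfl : i = Fin.last t := h1
    change Linked (T.lastTrek Z t) X Z x at h2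
    induction h2 with
    | base hx => exact .base ⟨hx, rfl⟩
    | step _ hK hz ih => exact .step ih ((T.trek_iff t Z _ _).2 hK) ⟨hz, rfl⟩

/-- A proposition fails at time `t` if and only if its sides are connected by treks at time `t`. -/
theorem holdsAt_iff (t : ℕ) (p : CIProp V) :
    T.HoldsAt t p ↔ ¬ ∃ y ∈ p.Y, ∃ u, Linked (T.lastTrek ↑p.Z t) ↑p.X ↑p.Z u ∧
      T.lastTrek ↑p.Z t u y := by
  have hd : ∀ S S' : Finset V, Disjoint S S' →
      Disjoint (lastCopy t (S : Set V)) (lastCopy t (S' : Set V)) := fun S S' h =>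
    Set.disjoint_left.2 fun a ha ha' => Finset.disjoint_left.1 h ha.1 ha'.1
  refine (dSep_iff (T.unfolding_asymm t) (hd _ _ p.disjoint_XZ) (hd _ _ p.disjoint_YZ)).trans
    (not_congr ?_)
  constructor
  · rintro ⟨⟨y, i⟩, ⟨hy, rfl⟩, ⟨u, j⟩, hu, h⟩
    rw [linked_iff] at hu
    obtain ⟨rfl, hu⟩ := hu
    exact ⟨y, hy, u, hu, (T.trek_iff t _ _ _).1 h⟩
  · rintro ⟨y, hy, u, hu, h⟩
    exact ⟨(y, Fin.last t), ⟨hy, rfl⟩, (u, Fin.last t), (T.linked_iff t _ _ _).2 ⟨rfl, hu⟩,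
      (T.trek_iff t _ _ _).2 h⟩

end DBNTemplate

/-! ### Stabilization -/

/-- An increasing sequence of subsets of a finite type that stays constant after its first
repetition is constant as soon as the sizes leave no room for further growth. -/
lemma eq_of_card_le {α : Type*} [Finite α] {S : ℕ → Set α} (hmono : ∀ k, S k ⊆ S (k + 1))
    (hstab : ∀ k, S k = S (k + 1) → S (k + 1) = S (k + 2)) {m : ℕ}
    (hm : Nat.card α ≤ (S 0).ncard + m) {k : ℕ} (hk : m ≤ k) : S k = S m := by
  have hprop : ∀ j k, j ≤ k → S j = S (j + 1) → S k = S (k + 1) := by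
    intro j k hjk h
    induction k, hjk using Nat.le_induction with
    | base => exact h
    | succ k _ ih => exact hstab k ih
  have hst : S m = S (m + 1) := by
    by_contra hne
    have hcard : ∀ j ≤ m + 1, (S 0).ncard + j ≤ (S j).ncard := by
      intro j
      induction j with
      | zero => intro _; simp
      | succ j ih =>
        intro hj
        have h1 : S j ⊂ S (j + 1) := by
          refine (hmono j).ssubset_of_ne fun h => hne (hprop j m (by omega) h)
        have h2 := Set.ncard_lt_ncard h1 (Set.toFinite _)
        have h3 := ih (by omega)
        omega
    have h1 := hcard (m + 1) le_rfl
    have h2 := Set.ncard_le_card (S (m + 1))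
    omega
  induction k, hk using Nat.le_induction with
  | base => rfl
  | succ k hk ih => rw [← hprop m k hk hst, ih]

namespace DBNTemplate

open DSeparation Relation

variable {V : Type*} (T : DBNTemplate V)

lemma stepTrek_mono {E I : V → V → Prop} {Z : Set V} {P P' : V → V → Prop}
    (h : ∀ a b, P a b → P' a b) {u v : V} (hs : stepTrek E I Z P u v) : stepTrek E I Z P' u v := by
  rcases hs with hs | ⟨a, a', b, b', h1, h2⟩
  · exact .inl hs
  · exact .inr ⟨a, a', b, b', h _ _ h1, h2⟩

variable {T}

/-- In a restricted template, a path within the first slice is also one within every later slice;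
so common ancestors at one time yield common ancestors at the next. -/
lemma coAnc_mono (hT : T.IsRestricted) (t : ℕ) {u v : V} (h : T.coAnc t u v) :
    T.coAnc (t + 1) u v := by
  induction t generalizing u v with
  | zero =>
    rcases h with ⟨c, hc, h1, h2⟩ | ⟨_, _, _, _, h, _⟩
    · have h3 : ∀ a b, Directed T.edge0 ∅ a b → Directed T.edge1 ∅ a b := fun a b =>
        Directed.map id fun a b hab ha => ⟨hT a b hab, ha⟩
      exact .inl ⟨c, hc, h3 _ _ h1, h3 _ _ h2⟩
    · exact h.elim
  | succ t ih => exact stepTrek_mono (fun _ _ => ih) h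

/-- Common ancestors of all pairs are found within `|V| ^ 2 - 1` slices. -/
lemma coAnc_eq_of_le [Fintype V] (hT : T.IsRestricted) {t : ℕ} (ht : Fintype.card V ^ 2 ≤ t + 1) :
    T.coAnc t = T.coAnc (Fintype.card V ^ 2 - 1) := by
  rcases isEmpty_or_nonempty V with hV | ⟨⟨x⟩⟩
  · funext u; exact hV.elim u
  have h := eq_of_card_le (S := fun k => {q : V × V | T.coAnc k q.1 q.2})
    (m := Fintype.card V ^ 2 - 1) (k := t) (fun k q hq => coAnc_mono hT k hq) (fun k h => ?_) ?_
    (by omega)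
  · funext u v
    exact congrArg (fun S : Set (V × V) => (u, v) ∈ S) h
  · have : T.coAnc k = T.coAnc (k + 1) := by
      funext u v
      exact congrArg (fun S : Set (V × V) => (u, v) ∈ S) h
    ext q
    change T.coAnc (k + 1) q.1 q.2 ↔ T.coAnc (k + 2) q.1 q.2
    rw [coAnc, coAnc, ← this]
  · -- Every variable is its own ancestor, so the first relation is not empty.
    have h1 : 0 < Set.ncard {q : V × V | T.coAnc 0 q.1 q.2} :=
      (Set.ncard_pos (Set.toFinite _)).2 ⟨(x, x), .inl ⟨x, by simp, .refl, .refl⟩⟩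
    rw [Nat.card_eq_fintype_card, Fintype.card_prod, ← sq]
    omega

/-- From time `|V| ^ 2` on, the same propositions hold. -/
theorem holdsAt_eq_of_le [Fintype V] (hT : T.IsRestricted) {t : ℕ} (ht : Fintype.card V ^ 2 ≤ t)
    (p : CIProp V) : T.HoldsAt t p ↔ T.HoldsAt (Fintype.card V ^ 2) p := by
  rcases isEmpty_or_nonempty V with hV | hV
  · rw [holdsAt_iff, holdsAt_iff]
    simp
  have hpos : 0 < Fintype.card V ^ 2 := by
    have := Fintype.card_pos (α := V)
    positivity
  have h1 : T.lastTrek ↑p.Z t = T.lastTrek ↑p.Z (Fintype.card V ^ 2) := by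
    obtain ⟨s, rfl⟩ : ∃ s, t = s + 1 := ⟨t - 1, by omega⟩
    obtain ⟨m, hm⟩ : ∃ m, Fintype.card V ^ 2 = m + 1 := ⟨_, (Nat.succ_pred_eq_of_pos hpos).symm⟩
    rw [hm, lastTrek, lastTrek, coAnc_eq_of_le hT ht, coAnc_eq_of_le hT (t := m) (by omega)]
  rw [holdsAt_iff, holdsAt_iff, h1]

theorem trace_eq_of_le [Fintype V] (hT : T.IsRestricted) (A : Set (CIProp V)) {t : ℕ}
    (ht : Fintype.card V ^ 2 ≤ t) : T.trace A t = T.trace A (Fintype.card V ^ 2) := by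
  ext p
  exact and_congr_right fun _ => holdsAt_eq_of_le hT ht p

end DBNTemplate

/-! ### Defining relations by recursion on their first argument -/

namespace Form

/-- Disjunction. -/
def disj (φ ψ : Form) : Form := .neg (.conj (.neg φ) (.neg ψ))

/-- Bounded universal quantification. -/
def all (x : Var) (φ : Form) : Form := .neg (.ex x (.neg φ))

/-- Equality of terms. -/
def eq (s t : Term) : Form := .conj (.le s t) (.le t s)

/-- Strict inequality of terms. -/
def lt (s t : Term) : Form := .le (s + .const 1) t

/-- Conjunction of a list of formulae. -/
def conjs : List Form → Form
  | [] => .le (.const 0) (.const 0)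
  | [φ] => φ
  | φ :: l => .conj φ (conjs l)

variable {N : ℕ} {R : ℕ → List ℕ → Prop} {ρ : Var → ℕ} {φ ψ : Form} {s t : Term} {x : Var}

@[simp] lemma holds_mem {tag : ℕ} {ts : List Term} :
    (mem tag ts).Holds N R ρ ↔ R tag (ts.map (Term.val ρ)) := Iff.rfl

@[simp] lemma holds_le : (le s t).Holds N R ρ ↔ s.val ρ ≤ t.val ρ := Iff.rfl

@[simp] lemma holds_neg : (neg φ).Holds N R ρ ↔ ¬ φ.Holds N R ρ := Iff.rfl

@[simp] lemma holds_conj : (conj φ ψ).Holds N R ρ ↔ φ.Holds N R ρ ∧ ψ.Holds N R ρ := Iff.rfl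

@[simp] lemma holds_ex :
    (ex x φ).Holds N R ρ ↔ ∃ i < N, φ.Holds N R (Function.update ρ x i) := Iff.rfl

@[simp] lemma holds_disj : (disj φ ψ).Holds N R ρ ↔ φ.Holds N R ρ ∨ ψ.Holds N R ρ := by
  simp only [disj, holds_neg, holds_conj]; tauto

@[simp] lemma holds_all :
    (all x φ).Holds N R ρ ↔ ∀ i < N, φ.Holds N R (Function.update ρ x i) := by
  simp [all]

@[simp] lemma holds_eq : (eq s t).Holds N R ρ ↔ s.val ρ = t.val ρ := by
  simp [eq, le_antisymm_iff]

end Form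

@[simp] lemma Term.val_const (ρ : Var → ℕ) (c : ℕ) : (Term.const c).val ρ = c := rfl

@[simp] lemma Term.val_var (ρ : Var → ℕ) (x : Var) : (Term.var x).val ρ = ρ x := rfl

@[simp] lemma Term.val_prod (ρ : Var → ℕ) (x y : Var) : (Term.prod x y).val ρ = ρ x * ρ y := rfl

@[simp] lemma Term.val_add (ρ : Var → ℕ) (s t : Term) : (s + t).val ρ = s.val ρ + t.val ρ := rfl

@[simp] lemma Form.holds_lt {N : ℕ} {R : ℕ → List ℕ → Prop} {ρ : Var → ℕ} {s t : Term} :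
    (lt s t).Holds N R ρ ↔ s.val ρ < t.val ρ := by
  simp [lt]

namespace Cmd

open Function

/-- Insert the values of the variables `xs`, which run through all tuples, into the relation `tag`
if the formula holds. -/
def define (tag : ℕ) (xs : List Var) (φ : Form) : Cmd :=
  xs.foldr Cmd.loop (.test φ (.ins tag (xs.map .var)))

/-- The assignment changed on the list of variables. -/
def assign (ρ : Var → ℕ) : List Var → List ℕ → Var → ℕ
  | x :: xs, a :: v => assign (update ρ x a) xs v
  | _, _ => ρ

@[simp] lemma assign_nil (ρ : Var → ℕ) (v : List ℕ) : assign ρ [] v = ρ := by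
  cases v <;> rfl

@[simp] lemma assign_cons (ρ : Var → ℕ) (x : Var) (xs : List Var) (a : ℕ) (v : List ℕ) :
    assign ρ (x :: xs) (a :: v) = assign (update ρ x a) xs v := rfl

lemma assign_of_notMem {ρ : Var → ℕ} {xs : List Var} {v : List ℕ} {x : Var} (h : x ∉ xs) :
    assign ρ xs v x = ρ x := by
  induction xs generalizing ρ v with
  | nil => cases v <;> rfl
  | cons y xs ih =>
    cases v with
    | nil => rfl
    | cons a v =>
      rw [assign, ih (fun h' => h (List.mem_cons_of_mem _ h')),
        update_of_ne (fun h' => h (by simp [h']))]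

lemma map_assign {ρ : Var → ℕ} {xs : List Var} (hxs : xs.Nodup) {v : List ℕ}
    (hv : v.length = xs.length) : xs.map (assign ρ xs v) = v := by
  induction xs generalizing ρ v with
  | nil => exact (List.length_eq_zero_iff.1 hv).symm
  | cons x xs ih =>
    cases v with
    | nil => simp at hv
    | cons a v =>
      obtain ⟨h1, h2⟩ := List.nodup_cons.1 hxs
      rw [List.map_cons, assign, assign_of_notMem h1, update_self,
        ih h2 (by simpa using hv)]

/-- Nested loops run through all tuples. The invariant `I` holds throughout, and ensures that the
formula expresses `Q`. -/
lemma eval_nest {N tag : ℕ} {φ : Form} {ts : List Term} (ys : List Var) (ρ : Var → ℕ)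
    (D : List (List ℕ)) (I : List (List ℕ) → Prop) (Q : List ℕ → Prop) (key : List ℕ → List ℕ)
    (hkey : ∀ v, v.length = ys.length → tag :: ts.map (Term.val (assign ρ ys v)) = key v)
    (hI : ∀ D' v, I D' → I (key v :: D'))
    (hφ : ∀ v, v.length = ys.length → (∀ a ∈ v, a < N) → ∀ D', I D' →
      (φ.Holds N (relOf D') (assign ρ ys v) ↔ Q v)) (hD : I D) :
    I ((ys.foldr Cmd.loop (.test φ (.ins tag ts))).eval N ρ D) ∧
    ∀ k, k ∈ (ys.foldr Cmd.loop (.test φ (.ins tag ts))).eval N ρ D ↔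
      k ∈ D ∨ ∃ v, v.length = ys.length ∧ (∀ a ∈ v, a < N) ∧ Q v ∧ k = key v := by
  induction ys generalizing ρ D Q key with
  | nil =>
    have h1 := hφ [] rfl (by simp) D hD
    have h2 := hkey [] rfl
    rw [assign_nil] at h1 h2
    simp only [List.foldr_nil, eval]
    split_ifs with h
    · rw [h2]
      refine ⟨hI _ _ hD, fun k => ?_⟩
      rw [List.mem_cons]
      constructor
      · rintro (rfl | h3)
        · exact .inr ⟨[], rfl, by simp, h1.1 h, rfl⟩
        · exact .inl h3
      · rintro (h3 | ⟨v, hv, _, _, rfl⟩)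
        · exact .inr h3
        · rw [List.length_eq_zero_iff.1 hv]; exact .inl rfl
    · refine ⟨hD, fun k => ⟨.inl, ?_⟩⟩
      rintro (h3 | ⟨v, hv, _, h4, _⟩)
      · exact h3
      · rw [List.length_eq_zero_iff.1 hv] at h4
        exact absurd (h1.2 h4) h
  | cons y ys ih =>
    let E : ℕ → List (List ℕ) := fun i => Nat.rec D (fun i D' =>
      (ys.foldr Cmd.loop (.test φ (.ins tag ts))).eval N (update ρ y i) D') i
    have key2 : ∀ i ≤ N, I (E i) ∧ ∀ k, k ∈ E i ↔ k ∈ D ∨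
        ∃ a < i, ∃ v, v.length = ys.length ∧ (∀ b ∈ v, b < N) ∧ Q (a :: v) ∧ k = key (a :: v) := by
      intro i
      induction i with
      | zero => exact fun _ => ⟨hD, by simp [E]⟩
      | succ i ihi =>
        intro hi
        obtain ⟨h1, h2⟩ := ihi (by omega)
        obtain ⟨h3, h4⟩ := ih (update ρ y i) (E i) (fun v => Q (i :: v)) (fun v => key (i :: v))
          (fun v hv => hkey (i :: v) (by simp [hv])) (fun D' v => hI D' (i :: v))
          (fun v hv hb D' hD' => hφ (i :: v) (by simp [hv])
            (by simpa using ⟨by omega, hb⟩) D' hD') h1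
        refine ⟨h3, fun k => ?_⟩
        change k ∈ (ys.foldr Cmd.loop (.test φ (.ins tag ts))).eval N (update ρ y i) (E i) ↔ _
        rw [h4, h2]
        constructor
        · rintro ((h | ⟨a, ha, h⟩) | h)
          · exact .inl h
          · exact .inr ⟨a, by omega, h⟩
          · exact .inr ⟨i, by omega, h⟩
        · rintro (h | ⟨a, ha, h⟩)
          · exact .inl (.inl h)
          · rcases Nat.lt_succ_iff_lt_or_eq.1 ha with ha | rfl
            · exact .inl (.inr ⟨a, ha, h⟩)
            · exact .inr h
    obtain ⟨h1, h2⟩ := key2 N le_rfl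
    refine ⟨h1, fun k => (h2 k).trans (or_congr_right ?_)⟩
    constructor
    · rintro ⟨a, ha, v, h3, h4, h5⟩
      exact ⟨a :: v, by simp [h3], by simpa using ⟨ha, h4⟩, h5⟩
    · rintro ⟨v, h3, h4, h5⟩
      cases v with
      | nil => simp at h3
      | cons a v =>
        have h6 := List.forall_mem_cons.1 h4
        exact ⟨a, h6.1, v, by simpa using h3, h6.2, h5⟩

/-- `define` computes a relation that is specified by recursion on its first argument. -/
theorem eval_define {N tag : ℕ} {φ : Form} {x : Var} {ys : List Var} (hxs : (x :: ys).Nodup)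
    {ρ : Var → ℕ} {D : List (List ℕ)} (hfresh : ∀ v, ¬ relOf D tag v) (Q : List ℕ → Prop)
    (hφ : ∀ a v, v.length = ys.length → a < N → (∀ b ∈ v, b < N) → ∀ R : ℕ → List ℕ → Prop,
      (∀ t ≠ tag, R t = relOf D t) →
      (∀ a' < a, ∀ v', R tag (a' :: v') ↔ v'.length = ys.length ∧ (∀ b ∈ v', b < N) ∧
        Q (a' :: v')) →
      (φ.Holds N R (assign ρ (x :: ys) (a :: v)) ↔ Q (a :: v))) :
    (∀ t ≠ tag, relOf ((define tag (x :: ys) φ).eval N ρ D) t = relOf D t) ∧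
    ∀ a v, relOf ((define tag (x :: ys) φ).eval N ρ D) tag (a :: v) ↔
      v.length = ys.length ∧ a < N ∧ (∀ b ∈ v, b < N) ∧ Q (a :: v) := by
  let body := ys.foldr Cmd.loop (.test φ (.ins tag ((x :: ys).map .var)))
  let E : ℕ → List (List ℕ) := fun i => Nat.rec D (fun i D' => body.eval N (update ρ x i) D') i
  let I : ℕ → List (List ℕ) → Prop := fun i D' => (∀ t ≠ tag, relOf D' t = relOf D t) ∧
    ∀ a < i, ∀ v, relOf D' tag (a :: v) ↔ v.length = ys.length ∧ (∀ b ∈ v, b < N) ∧ Q (a :: v)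
  have key : ∀ i ≤ N, I i (E i) ∧ ∀ a ≥ i, ∀ v, ¬ relOf (E i) tag (a :: v) := by
    intro i
    induction i with
    | zero => exact fun _ => ⟨⟨fun _ _ => rfl, by simp⟩, fun a _ v => hfresh _⟩
    | succ i ih =>
      intro hi
      obtain ⟨h1, h2⟩ := ih (by omega)
      obtain ⟨h3, h4⟩ := eval_nest (N := N) (φ := φ) (tag := tag) (ts := (x :: ys).map .var)
        ys (update ρ x i) (E i) (I i) (fun v => Q (i :: v)) (fun v => tag :: i :: v)
        (fun v hv => by
          congr 1
          rw [List.map_map]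
          exact map_assign (ρ := ρ) hxs (v := i :: v) (by simp [hv]))
        (fun D' v hD' => by
          refine ⟨fun t ht => ?_, fun a ha u => ?_⟩
          · rw [← hD'.1 t ht]
            funext u
            simp [relOf, ht]
          · rw [← hD'.2 a ha]
            simp [relOf, ha.ne])
        (fun v hv hb D' hD' => hφ i v hv (by omega) hb _ hD'.1 hD'.2) h1
      have h5 : E (i + 1) = body.eval N (update ρ x i) (E i) := rfl
      rw [h5]
      refine ⟨⟨h3.1, fun a ha v => ?_⟩, fun a ha v hv => ?_⟩
      · rcases Nat.lt_succ_iff_lt_or_eq.1 ha with ha | rfl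
        · exact h3.2 a ha v
        · refine (h4 _).trans ?_
          constructor
          · rintro (h | ⟨u, h6, h7, h8, h9⟩)
            · exact absurd h (h2 a le_rfl v)
            · obtain rfl : v = u := by simpa using h9
              exact ⟨h6, h7, h8⟩
          · rintro ⟨h6, h7, h8⟩
            exact .inr ⟨v, h6, h7, h8, rfl⟩
      · rcases (h4 _).1 hv with h | ⟨u, _, _, _, h9⟩
        · exact h2 a (by omega) v h
        · have : a = i := by simp at h9; exact h9.1
          omega
  obtain ⟨h1, h2⟩ := key N le_rfl
  refine ⟨h1.1, fun a v => ?_⟩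
  change relOf (E N) tag (a :: v) ↔ _
  by_cases ha : a < N
  · rw [h1.2 a ha]; tauto
  · have := h2 a (by omega) v
    tauto

variable {N tag : ℕ} {φ : Form} {ρ : Var → ℕ} {D : List (List ℕ)}

theorem eval_define₁ {x : Var} (hfresh : ∀ v, ¬ relOf D tag v) (P : ℕ → Prop)
    (hφ : ∀ a, a < N → ∀ R : ℕ → List ℕ → Prop, (∀ t ≠ tag, R t = relOf D t) →
      (∀ a' < a, R tag [a'] ↔ P a') → (φ.Holds N R (update ρ x a) ↔ P a)) :
    (∀ t ≠ tag, relOf ((define tag [x] φ).eval N ρ D) t = relOf D t) ∧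
    ∀ a, relOf ((define tag [x] φ).eval N ρ D) tag [a] ↔ a < N ∧ P a := by
  obtain ⟨h1, h2⟩ := eval_define (N := N) (φ := φ) (x := x) (ys := []) (by simp) (ρ := ρ) hfresh
    (fun v => ∃ a, v = [a] ∧ P a) (fun a v hv ha hb R hR hR' => by
      obtain rfl := List.length_eq_zero_iff.1 hv
      simpa using hφ a ha R hR fun a' ha' => by simpa using hR' a' ha' [])
  exact ⟨h1, fun a => by rw [h2]; simp⟩

theorem eval_define₂ {x y : Var} (hxy : [x, y].Nodup) (hfresh : ∀ v, ¬ relOf D tag v)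
    (P : ℕ → ℕ → Prop)
    (hφ : ∀ a b, a < N → b < N → ∀ R : ℕ → List ℕ → Prop, (∀ t ≠ tag, R t = relOf D t) →
      (∀ a' < a, ∀ b', R tag [a', b'] ↔ b' < N ∧ P a' b') →
      (φ.Holds N R (update (update ρ x a) y b) ↔ P a b)) :
    (∀ t ≠ tag, relOf ((define tag [x, y] φ).eval N ρ D) t = relOf D t) ∧
    ∀ a b, relOf ((define tag [x, y] φ).eval N ρ D) tag [a, b] ↔ a < N ∧ b < N ∧ P a b := by
  obtain ⟨h1, h2⟩ := eval_define (N := N) (φ := φ) hxy (ρ := ρ) hfresh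
    (fun v => ∃ a b, v = [a, b] ∧ P a b) (fun a v hv ha hb R hR hR' => by
      obtain ⟨b, rfl⟩ := List.length_eq_one_iff.1 hv
      simpa using hφ a b ha (hb b (by simp)) R hR fun a' ha' b' => by simpa using hR' a' ha' [b'])
  exact ⟨h1, fun a b => by rw [h2]; simp⟩

theorem eval_define₃ {x y z : Var} (hxy : [x, y, z].Nodup) (hfresh : ∀ v, ¬ relOf D tag v)
    (P : ℕ → ℕ → ℕ → Prop)
    (hφ : ∀ a b c, a < N → b < N → c < N → ∀ R : ℕ → List ℕ → Prop, (∀ t ≠ tag, R t = relOf D t) →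
      (∀ a' < a, ∀ b' c', R tag [a', b', c'] ↔ b' < N ∧ c' < N ∧ P a' b' c') →
      (φ.Holds N R (update (update (update ρ x a) y b) z c) ↔ P a b c)) :
    (∀ t ≠ tag, relOf ((define tag [x, y, z] φ).eval N ρ D) t = relOf D t) ∧
    ∀ a b c, relOf ((define tag [x, y, z] φ).eval N ρ D) tag [a, b, c] ↔
      a < N ∧ b < N ∧ c < N ∧ P a b c := by
  obtain ⟨h1, h2⟩ := eval_define (N := N) (φ := φ) hxy (ρ := ρ) hfresh
    (fun v => ∃ a b c, v = [a, b, c] ∧ P a b c) (fun a v hv ha hb R hR hR' => by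
      obtain ⟨b, c, rfl⟩ := List.length_eq_two.1 hv
      simpa using hφ a b c ha (hb b (by simp)) (hb c (by simp)) R hR
        fun a' ha' b' c' => by simpa [and_assoc] using hR' a' ha' [b', c'])
  exact ⟨h1, fun a b c => by rw [h2]; simp [and_assoc]⟩

theorem eval_define₄ {x y z r : Var} (hxy : [x, y, z, r].Nodup) (hfresh : ∀ v, ¬ relOf D tag v)
    (P : ℕ → ℕ → ℕ → ℕ → Prop)
    (hφ : ∀ a b c d, a < N → b < N → c < N → d < N → ∀ R : ℕ → List ℕ → Prop,
      (∀ t ≠ tag, R t = relOf D t) →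
      (∀ a' < a, ∀ b' c' d', R tag [a', b', c', d'] ↔ b' < N ∧ c' < N ∧ d' < N ∧ P a' b' c' d') →
      (φ.Holds N R (update (update (update (update ρ x a) y b) z c) r d) ↔ P a b c d)) :
    (∀ t ≠ tag, relOf ((define tag [x, y, z, r] φ).eval N ρ D) t = relOf D t) ∧
    ∀ a b c d, relOf ((define tag [x, y, z, r] φ).eval N ρ D) tag [a, b, c, d] ↔
      a < N ∧ b < N ∧ c < N ∧ d < N ∧ P a b c d := by
  obtain ⟨h1, h2⟩ := eval_define (N := N) (φ := φ) hxy (ρ := ρ) hfresh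
    (fun v => ∃ a b c d, v = [a, b, c, d] ∧ P a b c d) (fun a v hv ha hb R hR hR' => by
      obtain ⟨b, c, d, rfl⟩ := List.length_eq_three.1 hv
      simpa using hφ a b c d ha (hb b (by simp)) (hb c (by simp)) (hb d (by simp)) R hR
        fun a' ha' b' c' d' => by simpa [and_assoc] using hR' a' ha' [b', c', d'])
  exact ⟨h1, fun a b c d => by rw [h2]; simp [and_assoc]⟩

end Cmd

/-! ### Reachability -/

/-- `ReachIn B S k v`: a path of at most `k` steps in `S` leads from `B` to `v`. -/
inductive ReachIn {V : Type*} (B : V → Prop) (S : V → V → Prop) : ℕ → V → Prop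
  | base {k : ℕ} {v : V} : B v → ReachIn B S k v
  | step {k l : ℕ} {u v : V} : ReachIn B S k u → S u v → k < l → ReachIn B S l v

namespace ReachIn

open Relation

variable {V : Type*} {B : V → Prop} {S : V → V → Prop}

lemma iff (k : ℕ) (v : V) :
    ReachIn B S k v ↔ B v ∨ ∃ j < k, ∃ u, ReachIn B S j u ∧ S u v := by
  constructor
  · rintro (h | ⟨h1, h2, h3⟩)
    · exact .inl h
    · exact .inr ⟨_, h3, _, h1, h2⟩
  · rintro (h | ⟨j, hj, u, h1, h2⟩)
    · exact .base h
    · exact .step h1 h2 hj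

lemma mono {k l : ℕ} (hkl : k ≤ l) {v : V} (h : ReachIn B S k v) : ReachIn B S l v := by
  cases h with
  | base h => exact .base h
  | step h1 h2 h3 => exact .step h1 h2 (h3.trans_le hkl)

lemma succ_iff (k : ℕ) (v : V) :
    ReachIn B S (k + 1) v ↔ B v ∨ ∃ u, ReachIn B S k u ∧ S u v := by
  rw [iff]
  refine or_congr_right ⟨?_, ?_⟩
  · rintro ⟨j, hj, u, h1, h2⟩
    exact ⟨u, h1.mono (by omega), h2⟩
  · rintro ⟨u, h1, h2⟩
    exact ⟨k, by omega, u, h1, h2⟩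

/-- Among `N` nodes, paths of fewer than `N` steps reach everything that can be reached. -/
lemma exists_iff {B : ℕ → Prop} {S : ℕ → ℕ → Prop} {N : ℕ} (hB : ∀ v, B v → v < N)
    (hS : ∀ u v, S u v → v < N) (v : ℕ) :
    (∃ k < N, ReachIn B S k v) ↔ ∃ u, B u ∧ ReflTransGen S u v := by
  constructor
  · rintro ⟨k, -, h⟩
    induction h with
    | base h => exact ⟨_, h, .refl⟩
    | step _ h _ ih =>
      obtain ⟨u, h1, h2⟩ := ih
      exact ⟨u, h1, h2.tail h⟩
  · rintro ⟨u, h1, h2⟩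
    have hN : u < N := hB u h1
    have hlt : ∀ k v, ReachIn B S k v → v < N := by
      rintro k v (h | ⟨_, h, _⟩)
      exacts [hB _ h, hS _ _ h]
    have hst := fun k (hk : N - 1 ≤ k) =>
      eq_of_card_le (S := fun k => {v : Fin N | ReachIn B S k v}) (m := N - 1) (k := k)
      (fun k v hv => hv.mono (by omega)) (fun k h => by
        ext v
        simp only [Set.mem_ofPred_eq, Set.ext_iff] at h ⊢
        rw [succ_iff, succ_iff (k + 1)]
        refine or_congr_right (exists_congr fun w => and_congr_left fun _ => ?_)
        constructor
        · exact fun hw => (h ⟨w, hlt _ _ hw⟩).1 hw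
        · exact fun hw => (h ⟨w, hlt _ _ hw⟩).2 hw)
      (by
        have : 0 < Set.ncard {v : Fin N | ReachIn B S 0 v} :=
          (Set.ncard_pos (Set.toFinite _)).2 ⟨⟨u, hN⟩, .base h1⟩
        rw [Nat.card_eq_fintype_card, Fintype.card_fin]
        omega) hk
    refine ⟨N - 1, by omega, ?_⟩
    induction h2 with
    | refl => exact .base h1
    | @tail c w _ h ih =>
      have h3 : ReachIn B S N w := .step ih h (by omega)
      have := hst N (by omega)
      exact (Set.ext_iff.1 this ⟨w, hlt _ _ h3⟩).1 h3

end ReachIn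

namespace Cmd

open Function Relation

/-- The relation of all `(k, p, q, v)` such that a path of at most `k` steps leads to `v` from a
number with the property `base`; the variables 5 and 6 hold the parameters `p` and `q` of `base`
and `step`, the variable 7 holds `v`, and `step` tests for an edge from the value of the
variable 9. -/
def closure (tag : ℕ) (base step : Form) : Cmd :=
  define tag [4, 5, 6, 7] (.disj base (.ex 8 (.ex 9 (.conjs
    [.lt (.var 8) (.var 4), .mem tag [.var 8, .var 5, .var 6, .var 9], step]))))

/-- The assignment of the variables 4 to 7. -/
abbrev upd (ρ : Var → ℕ) (k p q v : ℕ) : Var → ℕ :=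
  update (update (update (update ρ 4 k) 5 p) 6 q) 7 v

theorem eval_closure {N tag : ℕ} {base step : Form} {ρ : Var → ℕ} {D : List (List ℕ)}
    (hfresh : ∀ v, ¬ relOf D tag v) (B : ℕ → ℕ → ℕ → Prop) (S : ℕ → ℕ → ℕ → ℕ → Prop)
    (hB : ∀ p q v, B p q v → v < N) (hS : ∀ p q u v, S p q u v → v < N)
    (hbase : ∀ k p q v, k < N → p < N → q < N → v < N → ∀ R : ℕ → List ℕ → Prop,
      (∀ t ≠ tag, R t = relOf D t) → (base.Holds N R (upd ρ k p q v) ↔ B p q v))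
    (hstep : ∀ k p q v j u, p < N → q < N → v < N → u < N → ∀ R : ℕ → List ℕ → Prop,
      (∀ t ≠ tag, R t = relOf D t) →
        (step.Holds N R (update (update (upd ρ k p q v) 8 j) 9 u) ↔ S p q u v)) :
    (∀ t ≠ tag, relOf ((closure tag base step).eval N ρ D) t = relOf D t) ∧
    ∀ p q v, p < N → q < N → v < N →
      ((∃ k < N, relOf ((closure tag base step).eval N ρ D) tag [k, p, q, v]) ↔
        ∃ u, B p q u ∧ ReflTransGen (S p q) u v) := by
  obtain ⟨h1, h2⟩ := eval_define₄ (N := N) (tag := tag) (ρ := ρ) (D := D) (x := 4) (y := 5)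
    (z := 6) (r := 7) (φ := .disj base (.ex 8 (.ex 9 (.conjs
    [.lt (.var 8) (.var 4), .mem tag [.var 8, .var 5, .var 6, .var 9], step]))))
    (by decide) hfresh (fun k p q v => ReachIn (B p q) (S p q) k v) (by
    intro k p q v hk hp hq hv R hR hR'
    simp only [Form.holds_disj, Form.holds_ex, Form.conjs, Form.holds_conj, Form.holds_lt,
      Form.holds_mem]
    rw [hbase k p q v hk hp hq hv R hR, ReachIn.iff]
    refine or_congr_right ?_
    constructor
    · rintro ⟨j, hj, u, hu, h3, h4, h5⟩
      rw [hstep k p q v j u hp hq hv hu R hR] at h5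
      simp at h3 h4
      rw [hR' j h3] at h4
      exact ⟨j, h3, u, h4.2.2.2, h5⟩
    · rintro ⟨j, hj, u, h3, h4⟩
      have hu : u < N := by
        rcases h3 with h | ⟨_, h, _⟩
        exacts [hB _ _ _ h, hS _ _ _ _ h]
      refine ⟨j, by omega, u, hu, ?_, ?_, (hstep k p q v j u hp hq hv hu R hR).2 h4⟩
      · simpa [update_apply] using hj
      · simp
        rw [hR' j hj]
        exact ⟨hp, hq, hu, h3⟩)
  refine ⟨h1, fun p q v hp hq hv => ?_⟩
  rw [← ReachIn.exists_iff (hB p q) (hS p q)]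
  refine exists_congr fun k => and_congr_right fun hk => ?_
  rw [closure, h2]
  tauto

end Cmd

/-! ### A program for d-separation in the unfoldings of a template -/

namespace DSeparation

open Relation

variable {V W : Type*}

/-- Treks between nodes of slice `t` that avoid the set in this slice, for the edge relations `E0`
within the first slice, `E1` within the later slices, and `I` between consecutive slices. -/
def trekAt (E0 E1 I : V → V → Prop) : ℕ → Set V → V → V → Prop
  | 0, Z => stepTrek E0 I Z fun _ _ => False
  | t + 1, Z => stepTrek E1 I Z (trekAt E0 E1 I t ∅)

/-- `X` and `Y` are separated by `Z` at time `t`. -/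
def Separated (E0 E1 I : V → V → Prop) (t : ℕ) (X Y Z : Set V) : Prop :=
  ¬ ∃ y ∈ Y, ∃ u, Linked (trekAt E0 E1 I t Z) X Z u ∧ trekAt E0 E1 I t Z u y

lemma linked_iff_reflTransGen {K : V → V → Prop} {X Z : Set V} {v : V} :
    Linked K X Z v ↔ ∃ u, u ∈ X ∧ ReflTransGen (fun a b => K a b ∧ b ∈ Z) u v := by
  constructor
  · intro h
    induction h with
    | base h => exact ⟨_, h, .refl⟩
    | step _ h1 h2 ih =>
      obtain ⟨u, hu, h3⟩ := ih
      exact ⟨u, hu, h3.tail ⟨h1, h2⟩⟩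
  · rintro ⟨u, hu, h⟩
    induction h with
    | refl => exact .base hu
    | tail _ h ih => exact .step ih h.1 h.2

/-- The edge relation between numbers below `n` that is given by the bits of a matrix, the word
starting at position `off`. -/
def bitEdge (bit : ℕ → Prop) (n off x y : ℕ) : Prop :=
  x < n ∧ y < n ∧ bit (off + x * n + y)

/-- The subset of the numbers below `n` given by the bits from position `off` on. -/
def bitSet (bit : ℕ → Prop) (n off : ℕ) : Set ℕ :=
  {v | v < n ∧ bit (off + v)}

/-- The trek relation of the template read off the bits, with respect to the third set of the
proposition at position `s`. -/
def bitTrek (bit : ℕ → Prop) (n t s : ℕ) : ℕ → ℕ → Prop :=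
  trekAt (bitEdge bit n (n + 1)) (bitEdge bit n (n + 1 + n * n + n * n))
    (bitEdge bit n (n + 1 + n * n)) t (bitSet bit n (s + 1 + n + n))

/-- The proposition at position `s` holds at time `t`, in the template read off the bits. -/
def BitHolds (bit : ℕ → Prop) (n s t : ℕ) : Prop :=
  Separated (bitEdge bit n (n + 1)) (bitEdge bit n (n + 1 + n * n + n * n))
    (bitEdge bit n (n + 1 + n * n)) t (bitSet bit n (s + 1)) (bitSet bit n (s + 1 + n))
    (bitSet bit n (s + 1 + n + n))

lemma Directed.lt {bit : ℕ → Prop} {n off N : ℕ} {Z : Set ℕ} {c u : ℕ}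
    (h : Directed (bitEdge bit n off) Z c u) (hn : n < N) (hu : u < N) : c < N := by
  rcases ReflTransGen.cases_head h with rfl | ⟨d, h1, _⟩
  · exact hu
  · exact h1.1.1.trans hn

end DSeparation

/-- The edge relation `bitEdge` as a formula. The variable 0 holds the number of variables of the
template. -/
def Form.edge (off : Term) (x y : Var) : Form :=
  .conjs [.lt (.var x) (.var 0), .lt (.var y) (.var 0), .mem 1 [off + .prod x 0 + .var y]]

/-- Membership in `bitSet` as a formula. -/
def Form.inSet (off : Term) (x : Var) : Form :=
  .conjs [.lt (.var x) (.var 0), .mem 1 [off + .var x]]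

/-- The path relation computed by `Cmd.closure`. -/
def Form.reach (tag : ℕ) (p q v : Var) : Form :=
  .ex 15 (.mem tag [.var 15, .var p, .var q, .var v])

/-- Position of the third set of the proposition whose position is held by `s`. -/
def Term.offZ (s : Var) : Term := .var s + .const 1 + .var 0 + .var 0

namespace Cmd

open Function Relation DSeparation

/-- The relation of all `(k, s, u, v)` such that a path of at most `k` edges of the matrix at `off`
leads from `u` to `v` and avoids the third set of the proposition at position `s`, except possibly
at `v`. -/
def directed (tag : ℕ) (off : Term) : Cmd :=
  closure tag (.eq (.var 7) (.var 6))
    (.conj (.edge off 9 7) (.neg (.inSet (.offZ 5) 9)))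

/-- The relation of all `(t, s, u, v)` such that `bitTrek bit n t s u v`. The variable 1 holds the
last position, at which no proposition starts; hence the set read there is empty. -/
def treks : Cmd :=
  define 10 [4, 5, 6, 7] (.disj
    (.conj (.le (.var 4) (.const 0)) (.ex 8 (.conjs
      [.neg (.inSet (.offZ 5) 8), .reach 8 5 8 6, .reach 8 5 8 7])))
    (.ex 8 (.conj (.eq (.var 8 + .const 1) (.var 4)) (.disj
      (.ex 9 (.conjs [.neg (.inSet (.offZ 5) 9), .reach 9 5 9 6, .reach 9 5 9 7]))
      (.ex 9 (.ex 10 (.ex 11 (.ex 12 (.conjs [.mem 10 [.var 8, .var 1, .var 9, .var 10],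
        .edge (.var 0 + .const 1 + .prod 0 0) 9 11, .edge (.var 0 + .const 1 + .prod 0 0) 10 12,
        .reach 9 5 11 6, .reach 9 5 12 7])))))))))

/-- The program computing, as relation 12, which propositions hold at which times: the paths within
the first slice (8) and within a later slice (9), the treks (10), and the chains of treks (11). -/
def separation : Cmd :=
  .seq (directed 8 (.var 0 + .const 1)) <|
  .seq (directed 9 (.var 0 + .const 1 + .prod 0 0 + .prod 0 0)) <|
  .seq treks <|
  .seq (closure 11 (.inSet (.var 5 + .const 1) 7)
    (.conj (.mem 10 [.var 6, .var 5, .var 9, .var 7]) (.inSet (.offZ 5) 7))) <|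
  define 12 [4, 5] (.neg (.ex 6 (.ex 7 (.conjs [.inSet (.var 4 + .const 1 + .var 0) 7,
    .reach 11 4 5 6, .mem 10 [.var 5, .var 4, .var 6, .var 7]]))))

variable {N n : ℕ} {ρ : Var → ℕ} {D : List (List ℕ)} {bit : ℕ → Prop}

lemma eval_directed {tag : ℕ} (htag : tag ≠ 1) {off : Term} {o : ℕ}
    (hoff : ∀ ρ' : Var → ℕ, ρ' 0 = n → off.val ρ' = o) (hn : n < N) (h0 : ρ 0 = n)
    (hbit : ∀ i, relOf D 1 [i] ↔ bit i) (hfresh : ∀ v, ¬ relOf D tag v) :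
    (∀ t ≠ tag, relOf ((directed tag off).eval N ρ D) t = relOf D t) ∧
    ∀ s c u, s < N → c < N → u < N →
      ((∃ k < N, relOf ((directed tag off).eval N ρ D) tag [k, s, c, u]) ↔
        Directed (bitEdge bit n o) (bitSet bit n (s + 1 + n + n)) c u) := by
  obtain ⟨h1, h2⟩ := eval_closure (N := N) (tag := tag) (ρ := ρ) (D := D)
    (base := .eq (.var 7) (.var 6))
    (step := .conj (.edge off 9 7) (.neg (.inSet (.offZ 5) 9))) hfresh
    (fun s c u => c < N ∧ c = u)
    (fun s _ a b => bitEdge bit n o a b ∧ a ∉ bitSet bit n (s + 1 + n + n))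
    (fun s c u h => h.2 ▸ h.1) (fun s _ a b h => h.1.2.1.trans hn)
    (fun k p q v _ _ hq _ R _ => by simp [hq, eq_comm])
    (fun k p q v j u hp hq hv hu R hR => by
      have h3 := hoff (update (update (upd ρ k p q v) 8 j) 9 u) (by simp [h0])
      simp [Form.edge, Form.inSet, Form.conjs, hR 1 htag.symm, hbit, h3, h0, bitEdge, bitSet,
        Term.offZ])
  refine ⟨h1, fun s c u hs hc hu => (h2 s c u hs hc hu).trans ?_⟩
  simp [hc, DSeparation.Directed]

lemma eval_treks (hn : n < N) (h0 : ρ 0 = n) (h1 : ρ 1 + 1 = N)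
    (hbit : ∀ i, relOf D 1 [i] ↔ bit i) (hN : ∀ i, bit i → i < N)
    (h8 : ∀ s c u, s < N → c < N → u < N → ((∃ k < N, relOf D 8 [k, s, c, u]) ↔
        Directed (bitEdge bit n (n + 1)) (bitSet bit n (s + 1 + n + n)) c u))
    (h9 : ∀ s c u, s < N → c < N → u < N → ((∃ k < N, relOf D 9 [k, s, c, u]) ↔
        Directed (bitEdge bit n (n + 1 + n * n + n * n)) (bitSet bit n (s + 1 + n + n)) c u))
    (hfresh : ∀ v, ¬ relOf D 10 v) :
    (∀ t ≠ 10, relOf (treks.eval N ρ D) t = relOf D t) ∧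
    ∀ t s u v, relOf (treks.eval N ρ D) 10 [t, s, u, v] ↔
      t < N ∧ s < N ∧ u < N ∧ v < N ∧ bitTrek bit n t s u v := by
  refine eval_define₄ (by decide) hfresh (fun t s u v => bitTrek bit n t s u v) ?_
  intro t s u v ht hs hu hv R hR hR'
  have hempty : bitSet bit n (N - 1 + 1 + n + n) = ∅ := by
    refine Set.eq_empty_of_forall_notMem fun x hx => ?_
    have := hN _ hx.2
    omega
  simp only [Form.holds_disj, Form.holds_ex, Form.conjs, Form.holds_conj, Form.holds_lt,
      Form.holds_mem, Form.reach, Form.inSet, Form.edge, Form.holds_neg, Form.holds_le,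
      Form.holds_eq, Term.offZ, hR 1 (by decide), hR 8 (by decide), hR 9 (by decide)]
  simp [hbit, h0]
  have hdir : ∀ (r : ℕ → ℕ → ℕ → ℕ → Prop) (o : ℕ), (∀ s c u, s < N → c < N → u < N →
      ((∃ k < N, r k s c u) ↔
        DSeparation.Directed (bitEdge bit n o) (bitSet bit n (s + 1 + n + n)) c u)) →
      ((∃ i < N, (i < n → ¬ bit (s + 1 + n + n + i)) ∧ (∃ k < N, r k s i u) ∧ ∃ k < N, r k s i v) ↔
        ∃ c ∉ bitSet bit n (s + 1 + n + n),
          DSeparation.Directed (bitEdge bit n o) (bitSet bit n (s + 1 + n + n)) c u ∧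
          DSeparation.Directed (bitEdge bit n o) (bitSet bit n (s + 1 + n + n)) c v) := by
    intro r o hr
    constructor
    · rintro ⟨c, hc, h2, h3, h4⟩
      exact ⟨c, fun h => h2 h.1 h.2, (hr s c u hs hc hu).1 h3, (hr s c v hs hc hv).1 h4⟩
    · rintro ⟨c, h2, h3, h4⟩
      have hc := h3.lt hn hu
      exact ⟨c, hc, fun h h' => h2 ⟨h, h'⟩, (hr s c u hs hc hu).2 h3, (hr s c v hs hc hv).2 h4⟩
  have h8' := hdir _ _ h8
  have h9' := hdir _ _ h9
  cases t with
  | zero =>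
    simp only [true_and, Nat.add_eq_zero_iff, one_ne_zero, and_false, false_and, exists_false,
      or_false]
    rw [h8']
    simp [bitTrek, trekAt, stepTrek]
  | succ t =>
    simp only [Nat.add_eq_zero_iff, one_ne_zero, and_false, false_and, false_or,
      Nat.add_right_cancel_iff]
    rw [bitTrek, trekAt, stepTrek, ← h9', ← hempty]
    constructor
    · rintro ⟨i, hi, rfl, h2 | ⟨a, ha, a', ha', b, hb, b', hb', h2, h3, h4, h5, h6⟩⟩
      · exact .inl h2
      · rw [hR' i (by omega), show ρ 1 = N - 1 by omega] at h2
        exact .inr ⟨a, a', b, b', h2.2.2.2, h3, h4, (h9 _ _ _ hs hb hu).1 h5,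
          (h9 _ _ _ hs hb' hv).1 h6⟩
    · intro h
      refine ⟨t, by omega, rfl, h.imp_right ?_⟩
      rintro ⟨a, a', b, b', h2, h3, h4, h5, h6⟩
      have hb := h3.2.1.trans hn
      have hb' := h4.2.1.trans hn
      have ha := h3.1.trans hn
      have ha' := h4.1.trans hn
      refine ⟨a, ha, a', ha', b, hb, b', hb', ?_, h3, h4, (h9 _ _ _ hs hb hu).2 h5,
          (h9 _ _ _ hs hb' hv).2 h6⟩
      rw [hR' t (by omega), show ρ 1 = N - 1 by omega]
      exact ⟨by omega, ha, ha', h2⟩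

theorem eval_separation (hn : n < N) (h0 : ρ 0 = n) (h1 : ρ 1 + 1 = N)
    (hbit : ∀ i, relOf D 1 [i] ↔ bit i) (hN : ∀ i, bit i → i < N)
    (hfresh : ∀ t, 8 ≤ t → ∀ v, ¬ relOf D t v) :
    (∀ t < 8, relOf (separation.eval N ρ D) t = relOf D t) ∧
    (∀ t, 13 ≤ t → ∀ v, ¬ relOf (separation.eval N ρ D) t v) ∧
    ∀ s t, relOf (separation.eval N ρ D) 12 [s, t] ↔ s < N ∧ t < N ∧ BitHolds bit n s t := by
  simp only [separation, eval]
  obtain ⟨a1, a2⟩ := eval_directed (N := N) (tag := 8) (by decide) (off := .var 0 + .const 1)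
    (o := n + 1) (by simp) hn h0 hbit (hfresh 8 (by decide))
  generalize (directed 8 (.var 0 + .const 1)).eval N ρ D = D1 at a1 a2 ⊢
  obtain ⟨b1, b2⟩ := eval_directed (N := N) (tag := 9) (ρ := ρ) (D := D1) (by decide)
    (off := .var 0 + .const 1 + .prod 0 0 + .prod 0 0)
    (o := n + 1 + n * n + n * n) (by simp +contextual) hn h0 (by simpa [a1 1 (by decide)])
    (by simpa [a1 9 (by decide)] using hfresh 9 (by decide))
  generalize (directed 9 _).eval N ρ D1 = D2 at b1 b2 ⊢
  obtain ⟨c1, c2⟩ := eval_treks (N := N) (ρ := ρ) (D := D2) (bit := bit) hn h0 h1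
    (by simpa [a1 1 (by decide), b1 1 (by decide)]) hN (by simpa [b1 8 (by decide)]) b2
    (by simpa [a1 10 (by decide), b1 10 (by decide)] using hfresh 10 (by decide))
  generalize treks.eval N ρ D2 = D3 at c1 c2 ⊢
  obtain ⟨d1, d2⟩ := eval_closure (N := N) (tag := 11) (ρ := ρ) (D := D3)
    (base := .inSet (.var 5 + .const 1) 7)
    (step := .conj (.mem 10 [.var 6, .var 5, .var 9, .var 7]) (.inSet (.offZ 5) 7))
    (by simpa [a1 11 (by decide), b1 11 (by decide), c1 11 (by decide)] using hfresh 11 (by decide))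
    (fun s t v => v ∈ bitSet bit n (s + 1))
    (fun s t u v => bitTrek bit n t s u v ∧ v ∈ bitSet bit n (s + 1 + n + n))
    (fun s t v h => h.1.trans hn) (fun s t u v h => h.2.1.trans hn)
    (fun k s t v _ hs ht hv R hR => by
      simp [Form.inSet, Form.conjs, hR 1 (by decide), a1 1 (by decide), b1 1 (by decide),
        c1 1 (by decide), hbit, h0, bitSet])
    (fun k s t v j u hs ht hv hu R hR => by
      simp [Form.inSet, Form.conjs, hR 1 (by decide), a1 1 (by decide), b1 1 (by decide),
        c1 1 (by decide), hbit, h0, bitSet, hR 10 (by decide), Term.offZ, c2, hs, ht, hu, hv])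
  generalize (closure 11 _ _).eval N ρ D3 = D4 at d1 d2 ⊢
  obtain ⟨e1, e2⟩ := eval_define₂ (N := N) (tag := 12) (x := 4) (y := 5) (ρ := ρ) (D := D4)
    (φ := .neg (.ex 6 (.ex 7 (.conjs [.inSet (.var 4 + .const 1 + .var 0) 7,
    .reach 11 4 5 6, .mem 10 [.var 5, .var 4, .var 6, .var 7]])))) (by decide)
    (by simpa [a1 12 (by decide), b1 12 (by decide), c1 12 (by decide), d1 12 (by decide)]
      using hfresh 12 (by decide))
    (fun s t => BitHolds bit n s t) (fun s t hs ht R hR _ => by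
      rw [Form.holds_neg, BitHolds, Separated, not_iff_not]
      simp only [Form.holds_ex, Form.conjs, Form.holds_conj, Form.inSet, Form.reach,
        Form.holds_lt, Form.holds_mem, hR 1 (by decide), hR 11 (by decide), hR 10 (by decide),
        a1 1 (by decide), b1 1 (by decide),
        c1 1 (by decide), d1 1 (by decide), d1 10 (by decide)]
      simp only [linked_iff_reflTransGen]
      simp [h0, hbit, c2]
      constructor
      · rintro ⟨u, hu, y, hy, h2, h3, h4⟩
        exact ⟨y, h2, u, (d2 s t u hs ht hu).1 h3, h4.2.2.2.2⟩
      · rintro ⟨y, hy, u, h2, h3⟩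
        have hu : u < N := by
          obtain ⟨x, hx, h4⟩ := h2
          rcases ReflTransGen.cases_tail h4 with rfl | ⟨z, _, h4⟩
          exacts [hx.1.trans hn, h4.2.1.trans hn]
        have hy' := hy.1.trans hn
        exact ⟨u, hu, y, hy', hy, (d2 s t u hs ht hu).2 h2, ht, hs, hu, hy', h3⟩)
  refine ⟨fun t ht => ?_, fun t ht v => ?_, e2⟩
  · rw [e1 t (by omega), d1 t (by omega), c1 t (by omega), b1 t (by omega), a1 t (by omega)]
  · rw [e1 t (by omega), d1 t (by omega), c1 t (by omega), b1 t (by omega), a1 t (by omega)]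
    exact hfresh t (by omega) v

end Cmd

/-! ### The template and its propositions in the input word -/

namespace DSeparation

open Relation

variable {V W : Type*} {f : V → W} {r : V → V → Prop} {Z : Set W}

lemma directed_map_iff (hf : f.Injective) {a b : V} :
    Directed (Relation.Map r f f) Z (f a) (f b) ↔ Directed r (f ⁻¹' Z) a b := by
  constructor
  · intro h
    suffices ∀ x, Directed (Relation.Map r f f) Z x (f b) → ∀ a, x = f a →
        Directed r (f ⁻¹' Z) a b from this _ h a rfl
    intro x hx
    induction hx using ReflTransGen.head_induction_on with
    | refl => rintro a h; obtain rfl := hf h; exact .refl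
    | head h _ ih =>
      rintro a rfl
      obtain ⟨⟨a', c, h1, h2, rfl⟩, h3⟩ := h
      obtain rfl := hf h2
      exact .head ⟨h1, h3⟩ (ih c rfl)
  · exact Directed.map f fun a b hab ha => ⟨⟨a, b, hab, rfl, rfl⟩, ha⟩

lemma mem_range_of_directed_map {c : W} {b : V} (h : Directed (Relation.Map r f f) Z c (f b)) :
    ∃ a, f a = c := by
  rcases ReflTransGen.cases_head h with rfl | ⟨_, ⟨⟨a, _, _, h, _⟩, _⟩, _⟩
  exacts [⟨b, rfl⟩, ⟨a, h⟩]

lemma trekAt_map_iff (hf : f.Injective) (E0 E1 I : V → V → Prop) (t : ℕ) (Z : Set W)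
    (u v : V) :
    trekAt (Relation.Map E0 f f) (Relation.Map E1 f f) (Relation.Map I f f) t Z (f u) (f v) ↔
      trekAt E0 E1 I t (f ⁻¹' Z) u v := by
  have h1 : ∀ (Z : Set W) (E : V → V → Prop) (u v : V),
      (∃ c ∉ Z, Directed (Relation.Map E f f) Z c (f u) ∧
        Directed (Relation.Map E f f) Z c (f v)) ↔
      ∃ c ∉ f ⁻¹' Z, Directed E (f ⁻¹' Z) c u ∧ Directed E (f ⁻¹' Z) c v := by
    intro Z E u v
    constructor
    · rintro ⟨c, hc, h1, h2⟩
      obtain ⟨a, rfl⟩ := mem_range_of_directed_map h1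
      exact ⟨a, hc, (directed_map_iff hf).1 h1, (directed_map_iff hf).1 h2⟩
    · rintro ⟨a, ha, h1, h2⟩
      exact ⟨f a, ha, (directed_map_iff hf).2 h1, (directed_map_iff hf).2 h2⟩
  induction t generalizing Z u v with
  | zero => exact or_congr (h1 _ _ _ _) (by simp)
  | succ t ih =>
    refine or_congr (h1 _ _ _ _) ?_
    constructor
    · rintro ⟨_, _, _, _, h2, ⟨a, b, h3, rfl, rfl⟩, ⟨a', b', h4, rfl, rfl⟩, h5, h6⟩
      exact ⟨a, a', b, b', (ih ∅ a a').1 h2, h3, h4, (directed_map_iff hf).1 h5,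
        (directed_map_iff hf).1 h6⟩
    · rintro ⟨a, a', b, b', h2, h3, h4, h5, h6⟩
      exact ⟨f a, f a', f b, f b', (ih ∅ a a').2 h2, ⟨a, b, h3, rfl, rfl⟩,
        ⟨a', b', h4, rfl, rfl⟩, (directed_map_iff hf).2 h5, (directed_map_iff hf).2 h6⟩

lemma separated_map_iff (hf : f.Injective) (E0 E1 I : V → V → Prop) (t : ℕ) (X Y Z : Set V) :
    Separated (Relation.Map E0 f f) (Relation.Map E1 f f) (Relation.Map I f f) t
      (f '' X) (f '' Y) (f '' Z) ↔ Separated E0 E1 I t X Y Z := by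
  have hK := fun u v => trekAt_map_iff hf E0 E1 I t (f '' Z) u v
  rw [Set.preimage_image_eq _ hf] at hK
  have hL : ∀ w, Linked (trekAt (Relation.Map E0 f f) (Relation.Map E1 f f) (Relation.Map I f f) t
      (f '' Z)) (f '' X) (f '' Z) w ↔ ∃ u, f u = w ∧ Linked (trekAt E0 E1 I t Z) X Z u := by
    intro w
    constructor
    · intro h
      induction h with
      | base h =>
        obtain ⟨x, hx, rfl⟩ := h
        exact ⟨x, rfl, .base hx⟩
      | step _ h1 h2 ih =>
        obtain ⟨u, rfl, hu⟩ := ih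
        obtain ⟨z, hz, rfl⟩ := h2
        exact ⟨z, rfl, .step hu ((hK _ _).1 h1) hz⟩
    · rintro ⟨u, rfl, h⟩
      induction h with
      | base h => exact .base ⟨_, h, rfl⟩
      | step _ h1 h2 ih => exact .step ih ((hK _ _).2 h1) ⟨_, h2, rfl⟩
  refine not_congr ?_
  constructor
  · rintro ⟨_, ⟨y, hy, rfl⟩, _, h1, h2⟩
    obtain ⟨u, rfl, hu⟩ := (hL _).1 h1
    exact ⟨y, hy, u, hu, (hK _ _).1 h2⟩
  · rintro ⟨y, hy, u, h1, h2⟩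
    exact ⟨f y, ⟨y, hy, rfl⟩, f u, (hL _).2 ⟨u, rfl, h1⟩, (hK _ _).2 h2⟩

end DSeparation

namespace DBNTemplate

open DSeparation

variable {V : Type*} (T : DBNTemplate V)

lemma lastTrek_eq_trekAt (t : ℕ) (Z : Set V) :
    T.lastTrek Z t = trekAt T.edge0 T.edge1 T.edgeI t Z := by
  induction t generalizing Z with
  | zero => rfl
  | succ t ih => rw [lastTrek, trekAt, ← ih, coAnc_eq]

theorem holdsAt_iff_separated (t : ℕ) (p : CIProp V) :
    T.HoldsAt t p ↔ Separated T.edge0 T.edge1 T.edgeI t p.X p.Y p.Z := by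
  rw [holdsAt_iff, lastTrek_eq_trekAt]
  rfl

end DBNTemplate

/-- The word `l` occurs in `w` from position `s` on. -/
def Occurs {α : Type*} (w : List α) (s : ℕ) (l : List α) : Prop :=
  ∀ (j : ℕ) (hj : j < l.length), w[s + j]? = some l[j]

namespace Occurs

variable {α β : Type*} {w l l' : List α} {s : ℕ}

@[simp] lemma nil : Occurs w s [] := by simp [Occurs]

lemma self : Occurs w 0 w := fun j hj => by simp [hj]

@[simp] lemma cons_iff {a : α} : Occurs w s (a :: l) ↔ w[s]? = some a ∧ Occurs w (s + 1) l := by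
  constructor
  · intro h
    refine ⟨h 0 (by simp), fun j hj => ?_⟩
    have := h (j + 1) (by simpa using hj)
    rwa [← Nat.add_assoc, Nat.add_right_comm] at this
  · rintro ⟨h1, h2⟩ j hj
    cases j with
    | zero => exact h1
    | succ j =>
      have := h2 j (by simpa using hj)
      rwa [Nat.add_right_comm, Nat.add_assoc] at this

lemma append_iff : Occurs w s (l ++ l') ↔ Occurs w s l ∧ Occurs w (s + l.length) l' := by
  induction l generalizing s with
  | nil => simp
  | cons a l ih =>
    rw [List.cons_append, cons_iff, cons_iff, ih, and_assoc, List.length_cons,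
      show s + 1 + l.length = s + (l.length + 1) by omega]

lemma flatMap {f : β → List α} {c : ℕ} {L : List β} (hf : ∀ b ∈ L, (f b).length = c)
    (h : Occurs w s (L.flatMap f)) (i : ℕ) (hi : i < L.length) : Occurs w (s + i * c) (f L[i]) := by
  induction L generalizing s i with
  | nil => simp at hi
  | cons b L ih =>
    rw [List.flatMap_cons, append_iff, hf b (by simp)] at h
    cases i with
    | zero => simpa using h.1
    | succ i =>
      have := ih (fun b hb => hf b (by simp [hb])) h.2 i (by simpa using hi)
      rwa [show s + (i + 1) * c = s + c + i * c by rw [Nat.succ_mul]; omega]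

lemma lt (h : Occurs w s l) (hl : l ≠ []) : s + l.length ≤ w.length := by
  have h1 := List.length_pos_iff.2 hl
  have h2 := h (l.length - 1) (by omega)
  have h3 := (List.getElem?_eq_some_iff.1 h2).1
  omega

end Occurs

lemma List.length_flatMap_of_length_eq {α β : Type*} {f : α → List β} {c : ℕ} {l : List α}
    (hf : ∀ a ∈ l, (f a).length = c) : (l.flatMap f).length = l.length * c := by
  induction l with
  | nil => simp
  | cons a l ih =>
    rw [List.flatMap_cons, List.length_append, hf a (by simp), ih fun a h => hf a (by simp [h]),
      List.length_cons, Nat.succ_mul, Nat.add_comm]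

/-- The bit at position `i` is `true`. -/
def isOne (w : List Token) (i : ℕ) : Prop := w[i]? = some (Token.bit true)

@[simp] lemma length_encodeSubset {k : ℕ} (s : Finset (Fin k)) : (encodeSubset s).length = k := by
  simp [encodeSubset]

@[simp] lemma length_encodeCIProp {n : ℕ} (p : CIProp (Fin n)) :
    (encodeCIProp p).length = n + n + n := by
  simp [encodeCIProp, Nat.add_assoc]

lemma occurs_encodeSubset {n i : ℕ} {S : Finset (Fin n)} {w : List Token} :
    Occurs w i (encodeSubset S) ↔ ∀ x : Fin n, w[i + x]? = some (Token.bit (decide (x ∈ S))) := by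
  constructor
  · intro h x
    simpa [encodeSubset] using h x (by simp)
  · intro h j hj
    simpa [encodeSubset] using h ⟨j, by simpa using hj⟩

lemma bitSet_of_occurs {n i : ℕ} {S : Finset (Fin n)} {w : List Token}
    (h : Occurs w i (encodeSubset S)) :
    DSeparation.bitSet (isOne w) n i = Fin.val '' (S : Set (Fin n)) := by
  rw [occurs_encodeSubset] at h
  ext x
  constructor
  · rintro ⟨hx, h1⟩
    rw [isOne, h ⟨x, hx⟩] at h1
    exact ⟨⟨x, hx⟩, by simpa using h1, rfl⟩
  · rintro ⟨x, h1, rfl⟩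
    exact ⟨x.2, (h x).trans (by simpa using h1)⟩

/-- An adjacency matrix, row by row. -/
def encodeMatrix {n : ℕ} (M : Fin n → Fin n → Bool) : List Token :=
  (List.finRange n).flatMap fun x => List.ofFn fun y => Token.bit (M x y)

@[simp] lemma length_encodeMatrix {n : ℕ} (M : Fin n → Fin n → Bool) :
    (encodeMatrix M).length = n * n := by
  rw [encodeMatrix, List.length_flatMap_of_length_eq (c := n) (by simp), List.length_finRange]

lemma encodeTemplate_eq {n : ℕ} (T : DBNTemplate (Fin n)) :
    encodeTemplate T = List.replicate n Token.item ++ [Token.sep] ++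
      encodeMatrix (fun x y => decide ((x, y) ∈ T.E0)) ++
      encodeMatrix (fun x y => decide ((Sum.inl x, y) ∈ T.Estep)) ++
      encodeMatrix (fun x y => decide ((Sum.inr x, y) ∈ T.Estep)) := rfl

@[simp] lemma length_encodeTemplate {n : ℕ} (T : DBNTemplate (Fin n)) :
    (encodeTemplate T).length = n + 1 + n * n + n * n + n * n := by
  simp [encodeTemplate_eq]
  omega

lemma bitEdge_of_occurs {n i : ℕ} {r : Fin n → Fin n → Prop} {M : Fin n → Fin n → Bool}
    {w : List Token} (h : Occurs w i (encodeMatrix M)) (hM : ∀ x y, M x y = true ↔ r x y) :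
    DSeparation.bitEdge (isOne w) n i = Relation.Map r Fin.val Fin.val := by
  have key : ∀ x y : Fin n, w[i + x * n + y]? = some (Token.bit (M x y)) := by
    intro x y
    simpa using h.flatMap (c := n) (by simp) x (by simp) y (by simp)
  funext x y
  simp only [DSeparation.bitEdge, isOne, Relation.Map, eq_iff_iff, ← hM]
  constructor
  · rintro ⟨hx, hy, h⟩
    have := key ⟨x, hx⟩ ⟨y, hy⟩
    rw [h] at this
    exact ⟨⟨x, hx⟩, ⟨y, hy⟩, by simpa using this, rfl, rfl⟩
  · rintro ⟨x, y, h, rfl, rfl⟩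
    exact ⟨x.2, y.2, by rw [key]; simpa using h⟩

/-- The bits of the input determine which propositions hold. -/
theorem bitHolds_iff {n : ℕ} {T : DBNTemplate (Fin n)} {p : CIProp (Fin n)} {w : List Token} {s : ℕ}
    (hT : Occurs w 0 (encodeTemplate T)) (hp : Occurs w s (Token.item :: encodeCIProp p)) (t : ℕ) :
    DSeparation.BitHolds (isOne w) n s t ↔ T.HoldsAt t p := by
  simp only [encodeTemplate_eq, encodeCIProp, Occurs.append_iff, Occurs.cons_iff,
    List.length_append, List.length_replicate, List.length_singleton, length_encodeMatrix,
    length_encodeSubset, ← Nat.add_assoc, Nat.zero_add] at hT hp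
  rw [T.holdsAt_iff_separated, ← DSeparation.separated_map_iff Fin.val_injective,
    DSeparation.BitHolds,
    bitEdge_of_occurs (r := T.edge0) hT.1.1.2 (fun _ _ => decide_eq_true_iff),
    bitEdge_of_occurs (r := T.edgeI) hT.1.2 (fun _ _ => decide_eq_true_iff),
    bitEdge_of_occurs (r := T.edge1) hT.2 (fun _ _ => decide_eq_true_iff),
    bitSet_of_occurs hp.2.1.1, bitSet_of_occurs hp.2.1.2, bitSet_of_occurs hp.2.2]

/-! ### Reading the sizes off the input -/

namespace Cmd

open Function

variable {N : ℕ} {ρ : Var → ℕ} {D : List (List ℕ)}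

/-- A loop over a test that singles out one value runs its body once. -/
lemma eval_loop_test {x : Var} {φ : Form} {s : Cmd} {a : ℕ} (ha : a < N)
    (h : ∀ D', (∀ t < 8, relOf D' t = relOf D t) → ∀ i < N,
      (φ.Holds N (relOf D') (update ρ x i) ↔ i = a))
    (hs : ∀ t < 8, relOf (s.eval N (update ρ x a) D) t = relOf D t) :
    (loop x (test φ s)).eval N ρ D = s.eval N (update ρ x a) D := by
  let E : ℕ → List (List ℕ) := fun i => Nat.rec D (fun i D' =>
    (test φ s).eval N (update ρ x i) D') i
  have key : ∀ i ≤ N, E i = if a < i then s.eval N (update ρ x a) D else D := by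
    intro i
    induction i with
    | zero => intro _; simp [E]
    | succ i ih =>
      intro hi
      change (test φ s).eval N (update ρ x i) (E i) = _
      rw [ih (by omega), eval]
      by_cases h1 : a < i
      · have h2 := (h _ hs i (by omega)).not.2 (by omega)
        rw [if_pos h1, if_neg h2, if_pos (by omega)]
      · rw [if_neg h1, h _ (fun _ _ => rfl) i (by omega)]
        by_cases h2 : i = a
        · rw [if_pos h2, if_pos (by omega), h2]
        · rw [if_neg h2, if_neg (by omega)]
  exact (key N le_rfl).trans (if_pos ha)

/-- Run a command with the variable `x` holding the least number for which there is a separator at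
the position `pos x`. -/
def firstSep (x : Var) (pos : Var → Term) (s : Cmd) : Cmd :=
  .loop x (.test (.conj (.mem 2 [pos x]) (.neg (.ex 15 (.conj (.lt (.var 15) (.var x))
    (.mem 2 [pos 15]))))) s)

lemma eval_firstSep {w : List Token} {a : ℕ} {x : Var} (hx : x ≠ 15) {pos : Var → Term} {p : ℕ → ℕ}
    {s : Cmd} (hpos : ∀ i, (pos x).val (update ρ x i) = p i)
    (hpos' : ∀ i j, (pos 15).val (update (update ρ x i) 15 j) = p j)
    (hD : ∀ i, relOf D 2 [i] ↔ w[i]? = some .sep) (haN : a < N) (ha : w[p a]? = some .sep)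
    (hlt : ∀ i < a, w[p i]? ≠ some .sep)
    (hs : ∀ t < 8, relOf (s.eval N (update ρ x a) D) t = relOf D t) :
    (firstSep x pos s).eval N ρ D = s.eval N (update ρ x a) D := by
  refine eval_loop_test haN (fun D' hD' i hi => ?_) hs
  simp [hD' 2 (by decide), hD, hpos, hpos', hx]
  constructor
  · rintro ⟨h2, h3⟩
    by_contra hne
    rcases Nat.lt_or_gt_of_ne hne with h | h
    · exact hlt i h h2
    · exact h3 a haN h ha
  · rintro rfl
    exact ⟨ha, fun j _ hj => hlt j hj⟩

/-- Run a command with the variable 0 holding the position of the first separator and the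
variable 1 holding the last position. -/
def withSize (s : Cmd) : Cmd :=
  firstSep 0 .var (.loop 1 (.test (.neg (.ex 2 (.eq (.var 2) (.var 1 + .const 1)))) s))

lemma eval_withSize {w : List Token} {n : ℕ} {s : Cmd} (hN : w.length = N)
    (hD : ∀ i, relOf D 2 [i] ↔ w[i]? = some .sep) (hn : w[n]? = some .sep)
    (hlt : ∀ i < n, w[i]? ≠ some .sep)
    (hs : ∀ t < 8, relOf (s.eval N (update (update ρ 0 n) 1 (N - 1)) D) t = relOf D t) :
    (withSize s).eval N ρ D = s.eval N (update (update ρ 0 n) 1 (N - 1)) D := by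
  have hnN : n < N := hN ▸ (List.getElem?_eq_some_iff.1 hn).1
  have h1 : (loop 1 (.test (.neg (.ex 2 (.eq (.var 2) (.var 1 + .const 1)))) s)).eval N
      (update ρ 0 n) D = s.eval N (update (update ρ 0 n) 1 (N - 1)) D := by
    refine eval_loop_test (by omega) (fun D' _ i hi => ?_) hs
    simp
    omega
  rw [withSize, eval_firstSep (p := id) (by decide) (by simp) (by simp) hD hnN hn hlt
    (by rwa [h1]), h1]

end Cmd

/-- The tuples in the initial database are those for the letters of the input. -/
lemma relOf_inputDB_code (w : List Token) (a : Token) (i : ℕ) :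
    relOf (inputDB 0 w []) a.code [i] ↔ w[i]? = some a := by
  rw [Implementation.relOf_inputDB]
  constructor
  · rintro (h | ⟨j, b, h1, h2, h3⟩)
    · simp [relOf] at h
    · obtain rfl : a = b := by
        cases a with
        | bit x => cases b with
          | bit y => cases x <;> cases y <;> simp_all [Token.code]
          | _ => cases x <;> simp [Token.code] at h2
        | _ => cases b with
          | bit y => cases y <;> simp [Token.code] at h2
          | _ => first | rfl | simp [Token.code] at h2
      obtain rfl : i = j := by simpa using h3
      exact h1
  · exact fun h => .inr ⟨i, a, h, rfl, by simp⟩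

lemma not_relOf_inputDB (w : List Token) {t : ℕ} (ht : 8 ≤ t) (v : List ℕ) :
    ¬ relOf (inputDB 0 w []) t v := by
  rw [Implementation.relOf_inputDB]
  rintro (h | ⟨j, b, h1, rfl, h3⟩)
  · simp [relOf] at h
  · cases b with
    | bit y => cases y <;> simp [Token.code] at ht
    | _ => simp [Token.code] at ht

lemma encodeTemplate_sep {n : ℕ} {T : DBNTemplate (Fin n)} {w : List Token}
    (h : Occurs w 0 (encodeTemplate T)) :
    w[n]? = some Token.sep ∧ ∀ i < n, w[i]? = some Token.item := by
  simp only [encodeTemplate_eq, Occurs.append_iff, Occurs.cons_iff, List.length_replicate,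
    Nat.zero_add] at h
  refine ⟨h.1.1.1.2.1, fun i hi => ?_⟩
  have := h.1.1.1.1 i (by simpa using hi)
  rwa [Nat.zero_add, List.getElem_replicate] at this

/-! ### Formulae in the input word -/

section Text

variable {n : ℕ} {w : List Token} {e s : ℕ}

/-- The text of `f` occupies the positions from `s` to `e`. -/
def IsTextOf (w : List Token) (e s : ℕ) (f : LTLFormula (CIProp (Fin n))) : Prop :=
  Occurs w s (encodeFormula f) ∧ s + (encodeFormula f).length = e + 1

lemma length_encodeFormula_pos (f : LTLFormula (CIProp (Fin n))) :
    0 < (encodeFormula f).length := by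
  cases f <;> simp [encodeFormula]

lemma IsTextOf.le {f : LTLFormula (CIProp (Fin n))} (h : IsTextOf w e s f) : s ≤ e := by
  have := length_encodeFormula_pos f
  have := h.2
  omega

lemma IsTextOf.lt {f : LTLFormula (CIProp (Fin n))} (h : IsTextOf w e s f) : e < w.length := by
  have h1 := h.1.lt (List.length_pos_iff.1 (length_encodeFormula_pos f))
  have := h.2
  omega

lemma isTextOf_atom {p : CIProp (Fin n)} : IsTextOf w e s (.atom p) ↔
    e = s + n + n + n ∧ Occurs w s (Token.item :: encodeCIProp p) := by
  simp only [IsTextOf, encodeFormula, List.length_cons, length_encodeCIProp]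
  rw [and_comm]
  exact and_congr_left fun _ => ⟨fun h => by omega, fun h => by omega⟩

/-- A text built by a unary operator. -/
lemma isTextOf_unary {l : List Token} {a : Token} (hl : 0 < l.length) :
    (Occurs w s (l ++ [a]) ∧ s + (l ++ [a]).length = e + 1) ↔
      ∃ d, d + 1 = e ∧ w[e]? = some a ∧ Occurs w s l ∧ s + l.length = d + 1 := by
  simp only [Occurs.append_iff, Occurs.cons_iff, Occurs.nil, and_true, List.length_append,
    List.length_singleton]
  constructor
  · rintro ⟨⟨h1, h2⟩, h3⟩
    obtain rfl : e = s + l.length := by omega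
    exact ⟨s + l.length - 1, by omega, h2, h1, by omega⟩
  · rintro ⟨d, rfl, h1, h2, h3⟩
    exact ⟨⟨h2, by rw [h3]; exact h1⟩, by omega⟩

lemma isTextOf_neg {f : LTLFormula (CIProp (Fin n))} : IsTextOf w e s (.neg f) ↔
    ∃ d, d + 1 = e ∧ w[e]? = some .neg ∧ IsTextOf w d s f :=
  isTextOf_unary (length_encodeFormula_pos f)

lemma isTextOf_next {f : LTLFormula (CIProp (Fin n))} : IsTextOf w e s (.next f) ↔
    ∃ d, d + 1 = e ∧ w[e]? = some .next ∧ IsTextOf w d s f :=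
  isTextOf_unary (length_encodeFormula_pos f)

lemma occurs_append_text {f g : LTLFormula (CIProp (Fin n))} {d : ℕ} :
    (Occurs w s (encodeFormula f ++ encodeFormula g) ∧
      s + (encodeFormula f ++ encodeFormula g).length = d + 1) ↔
      ∃ c, IsTextOf w c s f ∧ IsTextOf w d (c + 1) g := by
  have := length_encodeFormula_pos f
  simp only [IsTextOf, Occurs.append_iff, List.length_append]
  constructor
  · rintro ⟨⟨h1, h2⟩, h3⟩
    have h4 : s + (encodeFormula f).length - 1 + 1 = s + (encodeFormula f).length := by omega
    exact ⟨s + (encodeFormula f).length - 1, ⟨h1, h4.symm⟩, h4 ▸ h2, by omega⟩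
  · rintro ⟨c, ⟨h1, h2⟩, h3, h4⟩
    exact ⟨⟨h1, h2 ▸ h3⟩, by omega⟩

lemma isTextOf_conj {f g : LTLFormula (CIProp (Fin n))} : IsTextOf w e s (.conj f g) ↔
    ∃ d, d + 1 = e ∧ w[e]? = some .conj ∧ ∃ c, IsTextOf w c s f ∧ IsTextOf w d (c + 1) g := by
  simp only [← occurs_append_text]
  exact isTextOf_unary (by have := length_encodeFormula_pos f; simp; omega)

lemma isTextOf_untl {f g : LTLFormula (CIProp (Fin n))} : IsTextOf w e s (.untl f g) ↔
    ∃ d, d + 1 = e ∧ w[e]? = some .untl ∧ ∃ c, IsTextOf w c s f ∧ IsTextOf w d (c + 1) g := by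
  simp only [← occurs_append_text]
  exact isTextOf_unary (by have := length_encodeFormula_pos f; simp; omega)

lemma IsTextOf.last_of_atom {p : CIProp (Fin n)} (h : IsTextOf w e s (.atom p)) :
    w[e]? = some .item ∨ ∃ b, w[e]? = some (.bit b) := by
  rw [isTextOf_atom] at h
  have h1 := h.2 (n + n + n) (by simp)
  rw [show s + (n + n + n) = e by omega] at h1
  have h2 : ∀ a ∈ Token.item :: encodeCIProp p, a = .item ∨ ∃ b, a = .bit b := by
    simp only [encodeCIProp, encodeSubset, List.mem_cons, List.mem_append, List.mem_ofFn]
    rintro a (rfl | (⟨i, rfl⟩ | ⟨i, rfl⟩) | ⟨i, rfl⟩)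
    exacts [.inl rfl, .inr ⟨_, rfl⟩, .inr ⟨_, rfl⟩, .inr ⟨_, rfl⟩]
  rw [h1]
  simpa using h2 _ (List.getElem_mem (by simp))

lemma encodeSubset_injective {k : ℕ} : Function.Injective (encodeSubset (k := k)) := by
  intro S S' h
  ext x
  have := List.ofFn_injective h
  simpa using congrFun this x

lemma encodeCIProp_injective : Function.Injective (encodeCIProp (n := n)) := by
  rintro ⟨X, Y, Z, _, _, _⟩ ⟨X', Y', Z', _, _, _⟩ h
  simp only [encodeCIProp] at h
  obtain ⟨h1, h2⟩ := List.append_inj h (by simp)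
  obtain ⟨h3, h4⟩ := List.append_inj h1 (by simp)
  obtain rfl := encodeSubset_injective h2
  obtain rfl := encodeSubset_injective h3
  obtain rfl := encodeSubset_injective h4
  rfl

/-- Unique readability of postfix notation from the right. -/
lemma IsTextOf.unique {f f' : LTLFormula (CIProp (Fin n))} {s' : ℕ} (h : IsTextOf w e s f)
    (h' : IsTextOf w e s' f') : s = s' ∧ f = f' := by
  induction f generalizing e s s' f' with
  | atom p =>
    have hl := h.last_of_atom
    cases f' with
    | atom p' =>
      rw [isTextOf_atom] at h h'
      obtain rfl : s = s' := by omega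
      refine ⟨rfl, ?_⟩
      have h1 : Token.item :: encodeCIProp p = Token.item :: encodeCIProp p' := by
        refine List.ext_getElem (by simp) fun i h1 h2 => ?_
        have h3 := h.2 i h1
        rw [h'.2 i h2] at h3
        exact (Option.some_injective _ h3).symm
      rw [encodeCIProp_injective (List.cons.inj h1).2]
    | neg => obtain ⟨_, _, h1, _⟩ := isTextOf_neg.1 h'; simp [h1] at hl
    | next => obtain ⟨_, _, h1, _⟩ := isTextOf_next.1 h'; simp [h1] at hl
    | conj => obtain ⟨_, _, h1, _⟩ := isTextOf_conj.1 h'; simp [h1] at hl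
    | untl => obtain ⟨_, _, h1, _⟩ := isTextOf_untl.1 h'; simp [h1] at hl
  | neg f ih =>
    obtain ⟨d, hd, h1, h2⟩ := isTextOf_neg.1 h
    cases f' with
    | atom p' => have := h'.last_of_atom; simp [h1] at this
    | neg f' =>
      obtain ⟨d', hd', h1', h2'⟩ := isTextOf_neg.1 h'
      obtain rfl : d = d' := by omega
      obtain ⟨rfl, rfl⟩ := ih h2 h2'
      exact ⟨rfl, rfl⟩
    | next => obtain ⟨_, _, h1', _⟩ := isTextOf_next.1 h'; simp [h1] at h1'
    | conj => obtain ⟨_, _, h1', _⟩ := isTextOf_conj.1 h'; simp [h1] at h1'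
    | untl => obtain ⟨_, _, h1', _⟩ := isTextOf_untl.1 h'; simp [h1] at h1'
  | next f ih =>
    obtain ⟨d, hd, h1, h2⟩ := isTextOf_next.1 h
    cases f' with
    | atom p' => have := h'.last_of_atom; simp [h1] at this
    | next f' =>
      obtain ⟨d', hd', h1', h2'⟩ := isTextOf_next.1 h'
      obtain rfl : d = d' := by omega
      obtain ⟨rfl, rfl⟩ := ih h2 h2'
      exact ⟨rfl, rfl⟩
    | neg => obtain ⟨_, _, h1', _⟩ := isTextOf_neg.1 h'; simp [h1] at h1'
    | conj => obtain ⟨_, _, h1', _⟩ := isTextOf_conj.1 h'; simp [h1] at h1'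
    | untl => obtain ⟨_, _, h1', _⟩ := isTextOf_untl.1 h'; simp [h1] at h1'
  | conj f g ihf ihg =>
    obtain ⟨d, hd, h1, c, h2, h3⟩ := isTextOf_conj.1 h
    cases f' with
    | atom p' => have := h'.last_of_atom; simp [h1] at this
    | conj f' g' =>
      obtain ⟨d', hd', h1', c', h2', h3'⟩ := isTextOf_conj.1 h'
      obtain rfl : d = d' := by omega
      obtain ⟨h4, rfl⟩ := ihg h3 h3'
      obtain rfl : c = c' := by omega
      obtain ⟨rfl, rfl⟩ := ihf h2 h2'
      exact ⟨rfl, rfl⟩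
    | neg => obtain ⟨_, _, h1', _⟩ := isTextOf_neg.1 h'; simp [h1] at h1'
    | next => obtain ⟨_, _, h1', _⟩ := isTextOf_next.1 h'; simp [h1] at h1'
    | untl => obtain ⟨_, _, h1', _⟩ := isTextOf_untl.1 h'; simp [h1] at h1'
  | untl f g ihf ihg =>
    obtain ⟨d, hd, h1, c, h2, h3⟩ := isTextOf_untl.1 h
    cases f' with
    | atom p' => have := h'.last_of_atom; simp [h1] at this
    | untl f' g' =>
      obtain ⟨d', hd', h1', c', h2', h3'⟩ := isTextOf_untl.1 h'
      obtain rfl : d = d' := by omega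
      obtain ⟨h4, rfl⟩ := ihg h3 h3'
      obtain rfl : c = c' := by omega
      obtain ⟨rfl, rfl⟩ := ihf h2 h2'
      exact ⟨rfl, rfl⟩
    | neg => obtain ⟨_, _, h1', _⟩ := isTextOf_neg.1 h'; simp [h1] at h1'
    | next => obtain ⟨_, _, h1', _⟩ := isTextOf_next.1 h'; simp [h1] at h1'
    | conj => obtain ⟨_, _, h1', _⟩ := isTextOf_conj.1 h'; simp [h1] at h1'

/-- There is a bit at position `i`. -/
def isBit (w : List Token) (i : ℕ) : Prop := w[i]? = some (.bit false) ∨ w[i]? = some (.bit true)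

/-- Three blocks of bits spell a proposition if no two of them have a bit `true` in common. -/
lemma exists_occurs_prop : (∃ p : CIProp (Fin n), Occurs w s (Token.item :: encodeCIProp p)) ↔
    w[s]? = some .item ∧ ∀ x < n,
      (isBit w (s + 1 + x) ∧ isBit w (s + 1 + n + x) ∧ isBit w (s + 1 + n + n + x)) ∧
      ¬ (isOne w (s + 1 + x) ∧ isOne w (s + 1 + n + x)) ∧
      ¬ (isOne w (s + 1 + x) ∧ isOne w (s + 1 + n + n + x)) ∧
      ¬ (isOne w (s + 1 + n + x) ∧ isOne w (s + 1 + n + n + x)) := by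
  classical
  have hbit : ∀ i (b : Bool), w[i]? = some (.bit b) → isBit w i ∧ (isOne w i ↔ b = true) := by
    intro i b h
    cases b <;> simp [isBit, isOne, h]
  constructor
  · rintro ⟨p, h⟩
    simp only [encodeCIProp, Occurs.cons_iff, Occurs.append_iff, length_encodeSubset,
      List.length_append, ← Nat.add_assoc, occurs_encodeSubset] at h
    refine ⟨h.1, fun x hx => ?_⟩
    obtain ⟨a1, a2⟩ := hbit _ _ (h.2.1.1 ⟨x, hx⟩)
    obtain ⟨b1, b2⟩ := hbit _ _ (h.2.1.2 ⟨x, hx⟩)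
    obtain ⟨c1, c2⟩ := hbit _ _ (h.2.2 ⟨x, hx⟩)
    refine ⟨⟨a1, b1, c1⟩, ?_⟩
    dsimp only at a2 b2 c2
    rw [a2, b2, c2]
    simp only [decide_eq_true_eq]
    exact ⟨fun h => Finset.disjoint_left.1 p.disjoint_XY h.1 h.2,
      fun h => Finset.disjoint_left.1 p.disjoint_XZ h.1 h.2,
      fun h => Finset.disjoint_left.1 p.disjoint_YZ h.1 h.2⟩
  · rintro ⟨h, h'⟩
    refine ⟨⟨Finset.univ.filter fun x => isOne w (s + 1 + x),
      Finset.univ.filter fun x => isOne w (s + 1 + n + x),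
      Finset.univ.filter fun x => isOne w (s + 1 + n + n + x), ?_, ?_, ?_⟩, ?_⟩
    · simpa [Finset.disjoint_left] using fun x h1 h2 => (h' x.1 x.2).2.1 ⟨h1, h2⟩
    · simpa [Finset.disjoint_left] using fun x h1 h2 => (h' x.1 x.2).2.2.1 ⟨h1, h2⟩
    · simpa [Finset.disjoint_left] using fun x h1 h2 => (h' x.1 x.2).2.2.2 ⟨h1, h2⟩
    · have hb : ∀ i, isBit w i → w[i]? = some (.bit (decide (isOne w i))) := by
        rintro i (h | h) <;> simp [isOne, h]
      simp only [encodeCIProp, Occurs.cons_iff, Occurs.append_iff, length_encodeSubset,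
        List.length_append, ← Nat.add_assoc, occurs_encodeSubset]
      refine ⟨h, ⟨fun x => ?_, fun x => ?_⟩, fun x => ?_⟩
      · simpa using hb _ (h' x x.2).1.1
      · simpa using hb _ (h' x x.2).1.2.1
      · simpa using hb _ (h' x x.2).1.2.2

/-- Some formula occupies the positions from `s` to `e`. -/
def IsText (n : ℕ) (w : List Token) (e s : ℕ) : Prop :=
  ∃ f : LTLFormula (CIProp (Fin n)), IsTextOf w e s f

lemma isText_iff : IsText n w e s ↔
    (e = s + n + n + n ∧ ∃ p : CIProp (Fin n), Occurs w s (Token.item :: encodeCIProp p)) ∨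
    ∃ d, d + 1 = e ∧ (((w[e]? = some .neg ∨ w[e]? = some .next) ∧ IsText n w d s) ∨
      ((w[e]? = some .conj ∨ w[e]? = some .untl) ∧
        ∃ c, c < e ∧ IsText n w c s ∧ IsText n w d (c + 1))) := by
  constructor
  · rintro ⟨f, h⟩
    cases f with
    | atom p =>
      rw [isTextOf_atom] at h
      exact .inl ⟨h.1, p, h.2⟩
    | neg f =>
      obtain ⟨d, hd, h1, h2⟩ := isTextOf_neg.1 h
      exact .inr ⟨d, hd, .inl ⟨.inl h1, f, h2⟩⟩
    | next f =>
      obtain ⟨d, hd, h1, h2⟩ := isTextOf_next.1 h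
      exact .inr ⟨d, hd, .inl ⟨.inr h1, f, h2⟩⟩
    | conj f g =>
      obtain ⟨d, hd, h1, c, h2, h3⟩ := isTextOf_conj.1 h
      have := h3.le
      exact .inr ⟨d, hd, .inr ⟨.inl h1, c, by omega, ⟨f, h2⟩, g, h3⟩⟩
    | untl f g =>
      obtain ⟨d, hd, h1, c, h2, h3⟩ := isTextOf_untl.1 h
      have := h3.le
      exact .inr ⟨d, hd, .inr ⟨.inr h1, c, by omega, ⟨f, h2⟩, g, h3⟩⟩
  · rintro (⟨h1, p, h2⟩ | ⟨d, hd, ⟨h1 | h1, f, h2⟩ | ⟨h1 | h1, c, _, ⟨f, h2⟩, g, h3⟩⟩)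
    · exact ⟨.atom p, isTextOf_atom.2 ⟨h1, h2⟩⟩
    · exact ⟨.neg f, isTextOf_neg.2 ⟨d, hd, h1, h2⟩⟩
    · exact ⟨.next f, isTextOf_next.2 ⟨d, hd, h1, h2⟩⟩
    · exact ⟨.conj f g, isTextOf_conj.2 ⟨d, hd, h1, c, h2, h3⟩⟩
    · exact ⟨.untl f g, isTextOf_untl.2 ⟨d, hd, h1, c, h2, h3⟩⟩

end Text

/-! ### A program for LTL model checking -/

/-- The letter `a` stands at the position given by the term. -/
def Form.tok (a : Token) (t : Term) : Form := .mem a.code [t]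

/-- There is a bit at the position given by the term. -/
def Form.bit (t : Term) : Form := .disj (.tok (.bit false) t) (.tok (.bit true) t)

/-- A proposition occurs at the position held by the variable 5. -/
def Form.isProp : Form :=
  let x := Term.var 5 + .const 1 + .var 6
  let y := Term.var 5 + .const 1 + .var 0 + .var 6
  let z := Term.var 5 + .const 1 + .var 0 + .var 0 + .var 6
  .conj (.tok .item (.var 5)) (.all 6 (.disj (.le (.var 0) (.var 6)) (.conjs
    [.conjs [.bit x, .bit y, .bit z],
      .neg (.conj (.tok (.bit true) x) (.tok (.bit true) y)),
      .neg (.conj (.tok (.bit true) x) (.tok (.bit true) z)),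
      .neg (.conj (.tok (.bit true) y) (.tok (.bit true) z))])))

/-- A formula occupies the positions from the value of the variable 5 to that of the variable 4;
the symbol 13 stands for the relation defined by this formula. -/
def Form.isText : Form :=
  .disj (.conj (.eq (.var 4) (.var 5 + .var 0 + .var 0 + .var 0)) .isProp)
    (.ex 6 (.conj (.eq (.var 6 + .const 1) (.var 4)) (.disj
      (.conj (.disj (.tok .neg (.var 4)) (.tok .next (.var 4))) (.mem 13 [.var 6, .var 5]))
      (.conj (.disj (.tok .conj (.var 4)) (.tok .untl (.var 4)))
        (.ex 7 (.conjs [.lt (.var 7) (.var 4), .mem 13 [.var 7, .var 5],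
          .mem 13 [.var 6, .var 7 + .const 1]]))))))

/-- The formula that ends at the position held by the variable 4 and starts at the one held by the
variable 5 is satisfied at the time held by the variable 6; the symbol 14 stands for the relation
defined by this formula. Since the trace has become constant, the last position of the input
represents all later times. -/
def Form.isSat : Form :=
  let e := Term.var 4
  let s := Term.var 5
  let t := Term.var 6
  let d := Term.var 7
  let c := Term.var 8
  .conj (.mem 13 [e, s]) <| .disj
    (.conj (.disj (.tok .item e) (.bit e)) (.mem 12 [s, t])) <|
    .ex 7 <| .conj (.eq (d + .const 1) e) <| .disj
      (.conj (.tok .neg e) (.neg (.mem 14 [d, s, t]))) <| .disj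
      (.conj (.tok .next e) (.ex 8 (.conj (.disj (.eq c (t + .const 1))
        (.conj (.eq t (.var 1)) (.eq c t))) (.mem 14 [d, s, c])))) <|
      .ex 8 <| .conjs [.lt c e, .mem 13 [c, s], .mem 13 [d, c + .const 1], .disj
        (.conjs [.tok .conj e, .mem 14 [c, s, t], .mem 14 [d, c + .const 1, t]])
        (.conj (.tok .untl e) (.ex 9 (.conjs [.le t (.var 9), .mem 14 [d, c + .const 1, .var 9],
          .all 10 (.disj (.neg (.conj (.le t (.var 10)) (.lt (.var 10) (.var 9))))
            (.mem 14 [c, s, .var 10]))])))]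

lemma Token.code_lt (a : Token) : a.code < 8 := by
  cases a with
  | bit b => cases b <;> simp [Token.code]
  | _ => simp [Token.code]

namespace Cmd

open Function

/-- The relation of all `(e, s)` such that a formula occupies the positions from `s` to `e`. -/
def texts : Cmd := define 13 [4, 5] .isText

/-- The relation of all `(e, s, t)` such that the formula that occupies the positions from `s` to
`e` is satisfied at time `t`. -/
def sats : Cmd := define 14 [4, 5, 6] .isSat

variable {N n : ℕ} {ρ : Var → ℕ} {D : List (List ℕ)} {w : List Token}

lemma eval_texts (h0 : ρ 0 = n) (hn : n < N) (hN : w.length = N)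
    (hD : ∀ (a : Token) i, relOf D a.code [i] ↔ w[i]? = some a) (hfresh : ∀ v, ¬ relOf D 13 v) :
    (∀ t ≠ 13, relOf (texts.eval N ρ D) t = relOf D t) ∧
    ∀ e s, relOf (texts.eval N ρ D) 13 [e, s] ↔ IsText n w e s := by
  have hlt : ∀ {e s}, IsText n w e s → e < N ∧ s < N := by
    rintro e s ⟨f, h⟩
    have := h.le
    have := h.lt
    omega
  obtain ⟨h1, h2⟩ := eval_define₂ (N := N) (ρ := ρ) (D := D) (tag := 13) (x := 4) (y := 5)
    (φ := .isText) (by decide) hfresh (IsText n w) (fun e s he hs R hR hR' => by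
    have hc : ∀ (a : Token) i, R a.code [i] ↔ w[i]? = some a := fun a i => by
      rw [hR _ (by have := a.code_lt; omega), hD]
    have hR'' : ∀ {d}, d < e → ∀ s', R 13 [d, s'] ↔ IsText n w d s' := fun hd s' => by
      rw [hR' _ hd]
      exact ⟨fun h => h.2, fun h => ⟨(hlt h).2, h⟩⟩
    rw [isText_iff, exists_occurs_prop]
    refine Form.holds_disj.trans (or_congr ?_ ?_)
    · simp [Form.isProp, Form.conjs, Form.tok, Form.bit, hc, h0]
      refine fun _ _ => ⟨fun h x hx => ?_, fun h x _ => ?_⟩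
      · exact (h x (hx.trans hn)).resolve_left (by omega)
      · by_cases hx : x < n
        · exact .inr (h x hx)
        · exact .inl (by omega)
    · simp [Form.conjs, Form.tok, hc]
      constructor
      · rintro ⟨d, _, rfl, ⟨h1, h2⟩ | ⟨h1, c, _, h2, h3, h4⟩⟩
        · rw [hR'' (by omega)] at h2
          exact ⟨d, rfl, .inl ⟨h1, h2⟩⟩
        · rw [hR'' (by omega)] at h3 h4
          exact ⟨d, rfl, .inr ⟨h1, c, h2, h3, h4⟩⟩
      · rintro ⟨d, rfl, ⟨h1, h2⟩ | ⟨h1, c, h2, h3, h4⟩⟩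
        · exact ⟨d, by omega, rfl, .inl ⟨h1, (hR'' (by omega) _).2 h2⟩⟩
        · exact ⟨d, by omega, rfl, .inr ⟨h1, c, by omega, h2, (hR'' h2 _).2 h3,
            (hR'' (by omega) _).2 h4⟩⟩)
  exact ⟨h1, fun e s => (h2 e s).trans ⟨fun h => h.2.2, fun h => ⟨(hlt h).1, (hlt h).2, h⟩⟩⟩

/-- The formula that occupies the positions from `s` to `e` is satisfied by the word `v` from
position `t` on. -/
def _root_.IsSat (w : List Token) (v : ℕ → Set (CIProp (Fin n))) (e s t : ℕ) : Prop :=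
  ∃ f, IsTextOf w e s f ∧ f.Sat fun i => v (t + i)

lemma _root_.IsTextOf.isSat_iff {v : ℕ → Set (CIProp (Fin n))} {e s t : ℕ}
    {f : LTLFormula (CIProp (Fin n))} (h : IsTextOf w e s f) :
    IsSat w v e s t ↔ f.Sat fun i => v (t + i) := by
  constructor
  · rintro ⟨g, h1, h2⟩
    rwa [(h.unique h1).2]
  · exact fun h' => ⟨f, h, h'⟩

lemma eval_sats {v : ℕ → Set (CIProp (Fin n))} (h1 : ρ 1 = N - 1) (hN : w.length = N)
    (hv : ∀ t, N - 1 ≤ t → v t = v (N - 1))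
    (hD : ∀ (a : Token) i, relOf D a.code [i] ↔ w[i]? = some a)
    (h12 : ∀ (p : CIProp (Fin n)) s t, t < N → Occurs w s (Token.item :: encodeCIProp p) →
      (relOf D 12 [s, t] ↔ p ∈ v t))
    (h13 : ∀ e s, relOf D 13 [e, s] ↔ IsText n w e s) (hfresh : ∀ v, ¬ relOf D 14 v) :
    (∀ t ≠ 14, relOf (sats.eval N ρ D) t = relOf D t) ∧
    ∀ e s t, t < N → (relOf (sats.eval N ρ D) 14 [e, s, t] ↔ IsSat w v e s t) := by
  have hlt : ∀ {e s}, IsText n w e s → e < N ∧ s < N := by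
    rintro e s ⟨f, h⟩
    have := h.le
    have := h.lt
    omega
  have hconst : ∀ {e s t} {f : LTLFormula (CIProp (Fin n))}, IsTextOf w e s f → N - 1 ≤ t →
      (IsSat w v e s t ↔ IsSat w v e s (N - 1)) := fun {e s t f} hf ht => by
    have : (fun i => v (t + i)) = fun i => v (N - 1 + i) := by
      funext i
      rw [hv _ (by omega), hv (N - 1 + i) (by omega)]
    rw [hf.isSat_iff, hf.isSat_iff, this]
  obtain ⟨h2, h3⟩ := eval_define₃ (N := N) (ρ := ρ) (D := D) (tag := 14) (x := 4) (y := 5) (z := 6)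
    (φ := .isSat) (by decide) hfresh (IsSat w v) (fun e s t he hs ht R hR hR' => by
    have hc : ∀ (a : Token) i, R a.code [i] ↔ w[i]? = some a := fun a i => by
      rw [hR _ (by have := a.code_lt; omega), hD]
    have hR'' : ∀ {d}, d < e → ∀ s' t', t' < N → (R 14 [d, s', t'] ↔ IsSat w v d s' t') :=
        fun hd s' t' ht' => by
      rw [hR' _ hd]
      exact ⟨fun h => h.2.2, fun h => ⟨(hlt (h.imp fun _ h => h.1)).2, ht', h⟩⟩
    simp [Form.isSat, Form.conjs, Form.tok, Form.bit, hc, hR 12, hR 13, h13, h1]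
    by_cases hT : IsText n w e s
    swap
    · exact iff_of_false (fun h => hT h.1) fun h => hT (h.imp fun _ h => h.1)
    obtain ⟨f, hf⟩ := id hT
    rw [hf.isSat_iff]
    simp only [hT, true_and]
    cases f with
    | atom p =>
      have hp : relOf D 12 [s, t] ↔ p ∈ v t := h12 p s t ht (isTextOf_atom.1 hf).2
      change _ ↔ p ∈ v t
      rw [← hp]
      rcases hf.last_of_atom with h | ⟨b, h⟩
      · simp [h]
      · cases b <;> simp [h]
    | neg f =>
      obtain ⟨d, rfl, h2, h3⟩ := isTextOf_neg.1 hf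
      simp only [h2, LTLFormula.Sat, ← h3.isSat_iff]
      simp [hR'' (Nat.lt_succ_self d) s t ht, show d < N by omega]
    | next f =>
      obtain ⟨d, rfl, h2, h3⟩ := isTextOf_next.1 hf
      have h4 : (f.Sat fun i => v (t + (1 + i))) ↔ IsSat w v d s (t + 1) := by
        simp only [h3.isSat_iff, Nat.add_assoc]
      simp only [h2, LTLFormula.Sat, h4]
      simp [show d < N by omega]
      constructor
      · rintro ⟨c, hc', rfl | ⟨rfl, rfl⟩, h5⟩
        · rwa [hR'' (Nat.lt_succ_self d) s _ hc'] at h5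
        · rw [hR'' (Nat.lt_succ_self d) s _ hc', ← hconst h3 (Nat.le_succ _)] at h5
          exact h5
      · intro h5
        by_cases hc' : t + 1 < N
        · exact ⟨t + 1, hc', .inl rfl, (hR'' (Nat.lt_succ_self d) s _ hc').2 h5⟩
        · obtain rfl : t = N - 1 := by omega
          refine ⟨N - 1, ht, .inr ⟨rfl, rfl⟩, (hR'' (Nat.lt_succ_self d) s _ ht).2 ?_⟩
          exact (hconst h3 (Nat.le_succ _)).1 h5
    | conj f g =>
      obtain ⟨d, rfl, h2, c, h3, h4⟩ := isTextOf_conj.1 hf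
      have := h4.le
      simp only [h2, LTLFormula.Sat, ← h3.isSat_iff, ← h4.isSat_iff]
      simp [show d < N by omega]
      constructor
      · rintro ⟨c', _, h5, _, ⟨g', h6⟩, h7, h8⟩
        obtain rfl : c' = c := by have := (h6.unique h4).1; omega
        rw [hR'' (by omega) _ _ ht] at h7 h8
        exact ⟨h7, h8⟩
      · rintro ⟨h7, h8⟩
        exact ⟨c, by omega, by omega, ⟨f, h3⟩, ⟨g, h4⟩, (hR'' (by omega) _ _ ht).2 h7,
          (hR'' (by omega) _ _ ht).2 h8⟩
    | untl f g =>
      obtain ⟨d, rfl, h2, c, h3, h4⟩ := isTextOf_untl.1 hf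
      have hcd := h4.le
      have h5 : ∀ k, ((f.Sat fun i => v (t + (k + i))) ↔ IsSat w v c s (t + k)) ∧
          ((g.Sat fun i => v (t + (k + i))) ↔ IsSat w v d (c + 1) (t + k)) := fun k => by
        simp only [h3.isSat_iff, h4.isSat_iff, Nat.add_assoc, and_self]
      simp only [h2, LTLFormula.Sat, (h5 _).1, (h5 _).2]
      simp [show d < N by omega]
      constructor
      · rintro ⟨c', _, _, _, ⟨g', h6⟩, t', ht', h7, h8, h9⟩
        obtain rfl : c' = c := by have := (h6.unique h4).1; omega
        rw [hR'' (by omega) _ _ ht'] at h8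
        refine ⟨t' - t, by rwa [Nat.add_sub_cancel' h7], fun k hk => ?_⟩
        have h10 := (h9 (t + k) (by omega)).resolve_left (by omega)
        rwa [hR'' (by omega) _ _ (by omega)] at h10
      · rintro ⟨k, h7, h8⟩
        -- A witness that lies beyond the last position is replaced by this position.
        refine ⟨c, by omega, by omega, ⟨f, h3⟩, ⟨g, h4⟩, min (t + k) (N - 1), by omega, by omega,
          ?_, fun i hi => ?_⟩
        · rw [hR'' (by omega) _ _ (by omega)]
          rcases le_total (t + k) (N - 1) with h9 | h9
          · rwa [min_eq_left h9]
          · rw [min_eq_right h9]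
            exact (hconst h4 h9).1 h7
        · by_cases hti : t ≤ i ∧ i < min (t + k) (N - 1)
          · refine .inr ((hR'' (by omega) _ _ hi).2 ?_)
            have := h8 (i - t) (by omega)
            rwa [Nat.add_sub_cancel' hti.1] at this
          · exact .inl fun h => by omega)
  exact ⟨h2, fun e s t ht => (h3 e s t).trans ⟨fun h => h.2.2.2,
    fun h => ⟨(hlt (h.imp fun _ h => h.1)).1, (hlt (h.imp fun _ h => h.1)).2, ht, h⟩⟩⟩

end Cmd

/-! ### LTL model checking in polynomial time -/

namespace Cmd

open Function

/-- Number of letters that encode the template. -/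
def _root_.Term.templateLength : Term :=
  .var 0 + .const 1 + .prod 0 0 + .prod 0 0 + .prod 0 0

lemma bound_separation : ∀ x ∈ separation.bound, x ≠ 0 ∧ x ≠ 1 ∧ x ≠ 2 ∧ x ≠ 3 := by
  simp [separation, directed, treks, closure, define, bound, Form.bound, Form.inSet, Form.reach,
    Form.edge, Form.disj, Form.eq, Form.lt, Form.conjs]

lemma proper_separation : separation.Proper := by
  simp [separation, directed, treks, closure, define, bound, Proper, Form.bound, Form.Proper,
    Form.inSet, Form.reach, Form.edge, Form.disj, Form.eq, Form.lt, Form.conjs]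

lemma proper_withSize {s : Cmd} (h : ∀ x ∈ s.bound, x ≠ 0 ∧ x ≠ 1) (hs : s.Proper) :
    (withSize s).Proper := by
  have h0 : 0 ∉ s.bound := fun h' => (h _ h').1 rfl
  have h1 : 1 ∉ s.bound := fun h' => (h _ h').2 rfl
  simp [withSize, firstSep, Proper, bound, Form.Proper, Form.bound, Form.eq, Form.lt, h0, h1, hs]

/-- The program for LTL model checking. -/
def ltl : Cmd :=
  withSize <| .seq separation <| .seq texts <| .seq sats <|
    define 15 [4] (.conj (.eq (.var 4) (.const 0)) (.mem 14 [.var 1, .templateLength, .const 0]))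

lemma eval_ltl_body {N n : ℕ} {ρ : Var → ℕ} {D : List (List ℕ)} {w : List Token}
    {T : DBNTemplate (Fin n)} (hT : T.IsRestricted) {f : LTLFormula (CIProp (Fin n))}
    (hw : w = encodeTemplate T ++ encodeFormula f) (h0 : ρ 0 = n) (h1 : ρ 1 = N - 1)
    (hN : w.length = N) (hD : ∀ (a : Token) i, relOf D a.code [i] ↔ w[i]? = some a)
    (hfresh : ∀ t, 8 ≤ t → ∀ v, ¬ relOf D t v) :
    (∀ t < 8, relOf ((Cmd.seq separation <| .seq texts <| .seq sats <|
      define 15 [4] (.conj (.eq (.var 4) (.const 0))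
        (.mem 14 [.var 1, .templateLength, .const 0]))).eval N ρ D) t = relOf D t) ∧
    ∀ a, relOf ((Cmd.seq separation <| .seq texts <| .seq sats <|
      define 15 [4] (.conj (.eq (.var 4) (.const 0))
        (.mem 14 [.var 1, .templateLength, .const 0]))).eval N ρ D) 15 [a] ↔
        a = 0 ∧ f.Sat (T.trace Set.univ) := by
  have hlen : N = n + 1 + n * n + n * n + n * n + (encodeFormula f).length := by
    rw [← hN, hw, List.length_append, length_encodeTemplate]
  have hpos := length_encodeFormula_pos f
  have hocc := Occurs.self (w := w)
  conv at hocc => arg 3; rw [hw]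
  rw [Occurs.append_iff, Nat.zero_add, length_encodeTemplate] at hocc
  simp only [eval]
  obtain ⟨a1, a2, a3⟩ := eval_separation (N := N) (ρ := ρ) (D := D) (bit := isOne w) (by omega) h0
    (by omega) (fun i => hD (.bit true) i)
    (fun i hi => hN ▸ (List.getElem?_eq_some_iff.1 hi).1) hfresh
  generalize separation.eval N ρ D = D1 at a1 a2 a3 ⊢
  obtain ⟨b1, b2⟩ := eval_texts (ρ := ρ) (D := D1) h0 (by omega) hN
    (fun a i => by rw [a1 _ a.code_lt, hD]) (a2 13 le_rfl)
  generalize texts.eval N ρ D1 = D2 at b1 b2 ⊢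
  obtain ⟨c1, c2⟩ := eval_sats (ρ := ρ) (D := D2) (v := T.trace Set.univ) h1 hN
    (fun t ht => by
      have h2 : Fintype.card (Fin n) ^ 2 ≤ N - 1 := by
        rw [Fintype.card_fin, sq]; omega
      rw [DBNTemplate.trace_eq_of_le hT _ (h2.trans ht), DBNTemplate.trace_eq_of_le hT _ h2])
    (fun a i => by rw [b1 _ (by have := a.code_lt; omega), a1 _ a.code_lt, hD])
    (fun p s t ht hp => by
      rw [b1 12 (by decide), a3, bitHolds_iff hocc.1 hp]
      have := hp.lt (by simp)
      simp only [List.length_cons] at this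
      simp only [DBNTemplate.trace, Set.mem_univ, true_and, Set.mem_ofPred_eq]
      exact ⟨fun h => h.2.2, fun h => ⟨by omega, ht, h⟩⟩) b2
    (by simpa only [b1 14 (by decide)] using a2 14 (by decide))
  generalize sats.eval N ρ D2 = D3 at c1 c2 ⊢
  obtain ⟨d1, d2⟩ := eval_define₁ (N := N) (ρ := ρ) (D := D3) (tag := 15) (x := 4)
    (φ := (.conj (.eq (.var 4) (.const 0)) (.mem 14 [.var 1, .templateLength, .const 0])))
    (by simpa only [c1 15 (by decide), b1 15 (by decide)] using a2 15 (by decide))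
    (fun a => a = 0 ∧ f.Sat (T.trace Set.univ)) (fun a ha R hR _ => by
      have h2 : IsTextOf w (N - 1) (n + 1 + n * n + n * n + n * n) f := ⟨hocc.2, by omega⟩
      have h3 := (c2 (N - 1) (n + 1 + n * n + n * n + n * n) 0 (by omega)).trans h2.isSat_iff
      simp only [Nat.zero_add] at h3
      simp [Term.templateLength, h0, h1, hR 14 (by decide)]
      exact fun _ => h3)
  refine ⟨fun t ht => ?_, fun a => (d2 a).trans ⟨fun h => h.2, fun h => ⟨by omega, h⟩⟩⟩
  rw [d1 t (by omega), c1 t (by omega), b1 t (by omega), a1 t ht]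

end Cmd

theorem ltl_polyTimeDecidable : PolyTimeDecidable LTLInstance.encode LTLInstance.Yes := by
  refine polyTimeDecidable_of_cmd .ltl (.ex 0 (.mem 15 [.var 0])) ?_ ?_ _ _ fun I => ?_
  · refine Cmd.proper_withSize ?_ ?_
    · simp only [Cmd.bound, List.mem_append]
      rintro x (h | h)
      · exact ⟨(Cmd.bound_separation x h).1, (Cmd.bound_separation x h).2.1⟩
      · simp [Cmd.bound, Cmd.texts, Cmd.sats, Cmd.define, Form.isText, Form.isSat, Form.isProp,
          Form.bit, Form.tok, Form.all, Form.disj, Form.eq, Form.lt, Form.conjs, Form.bound] at h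
        constructor <;> rintro rfl <;> simp at h
    · simp [Cmd.Proper, Cmd.proper_separation, Cmd.bound, Cmd.texts, Cmd.sats, Cmd.define,
        Form.isText, Form.isSat, Form.isProp, Form.bit, Form.tok, Form.all, Form.disj, Form.eq,
        Form.lt, Form.conjs, Form.bound, Form.Proper]
  · simp [Form.Proper, Form.bound]
  · obtain ⟨n, T, hT, f⟩ := I
    simp only [LTLInstance.encode, LTLInstance.Yes]
    obtain ⟨w, hw⟩ : ∃ w, w = encodeTemplate T ++ encodeFormula f := ⟨_, rfl⟩
    rw [← hw]
    have hpos := length_encodeFormula_pos f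
    have hN : 0 < w.length := by rw [hw, List.length_append]; omega
    have hsep := encodeTemplate_sep (w := w) (T := T) (by
      have hocc := Occurs.self (w := w)
      conv at hocc => arg 3; rw [hw]
      exact (Occurs.append_iff.1 hocc).1)
    obtain ⟨h1, h2⟩ := Cmd.eval_ltl_body (N := w.length) (D := inputDB 0 w [])
      (ρ := Function.update (Function.update (fun _ => 0) 0 n) 1 (w.length - 1)) hT hw
      (by simp) (by simp) rfl (relOf_inputDB_code w) (fun t => not_relOf_inputDB w)
    rw [Cmd.ltl, Cmd.eval_withSize (n := n) rfl (relOf_inputDB_code w .sep) hsep.1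
      (fun i hi => by rw [hsep.2 i hi]; simp) h1]
    simp only [Form.holds_ex, Form.holds_mem, List.map_cons, List.map_nil, Term.val_var,
      Function.update_self, h2]
    exact ⟨fun ⟨_, _, _, h⟩ => h, fun h => ⟨0, hN, rfl, h⟩⟩

/-! ### Büchi automata on eventually constant words -/

/-- `RunTo R I t q`: there is a run of length `t` from `I` to `q` whose steps at time `i` lie in
`R i`. -/
inductive RunTo {Q : Type*} (R : ℕ → Q → Q → Prop) (I : Q → Prop) : ℕ → Q → Prop
  | zero {q : Q} : I q → RunTo R I 0 q
  | succ {t : ℕ} {p q : Q} : RunTo R I t p → R t p q → RunTo R I (t + 1) q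

namespace RunTo

open Relation

variable {Q : Type*} {R : ℕ → Q → Q → Prop} {I : Q → Prop}

lemma zero_iff (q : Q) : RunTo R I 0 q ↔ I q := ⟨fun | .zero h => h, .zero⟩

lemma succ_iff (t : ℕ) (q : Q) : RunTo R I (t + 1) q ↔ ∃ p, RunTo R I t p ∧ R t p q :=
  ⟨fun | .succ h1 h2 => ⟨_, h1, h2⟩, fun ⟨_, h1, h2⟩ => .succ h1 h2⟩

lemma exists_path {t : ℕ} {q : Q} (h : RunTo R I t q) :
    ∃ c : ℕ → Q, I (c 0) ∧ c t = q ∧ ∀ i < t, R i (c i) (c (i + 1)) := by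
  induction h with
  | @zero q h => exact ⟨fun _ => q, h, rfl, by simp⟩
  | @succ t p q _ h ih =>
    obtain ⟨c, h1, rfl, h3⟩ := ih
    refine ⟨fun i => if i ≤ t then c i else q, by simpa, by simp, fun i hi => ?_⟩
    rcases Nat.lt_succ_iff_lt_or_eq.1 hi with hi | rfl
    · simpa [hi.le, Nat.succ_le_iff.2 hi] using h3 i hi
    · simpa using h

/-- A run is prolonged by a path of steps that are possible at all later times. -/
lemma extend {t : ℕ} {p q : Q} (h : RunTo R I t p) {S : Q → Q → Prop}
    (hS : ∀ i, t ≤ i → ∀ a b, S a b → R i a b) (hpq : ReflTransGen S p q) :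
    ∃ u, t ≤ u ∧ RunTo R I u q := by
  induction hpq with
  | refl => exact ⟨t, le_rfl, h⟩
  | tail _ h2 ih =>
    obtain ⟨u, hu, h3⟩ := ih
    exact ⟨u + 1, by omega, .succ h3 (hS u hu _ _ h2)⟩

/-- Renaming of the states. -/
lemma map_iff {Q' : Type*} {f : Q → Q'} (hf : f.Injective) (t : ℕ) (x : Q') :
    RunTo (fun i => Relation.Map (R i) f f) (fun x => ∃ q, f q = x ∧ I q) t x ↔
      ∃ q, f q = x ∧ RunTo R I t q := by
  induction t generalizing x with
  | zero => simp only [zero_iff]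
  | succ t ih =>
    simp only [succ_iff, ih]
    constructor
    · rintro ⟨_, ⟨p, rfl, h1⟩, p', q, h2, h3, rfl⟩
      obtain rfl := hf h3
      exact ⟨q, rfl, p', h1, h2⟩
    · rintro ⟨q, rfl, p, h1, h2⟩
      exact ⟨f p, ⟨p, rfl, h1⟩, p, q, h2, rfl, rfl⟩

end RunTo

lemma reflTransGen_map_iff {Q Q' : Type*} {r : Q → Q → Prop} {f : Q → Q'} (hf : f.Injective)
    {u : Q} {x : Q'} : Relation.ReflTransGen (Relation.Map r f f) (f u) x ↔
      ∃ v, f v = x ∧ Relation.ReflTransGen r u v := by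
  constructor
  · intro h
    induction h with
    | refl => exact ⟨u, rfl, .refl⟩
    | tail _ h ih =>
      obtain ⟨v, rfl, h1⟩ := ih
      obtain ⟨v', z, h2, h3, rfl⟩ := h
      obtain rfl := hf h3
      exact ⟨z, rfl, h1.tail h2⟩
  · rintro ⟨v, rfl, h⟩
    exact h.lift f fun a b hab => ⟨a, b, hab, rfl, rfl⟩

namespace NBA

open Relation

variable {S Q : Type*} {B : NBA S Q} {w : ℕ → S} {T : ℕ}

/-- An accepting run on a word that is constant from time `T` on amounts to a lasso: a run to some
state at time `T`, a path from there to an accepting state, and a cycle through the latter. -/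
theorem accepts_iff_lasso [Finite Q] (hw : ∀ t, T ≤ t → w t = w T) :
    B.Accepts w ↔ ∃ q f g, RunTo (fun i a b => (a, w i, b) ∈ B.Δ) (· ∈ B.initial) T q ∧
      ReflTransGen (fun a b => (a, w T, b) ∈ B.Δ) q f ∧ f ∈ B.accepting ∧ (f, w T, g) ∈ B.Δ ∧
      ReflTransGen (fun a b => (a, w T, b) ∈ B.Δ) g f := by
  constructor
  · rintro ⟨ρ, h0, hstep, hinf⟩
    have hrun : ∀ t, RunTo (fun i a b => (a, w i, b) ∈ B.Δ) (· ∈ B.initial) t (ρ t) := by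
      intro t
      induction t with
      | zero => exact .zero h0
      | succ t ih => exact .succ ih (hstep t)
    have hpath : ∀ i j, T ≤ i → i ≤ j →
        ReflTransGen (fun a b => (a, w T, b) ∈ B.Δ) (ρ i) (ρ j) := by
      intro i j hi hij
      induction j, hij using Nat.le_induction with
      | base => exact .refl
      | succ j hij ih =>
        have := hstep j
        rw [hw j (hi.trans hij)] at this
        exact ih.tail this
    -- Some accepting state is visited infinitely often.
    obtain ⟨f, hf⟩ : ∃ f, {j | ρ j ∈ B.accepting ∧ ρ j = f}.Infinite := by
      by_contra! h
      refine hinf ((Set.finite_iUnion fun f => h f).subset fun j hj => ?_)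
      exact Set.mem_iUnion.2 ⟨ρ j, hj, rfl⟩
    obtain ⟨j, ⟨hj1, hj2⟩, hj⟩ := hf.exists_gt T
    obtain ⟨k, ⟨_, hk2⟩, hk⟩ := hf.exists_gt j
    refine ⟨ρ T, f, ρ (j + 1), hrun T, hj2 ▸ hpath T j le_rfl hj.le, hj2 ▸ hj1, ?_, ?_⟩
    · have := hstep j
      rwa [hw j hj.le, hj2] at this
    · rw [← hk2]
      exact hpath _ _ (by omega) hk
  · rintro ⟨q, f, g, h1, h2, hf, h3, h4⟩
    obtain ⟨u, hu, h5⟩ := h1.extend (S := fun a b => (a, w T, b) ∈ B.Δ)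
      (fun i hi a b h => by rw [hw i hi]; exact h) h2
    obtain ⟨c, hc0, hcu, hc⟩ := h5.exists_path
    obtain ⟨m, hm, h6⟩ := (RunTo.succ (R := fun _ a b => (a, w T, b) ∈ B.Δ) (I := (· = f))
      (.zero rfl) h3).extend (fun _ _ _ _ h => h) h4
    obtain ⟨d, hd0, hdm, hd⟩ := h6.exists_path
    -- The run follows `c` to the accepting state and repeats the cycle `d` from then on.
    refine ⟨fun i => if i < u then c i else d ((i - u) % m), ?_, fun i => ?_, ?_⟩
    · by_cases hu0 : 0 < u
      · simpa [hu0] using hc0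
      · obtain rfl : u = 0 := by omega
        simpa [hd0, ← hcu] using hc0
    · rcases lt_trichotomy (i + 1) u with hi | hi | hi
      · simpa [hi, show i < u by omega] using hc i (by omega)
      · subst hi
        simpa [hd0, ← hcu] using hc i (by omega)
      · simp only [show ¬ i < u by omega, show ¬ i + 1 < u by omega, if_false]
        rw [hw i (by omega), show i + 1 - u = i - u + 1 by omega]
        have hlt := Nat.mod_lt (i - u) hm
        have h7 := hd _ hlt
        rw [← Nat.mod_add_mod]
        by_cases h8 : (i - u) % m + 1 = m
        · rw [h8] at h7
          rwa [h8, Nat.mod_self, hd0, ← hdm]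
        · rwa [Nat.mod_eq_of_lt (show (i - u) % m + 1 < m from by omega)]
    · refine Set.infinite_of_injective_forall_mem (f := fun k => u + k * m) (fun a b h => ?_)
        fun k => ?_
      · exact Nat.eq_of_mul_eq_mul_right hm (Nat.add_left_cancel h)
      · simpa [hd0] using hf

end NBA

/-! ### The automaton in the input word -/

lemma occurs_encodeIndex {w : List Token} {s k : ℕ} {i : Fin k} :
    Occurs w s (encodeIndex i) ↔ w[s + i]? = some .sep ∧ ∀ j < (i : ℕ), w[s + j]? = some .item := by
  rw [encodeIndex, Occurs.append_iff, and_comm]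
  refine and_congr (by simp) ⟨fun h j hj => ?_, fun h j hj => ?_⟩
  · rw [h j (by simpa using hj), List.getElem_replicate]
  · rw [h j (by simpa using hj), List.getElem_replicate]

/-- Unary numbers that are read from the same position agree. -/
lemma eq_of_unary {w : List Token} {s a b : ℕ} (ha : w[s + a]? = some .sep)
    (ha' : ∀ j < a, w[s + j]? = some .item) (hb : w[s + b]? = some .sep)
    (hb' : ∀ j < b, w[s + j]? = some .item) : a = b := by
  rcases lt_trichotomy a b with h | h | h
  · simp [hb' a h] at ha
  · exact h
  · simp [ha' b h] at hb

namespace NBAInstance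

open Relation

variable (I : NBAInstance)

/-- Position of the proposition of the given index. -/
def propPos (i : ℕ) : ℕ :=
  I.n + 1 + I.n * I.n + I.n * I.n + I.n * I.n + i + i * I.n + i * I.n + i * I.n

/-- Position of the given state. -/
def statePos (i : ℕ) : ℕ := I.propPos I.props.length + 1 + i + i + i

/-- The text of a transition. -/
def encodeTrans (d : Fin I.q × Finset (Fin I.props.length) × Fin I.q) : List Token :=
  Token.item :: (encodeIndex d.1 ++ encodeSubset d.2.1 ++ encodeIndex d.2.2)

lemma length_encodeTrans (d : Fin I.q × Finset (Fin I.props.length) × Fin I.q) :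
    (I.encodeTrans d).length = 3 + d.1 + d.2.2 + I.props.length := by
  simp [encodeTrans, encodeIndex]
  omega

lemma length_props : (I.props.flatMap fun p => Token.item :: encodeCIProp p).length =
    I.props.length * (1 + I.n + I.n + I.n) :=
  List.length_flatMap_of_length_eq fun p _ => by simp; omega

lemma length_states : ((List.finRange I.q).flatMap (fun s => [Token.item,
    Token.bit (decide (s ∈ I.initial)), Token.bit (decide (s ∈ I.accepting))])).length =
    I.q * 3 := by
  rw [List.length_flatMap_of_length_eq (c := 3) (by simp), List.length_finRange]

lemma propPos_eq (i : ℕ) : I.propPos i =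
    I.n + 1 + I.n * I.n + I.n * I.n + I.n * I.n + i * (1 + I.n + I.n + I.n) := by
  rw [propPos]; ring

lemma length_encode : I.encode.length =
    I.statePos I.q + 1 + (I.trans.flatMap I.encodeTrans).length := by
  change List.length (_ ++ I.trans.flatMap I.encodeTrans) = _
  simp only [List.length_append, length_props, length_states, length_encodeTemplate,
    List.length_singleton, statePos, propPos_eq]
  omega

lemma occurs_encode :
    Occurs I.encode 0 (encodeTemplate I.template) ∧
    (∀ i (h : i < I.props.length),
      Occurs I.encode (I.propPos i) (Token.item :: encodeCIProp I.props[i])) ∧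
    I.encode[I.propPos I.props.length]? = some .sep ∧
    (∀ s : Fin I.q, Occurs I.encode (I.statePos s) [Token.item,
      Token.bit (decide (s ∈ I.initial)), Token.bit (decide (s ∈ I.accepting))]) ∧
    I.encode[I.statePos I.q]? = some .sep ∧
    Occurs I.encode (I.statePos I.q + 1) (I.trans.flatMap I.encodeTrans) := by
  have h := Occurs.self (w := I.encode)
  conv at h => arg 3; rw [encode]
  simp only [Occurs.append_iff, List.length_append, length_props, length_states,
    length_encodeTemplate, List.length_singleton, Nat.zero_add, Occurs.cons_iff] at h
  have e1 := I.propPos_eq I.props.length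
  have e2 : I.statePos I.q = I.propPos I.props.length + 1 + I.q * 3 := by rw [statePos]; omega
  obtain ⟨⟨⟨⟨⟨h1, h2⟩, h3, -⟩, h4⟩, h5, -⟩, h6⟩ := h
  refine ⟨h1, fun i hi => ?_, e1 ▸ h3, fun s => ?_, ?_, ?_⟩
  · rw [propPos_eq]
    exact h2.flatMap (fun p _ => by simp; omega) i hi
  · have := h4.flatMap (c := 3) (by simp) s (by simp)
    rw [← e1, show I.propPos I.props.length + 1 + (s : ℕ) * 3 = I.statePos s by
      rw [statePos]; omega] at this
    simpa using this
  · rw [e2, e1]; exact h5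
  · rw [e2, e1]; exact h6

/-- A transition from `a` to `b` is written at position `p`. -/
def TransAt (p a b : ℕ) : Prop :=
  ∃ pre d post, I.trans = pre ++ d :: post ∧
    p = I.statePos I.q + 1 + (pre.flatMap I.encodeTrans).length ∧ a = d.1 ∧ b = d.2.2

lemma occurs_of_eq_append {pre post d} (h : I.trans = pre ++ d :: post) :
    Occurs I.encode (I.statePos I.q + 1 + (pre.flatMap I.encodeTrans).length)
      (I.encodeTrans d) := by
  have := I.occurs_encode.2.2.2.2.2
  rw [h, List.flatMap_append, Occurs.append_iff, List.flatMap_cons, Occurs.append_iff] at this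
  exact this.2.1

lemma bit_of_eq_append {pre post d} (h : I.trans = pre ++ d :: post)
    (i : Fin I.props.length) :
    I.encode[I.statePos I.q + 1 + (pre.flatMap I.encodeTrans).length + 2 + d.1 + i]? =
      some (.bit (decide (i ∈ d.2.1))) := by
  have := I.occurs_of_eq_append h
  rw [encodeTrans, Occurs.cons_iff, Occurs.append_iff, Occurs.append_iff, occurs_encodeSubset]
    at this
  rw [← this.2.1.2 i]
  congr 1
  simp [encodeIndex]
  omega

variable {I}

lemma TransAt.lt {p a b : ℕ} (h : I.TransAt p a b) :
    p + a + b + I.props.length < I.encode.length := by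
  obtain ⟨pre, d, post, h1, rfl, rfl, rfl⟩ := h
  have := (I.occurs_of_eq_append h1).lt (by simp [encodeTrans])
  rw [length_encodeTrans] at this
  omega

lemma transAt_iff {p a b : ℕ} : I.TransAt p a b ↔
    (p = I.statePos I.q + 1 ∨ ∃ p' < p, ∃ a' b', I.TransAt p' a' b' ∧
      p = p' + 3 + a' + b' + I.props.length) ∧ I.encode[p]? = some .item ∧
    I.encode[p + 1 + a]? = some .sep ∧ (∀ j < a, I.encode[p + 1 + j]? = some .item) ∧
    I.encode[p + 2 + a + I.props.length + b]? = some .sep ∧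
    ∀ j < b, I.encode[p + 2 + a + I.props.length + j]? = some .item := by
  have hocc : ∀ {pre d post}, I.trans = pre ++ d :: post → ∀ {p},
      p = I.statePos I.q + 1 + (pre.flatMap I.encodeTrans).length →
      I.encode[p]? = some .item ∧
      (I.encode[p + 1 + d.1]? = some .sep ∧ ∀ j < (d.1 : ℕ), I.encode[p + 1 + j]? = some .item) ∧
      I.encode[p + 2 + d.1 + I.props.length + d.2.2]? = some .sep ∧
      ∀ j < (d.2.2 : ℕ), I.encode[p + 2 + d.1 + I.props.length + j]? = some .item := by
    rintro pre d post h p rfl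
    have := I.occurs_of_eq_append h
    have e : ∀ p, p + 1 + (encodeIndex d.1 ++ encodeSubset d.2.1).length =
        p + 2 + d.1 + I.props.length := fun p => by simp [encodeIndex]; omega
    rw [encodeTrans, Occurs.cons_iff, Occurs.append_iff, Occurs.append_iff, e, occurs_encodeIndex,
      occurs_encodeIndex] at this
    exact ⟨this.1, this.2.1.1, this.2.2⟩
  constructor
  · rintro ⟨pre, d, post, h, hp, rfl, rfl⟩
    obtain ⟨h1, h2, h3⟩ := hocc h hp
    refine ⟨?_, h1, h2.1, h2.2, h3⟩
    rcases List.eq_nil_or_concat pre with rfl | ⟨pre', d', rfl⟩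
    · exact .inl (by simpa using hp)
    · rw [List.concat_eq_append, List.flatMap_append, List.length_append, List.flatMap_singleton,
        length_encodeTrans] at hp
      exact .inr ⟨_, by omega, d'.1, d'.2.2, ⟨pre', d', d :: post, by simpa using h, rfl, rfl, rfl⟩,
        by omega⟩
  · rintro ⟨h1, h2, h3, h4, h5, h6⟩
    obtain ⟨pre, post, h7, h8⟩ : ∃ pre post, I.trans = pre ++ post ∧
        p = I.statePos I.q + 1 + (pre.flatMap I.encodeTrans).length := by
      rcases h1 with h1 | ⟨p', _, a', b', ⟨pre, d, post, h7, h8, rfl, rfl⟩, h1⟩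
      · exact ⟨[], _, rfl, by simpa using h1⟩
      · refine ⟨pre ++ [d], post, by simpa using h7, ?_⟩
        rw [List.flatMap_append, List.length_append, List.flatMap_singleton, length_encodeTrans]
        omega
    cases post with
    | nil =>
      rw [List.append_nil] at h7
      rw [← h7, ← length_encode] at h8
      simp [h8] at h2
    | cons d post =>
      obtain ⟨k1, k2, k3⟩ := hocc h7 h8
      obtain rfl := eq_of_unary h3 h4 k2.1 k2.2
      exact ⟨pre, d, post, h7, h8, rfl, eq_of_unary h5 h6 k3.1 k3.2⟩

/-- The letter of a transition is the letter of the trace at time `t`. -/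
lemma letter_eq_trace_iff (s : Finset (Fin I.props.length)) (t : ℕ) :
    I.letter s = I.template.trace I.propSet t ↔
      ∀ i, i ∈ s ↔ I.template.HoldsAt t (I.props.get i) := by
  have hinj := List.nodup_iff_injective_get.1 I.props_nodup
  constructor
  · intro h i
    have h1 : I.props.get i ∈ I.letter s ↔ I.props.get i ∈ I.template.trace I.propSet t := by rw [h]
    constructor
    · exact fun hi => (h1.1 ⟨i, hi, rfl⟩).2
    · intro hi
      obtain ⟨j, hj, h2⟩ := h1.2 ⟨List.get_mem _ _, hi⟩
      exact hinj h2 ▸ hj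
  · intro h
    ext p
    constructor
    · rintro ⟨i, hi, rfl⟩
      exact ⟨List.get_mem _ _, (h i).1 hi⟩
    · rintro ⟨hp, ht⟩
      obtain ⟨i, rfl⟩ := List.get_of_mem hp
      exact ⟨i, (h i).2 ht, rfl⟩

variable (I)

/-- The automaton can move from state `a` to state `b` at time `t`. -/
def Step (t a b : ℕ) : Prop :=
  ∃ d ∈ I.trans, a = d.1 ∧ b = d.2.2 ∧ ∀ i, i ∈ d.2.1 ↔ I.template.HoldsAt t (I.props.get i)

lemma step_eq_map (t : ℕ) : I.Step t = Relation.Map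
    (fun a b => (a, I.template.trace I.propSet t, b) ∈ I.automaton.Δ) Fin.val Fin.val := by
  funext a b
  simp only [Step, Relation.Map, automaton, ← letter_eq_trace_iff, eq_iff_iff, Set.mem_ofPred_eq,
    Prod.mk.injEq]
  constructor
  · rintro ⟨d, hd, rfl, rfl, h⟩
    exact ⟨_, _, ⟨d, hd, rfl, h.symm, rfl⟩, rfl, rfl⟩
  · rintro ⟨a, b, ⟨d, hd, rfl, h, rfl⟩, rfl, rfl⟩
    exact ⟨d, hd, rfl, rfl, h.symm⟩

/-- The acceptance condition for states written as numbers. -/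
lemma yes_iff {T : ℕ} (hT : I.n ^ 2 ≤ T) : I.Yes ↔ ∃ q f g,
    RunTo I.Step (fun x => ∃ s : Fin I.q, s = x ∧ s ∈ I.initial) T q ∧
    ReflTransGen (I.Step T) q f ∧ (∃ s : Fin I.q, s = f ∧ s ∈ I.accepting) ∧ I.Step T f g ∧
    ReflTransGen (I.Step T) g f := by
  have hT' : Fintype.card (Fin I.n) ^ 2 ≤ T := by simpa
  rw [Yes, NBA.accepts_iff_lasso (T := T) fun t ht => by
    rw [DBNTemplate.trace_eq_of_le I.restricted _ (hT'.trans ht),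
      DBNTemplate.trace_eq_of_le I.restricted _ hT']]
  have hstep : I.Step = fun t => Relation.Map
    (fun a b => (a, I.template.trace I.propSet t, b) ∈ I.automaton.Δ) Fin.val Fin.val :=
    funext I.step_eq_map
  simp only [hstep]
  constructor
  · rintro ⟨q, f, g, h1, h2, h3, h4, h5⟩
    exact ⟨q, f, g, (RunTo.map_iff Fin.val_injective _ _).2 ⟨q, rfl, h1⟩,
      (reflTransGen_map_iff Fin.val_injective).2 ⟨f, rfl, h2⟩, ⟨f, rfl, h3⟩, ⟨f, g, h4, rfl, rfl⟩,
      (reflTransGen_map_iff Fin.val_injective).2 ⟨f, rfl, h5⟩⟩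
  · rintro ⟨_, _, _, h1, h2, ⟨f, rfl, h3⟩, ⟨f', g, h4, h6, rfl⟩, h5⟩
    obtain ⟨q, rfl, k1⟩ := (RunTo.map_iff Fin.val_injective _ _).1 h1
    obtain ⟨f1, h7, k2⟩ := (reflTransGen_map_iff Fin.val_injective).1 h2
    obtain ⟨f2, h8, k5⟩ := (reflTransGen_map_iff Fin.val_injective).1 h5
    obtain rfl := Fin.val_injective h6
    obtain rfl := Fin.val_injective h7
    obtain rfl := Fin.val_injective h8
    exact ⟨q, f2, g, k1, k2, h3, h4, k5⟩

end NBAInstance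

/-! ### A program for Büchi model checking -/

/-- The position of the proposition whose index the variable `x` holds. -/
def Term.propPos (x : Var) : Term :=
  .templateLength + .var x + .prod x 0 + .prod x 0 + .prod x 0

/-- The position of the state that the variable `x` holds; the variable 2 holds the number of
propositions. -/
def Term.statePos (x : Var) : Term := .propPos 2 + .const 1 + .var x + .var x + .var x

/-- The variables 4, 5 and 6 hold the position, the source and the target of a transition. The
variable 3 holds the number of states, and the symbol 13 stands for the relation defined by this
formula. -/
def Form.isTrans : Form :=
  let p := Term.var 4
  let a := Term.var 5
  let b := Term.var 6
  .conjs [.disj (.eq p (.statePos 3 + .const 1))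
      (.ex 7 (.conj (.lt (.var 7) p) (.ex 8 (.ex 9 (.conj (.mem 13 [.var 7, .var 8, .var 9])
        (.eq p (.var 7 + .const 3 + .var 8 + .var 9 + .var 2))))))),
    .tok .item p, .tok .sep (p + .const 1 + a),
    .all 10 (.disj (.le a (.var 10)) (.tok .item (p + .const 1 + .var 10))),
    .tok .sep (p + .const 2 + a + .var 2 + b),
    .all 10 (.disj (.le b (.var 10)) (.tok .item (p + .const 2 + a + .var 2 + .var 10)))]

/-- At the time held by the variable 4, the automaton can move from the state held by the variable
5 to the one held by the variable 6. -/
def Form.isStep : Form :=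
  let one := Form.tok (.bit true) (.var 7 + .const 2 + .var 5 + .var 8)
  let holds := Form.mem 12 [.propPos 8, .var 4]
  .ex 7 (.conj (.mem 13 [.var 7, .var 5, .var 6]) (.all 8 (.disj (.le (.var 2) (.var 8))
    (.disj (.conj one holds) (.conj (.neg one) (.neg holds))))))

/-- The state held by the variable 5 is reached at the time held by the variable 4; the symbol 15
stands for the relation defined by this formula. -/
def Form.isRun : Form :=
  .disj (.conjs [.le (.var 4) (.const 0), .lt (.var 5) (.var 3),
      .tok (.bit true) (.statePos 5 + .const 1)])
    (.ex 6 (.conj (.eq (.var 6 + .const 1) (.var 4)) (.ex 7 (.conj (.mem 15 [.var 6, .var 7])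
      (.mem 14 [.var 6, .var 7, .var 5])))))

/-- There is an accepting lasso; the variable 4 has the value 0. -/
def Form.isLasso : Form :=
  .conj (.eq (.var 4) (.const 0)) (.ex 5 (.ex 6 (.ex 7 (.conjs [.mem 15 [.var 1, .var 5],
    .reach 16 4 5 6, .lt (.var 6) (.var 3), .tok (.bit true) (.statePos 6 + .const 2),
    .mem 14 [.var 1, .var 6, .var 7], .reach 16 4 7 6]))))

namespace Cmd

open Function

/-- The relations of the transitions, the steps, the runs, the paths from the last position on, and
the answer. -/
def lasso : Cmd :=
  .seq separation <| .seq (define 13 [4, 5, 6] .isTrans) <| .seq (define 14 [4, 5, 6] .isStep) <|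
  .seq (define 15 [4, 5] .isRun) <|
  .seq (closure 16 (.eq (.var 7) (.var 6)) (.mem 14 [.var 1, .var 9, .var 7])) <|
  define 17 [4] .isLasso

/-- The program for Büchi model checking. -/
def nba : Cmd := withSize <| firstSep 2 .propPos <| firstSep 3 .statePos lasso

/-- The variables 0 to 3 have their intended values. -/
structure _root_.NBAInstance.Sizes (I : NBAInstance) (ρ : Var → ℕ) : Prop where
  h0 : ρ 0 = I.n
  h1 : ρ 1 = I.encode.length - 1
  h2 : ρ 2 = I.props.length
  h3 : ρ 3 = I.q

variable {I : NBAInstance} {ρ : Var → ℕ} {D : List (List ℕ)}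

lemma val_propPos (h0 : ρ 0 = I.n) (x : Var) : (Term.propPos x).val ρ = I.propPos (ρ x) := by
  simp [Term.propPos, Term.templateLength, h0, NBAInstance.propPos]

lemma val_statePos (h0 : ρ 0 = I.n) (h2 : ρ 2 = I.props.length) (x : Var) :
    (Term.statePos x).val ρ = I.statePos (ρ x) := by
  simp [Term.statePos, val_propPos h0, h2, NBAInstance.statePos]

lemma eval_trans (h : I.Sizes ρ)
    (hD : ∀ (a : Token) i, relOf D a.code [i] ↔ I.encode[i]? = some a)
    (hfresh : ∀ v, ¬ relOf D 13 v) :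
    (∀ t ≠ 13, relOf ((define 13 [4, 5, 6] .isTrans).eval I.encode.length ρ D) t = relOf D t) ∧
    ∀ p a b, relOf ((define 13 [4, 5, 6] .isTrans).eval I.encode.length ρ D) 13 [p, a, b] ↔
      I.TransAt p a b := by
  have hlt : ∀ {p a b}, I.TransAt p a b → p < I.encode.length ∧ a < I.encode.length ∧
      b < I.encode.length := fun h => by have := h.lt; omega
  obtain ⟨h1, h2⟩ := eval_define₃ (N := I.encode.length) (ρ := ρ) (D := D) (tag := 13)
    (x := 4) (y := 5) (z := 6) (φ := .isTrans) (by decide) hfresh I.TransAt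
    (fun p a b hp ha hb R hR hR' => by
    have hc : ∀ (a : Token) i, R a.code [i] ↔ I.encode[i]? = some a := fun a i => by
      rw [hR _ (by have := a.code_lt; omega), hD]
    have hs := val_statePos (ρ := update (update (update ρ 4 p) 5 a) 6 b) (I := I)
      (by simp [h.h0]) (by simp [h.h2]) 3
    rw [NBAInstance.transAt_iff]
    simp [Form.isTrans, Form.conjs, Form.tok, hc, hs, h.h3, h.h2]
    have hall : ∀ c < I.encode.length, ∀ P : ℕ → Prop,
        (∀ i < I.encode.length, c ≤ i ∨ P i) ↔ ∀ j < c, P j := fun c hc P =>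
      ⟨fun h j hj => (h j (hj.trans hc)).resolve_left (by omega),
        fun h i _ => (le_or_gt c i).imp_right (h i)⟩
    rw [hall a ha, hall b hb]
    refine and_congr_left fun _ => or_congr_right ⟨?_, ?_⟩
    · rintro ⟨p', _, h1, a', _, b', _, h2, h3⟩
      exact ⟨p', h1, a', b', ((hR' p' h1 _ _).1 h2).2.2, h3⟩
    · rintro ⟨p', h1, a', b', h2, h3⟩
      obtain ⟨k1, k2, k3⟩ := hlt h2
      exact ⟨p', k1, h1, a', k2, b', k3, (hR' p' h1 _ _).2 ⟨k2, k3, h2⟩, h3⟩)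
  exact ⟨h1, fun p a b => (h2 p a b).trans
    ⟨fun h => h.2.2.2, fun h => ⟨(hlt h).1, (hlt h).2.1, (hlt h).2.2, h⟩⟩⟩

lemma eval_step (h : I.Sizes ρ)
    (hD : ∀ (a : Token) i, relOf D a.code [i] ↔ I.encode[i]? = some a)
    (h12 : ∀ i (hi : i < I.props.length) t, t < I.encode.length →
      (relOf D 12 [I.propPos i, t] ↔ I.template.HoldsAt t I.props[i]))
    (h13 : ∀ p a b, relOf D 13 [p, a, b] ↔ I.TransAt p a b) (hfresh : ∀ v, ¬ relOf D 14 v) :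
    (∀ t ≠ 14, relOf ((define 14 [4, 5, 6] .isStep).eval I.encode.length ρ D) t = relOf D t) ∧
    ∀ t a b, t < I.encode.length →
      (relOf ((define 14 [4, 5, 6] .isStep).eval I.encode.length ρ D) 14 [t, a, b] ↔
        I.Step t a b) := by
  have hq : I.q < I.encode.length := by rw [I.length_encode, NBAInstance.statePos]; omega
  obtain ⟨h1, h2⟩ := eval_define₃ (N := I.encode.length) (ρ := ρ) (D := D) (tag := 14)
    (x := 4) (y := 5) (z := 6) (φ := .isStep) (by decide) hfresh I.Step
    (fun t a b ht ha hb R hR hR' => by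
    have hc : ∀ (a : Token) i, R a.code [i] ↔ I.encode[i]? = some a := fun a i => by
      rw [hR _ (by have := a.code_lt; omega), hD]
    have hs := fun p i => val_propPos (I := I)
      (ρ := update (update (update (update (update ρ 4 t) 5 a) 6 b) 7 p) 8 i) (by simp [h.h0]) 8
    simp [Form.isStep, Form.tok, hc, hs, h.h2, hR 12, hR 13, h13]
    have hm : I.props.length < I.encode.length := by
      rw [I.length_encode, NBAInstance.statePos, NBAInstance.propPos]; omega
    have key : ∀ {pre d post}, I.trans = pre ++ d :: post →
        ((∀ i < I.encode.length, I.props.length ≤ i ∨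
          I.encode[I.statePos I.q + 1 + (pre.flatMap I.encodeTrans).length + 2 + d.1 + i]? =
            some (.bit true) ∧ relOf D 12 [I.propPos i, t] ∨
          ¬ I.encode[I.statePos I.q + 1 + (pre.flatMap I.encodeTrans).length + 2 + d.1 + i]? =
            some (.bit true) ∧ ¬ relOf D 12 [I.propPos i, t]) ↔
        ∀ i, i ∈ d.2.1 ↔ I.template.HoldsAt t (I.props.get i)) := by
      intro pre d post hd
      have hb := I.bit_of_eq_append hd
      constructor
      · intro h3 i
        have h4 := (h3 i (i.2.trans hm)).resolve_left (by have := i.2; omega)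
        rw [hb, h12 i i.2 t ht] at h4
        simp only [Option.some.injEq, Token.bit.injEq, decide_eq_true_eq] at h4
        rcases h4 with h4 | h4
        exacts [iff_of_true h4.1 h4.2, iff_of_false h4.1 h4.2]
      · intro h3 i _
        by_cases hi : i < I.props.length
        · right
          have h4 := hb ⟨i, hi⟩
          have h5 := h3 ⟨i, hi⟩
          dsimp only at h4
          rw [h4, h12 i hi t ht]
          simp only [Option.some.injEq, Token.bit.injEq, decide_eq_true_eq]
          rw [List.get_eq_getElem] at h5
          tauto
        · exact .inl (by omega)
    constructor
    · rintro ⟨_, _, ⟨pre, d, post, h3, rfl, rfl, rfl⟩, h4⟩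
      exact ⟨d, by simp [h3], rfl, rfl, (key h3).1 h4⟩
    · rintro ⟨d, hd, rfl, rfl, h4⟩
      obtain ⟨pre, post, h3⟩ := List.append_of_mem hd
      have h5 : I.TransAt (I.statePos I.q + 1 + (pre.flatMap I.encodeTrans).length) d.1 d.2.2 :=
        ⟨pre, d, post, h3, rfl, rfl, rfl⟩
      exact ⟨_, by have := h5.lt; omega, h5, (key h3).2 h4⟩)
  refine ⟨h1, fun t a b ht => (h2 t a b).trans ⟨fun h => h.2.2.2, fun h => ⟨ht, ?_, ?_, h⟩⟩⟩
  · obtain ⟨d, _, rfl, _⟩ := h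
    exact d.1.2.trans hq
  · obtain ⟨d, _, _, rfl, _⟩ := h
    exact d.2.2.2.trans hq

lemma initial_iff {s : ℕ} (hs : s < I.q) :
    (∃ x : Fin I.q, x = s ∧ x ∈ I.initial) ↔ I.encode[I.statePos s + 1]? = some (.bit true) := by
  have := I.occurs_encode.2.2.2.1 ⟨s, hs⟩
  simp only [Occurs.cons_iff] at this
  rw [this.2.1]
  simp only [Option.some.injEq, Token.bit.injEq, decide_eq_true_eq]
  exact ⟨fun ⟨x, h1, h2⟩ => by subst h1; exact h2, fun h => ⟨_, rfl, h⟩⟩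

lemma accepting_iff {s : ℕ} (hs : s < I.q) :
    (∃ x : Fin I.q, x = s ∧ x ∈ I.accepting) ↔ I.encode[I.statePos s + 2]? = some (.bit true) := by
  have := I.occurs_encode.2.2.2.1 ⟨s, hs⟩
  simp only [Occurs.cons_iff] at this
  rw [this.2.2.1]
  simp only [Option.some.injEq, Token.bit.injEq, decide_eq_true_eq]
  exact ⟨fun ⟨x, h1, h2⟩ => by subst h1; exact h2, fun h => ⟨_, rfl, h⟩⟩

lemma eval_lasso (h : I.Sizes ρ)
    (hD : ∀ (a : Token) i, relOf D a.code [i] ↔ I.encode[i]? = some a)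
    (hfresh : ∀ t, 8 ≤ t → ∀ v, ¬ relOf D t v) :
    (∀ t < 8, relOf (lasso.eval I.encode.length ρ D) t = relOf D t) ∧
    ∀ a, relOf (lasso.eval I.encode.length ρ D) 17 [a] ↔ a = 0 ∧ I.Yes := by
  obtain ⟨N, hN⟩ : ∃ N, N = I.encode.length := ⟨_, rfl⟩
  have hlen : N = I.statePos I.q + 1 + (I.trans.flatMap I.encodeTrans).length := by
    rw [hN, I.length_encode]
  have hq : I.q < N := by rw [hlen, NBAInstance.statePos]; omega
  have hn : I.n < N ∧ I.n * I.n < N := by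
    rw [hlen, NBAInstance.statePos, NBAInstance.propPos]
    constructor <;> omega
  have h1 : ρ 1 = N - 1 := by rw [h.h1, hN]
  simp only [lasso, eval]
  obtain ⟨a1, a2, a3⟩ := eval_separation (N := N) (ρ := ρ) (D := D) (bit := isOne I.encode)
    hn.1 h.h0 (by omega) (fun i => hD (.bit true) i)
    (fun i hi => hN ▸ (List.getElem?_eq_some_iff.1 hi).1) hfresh
  rw [hN] at a1 a2 a3
  generalize separation.eval I.encode.length ρ D = D1 at a1 a2 a3 ⊢
  obtain ⟨b1, b2⟩ := eval_trans (D := D1) h (fun a i => by rw [a1 _ a.code_lt, hD]) (a2 13 le_rfl)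
  generalize (define 13 [4, 5, 6] .isTrans).eval I.encode.length ρ D1 = D2 at b1 b2 ⊢
  obtain ⟨c1, c2⟩ := eval_step (D := D2) h
    (fun a i => by rw [b1 _ (by have := a.code_lt; omega), a1 _ a.code_lt, hD])
    (fun i hi t ht => by
      have hp := I.occurs_encode.2.1 i hi
      have := hp.lt (by simp)
      simp only [List.length_cons] at this
      rw [b1 12 (by decide), a3, bitHolds_iff I.occurs_encode.1 hp]
      exact ⟨fun h => h.2.2, fun h => ⟨by omega, ht, h⟩⟩) b2
    (by simpa only [b1 14 (by decide)] using a2 14 (by decide))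
  generalize (define 14 [4, 5, 6] .isStep).eval I.encode.length ρ D2 = D3 at c1 c2 ⊢
  have hstep : ∀ {t a b}, I.Step t a b → a < N ∧ b < N := by
    rintro t a b ⟨d, _, rfl, rfl, _⟩
    exact ⟨d.1.2.trans hq, d.2.2.2.trans hq⟩
  have hc : ∀ (a : Token) i, relOf D3 a.code [i] ↔ I.encode[i]? = some a := fun a i => by
    have := a.code_lt
    rw [c1 _ (by omega), b1 _ (by omega), a1 _ a.code_lt, hD]
  rw [← hN] at c2 ⊢
  obtain ⟨d1, d2⟩ := eval_define₂ (N := N) (ρ := ρ) (D := D3) (tag := 15) (x := 4) (y := 5)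
    (φ := .isRun) (by decide)
    (by simpa only [c1 15 (by decide), b1 15 (by decide)] using a2 15 (by decide))
    (RunTo I.Step (fun x => ∃ s : Fin I.q, s = x ∧ s ∈ I.initial))
    (fun t s ht hs R hR hR' => by
      have hs' := val_statePos (I := I) (ρ := update (update ρ 4 t) 5 s) (by simp [h.h0])
        (by simp [h.h2]) 5
      have hc' : ∀ (a : Token) i, R a.code [i] ↔ I.encode[i]? = some a := fun a i => by
        rw [hR _ (by have := a.code_lt; omega), hc]
      simp [Form.isRun, Form.conjs, Form.tok, hs', h.h3, hc', hR 14]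
      cases t with
      | zero =>
        rw [RunTo.zero_iff]
        simp only [true_and, Nat.add_eq_zero_iff, one_ne_zero, and_false, false_and, exists_false,
          or_false]
        constructor
        · rintro ⟨hs1, h2⟩
          exact (initial_iff hs1).2 h2
        · rintro h2
          have hs1 : s < I.q := by
            obtain ⟨x, rfl, _⟩ := h2
            exact x.2
          exact ⟨hs1, (initial_iff hs1).1 h2⟩
      | succ t =>
        rw [RunTo.succ_iff]
        simp only [Nat.add_eq_zero_iff, one_ne_zero, and_false, false_and, false_or,
          Nat.add_right_cancel_iff]
        constructor
        · rintro ⟨_, _, rfl, p, _, h2, h3⟩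
          exact ⟨p, ((hR' _ (Nat.lt_succ_self _) _).1 h2).2, (c2 _ _ _ (by omega)).1 h3⟩
        · rintro ⟨p, h2, h3⟩
          have hp := (hstep h3).1
          exact ⟨t, by omega, rfl, p, hp, (hR' _ (Nat.lt_succ_self _) _).2 ⟨hp, h2⟩,
            (c2 _ _ _ (by omega)).2 h3⟩)
  generalize (define 15 [4, 5] .isRun).eval N ρ D3 = D4 at d1 d2 ⊢
  obtain ⟨e1, e2⟩ := eval_closure (N := N) (ρ := ρ) (D := D4) (tag := 16)
    (base := .eq (.var 7) (.var 6)) (step := .mem 14 [.var 1, .var 9, .var 7])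
    (by simpa only [d1 16 (by decide), c1 16 (by decide), b1 16 (by decide)] using
      a2 16 (by decide))
    (fun _ s c => s < N ∧ s = c) (fun _ _ => I.Step (N - 1)) (fun _ s c h => h.2 ▸ h.1)
    (fun _ _ _ _ h => (hstep h).2)
    (fun k p q v _ _ hq _ R _ => by simp [hq, eq_comm])
    (fun k p q v j u hp hq hv hu R hR => by
      simp [h1, hR 14, d1 14]
      exact c2 _ _ _ (by omega))
  generalize (closure 16 _ _).eval N ρ D4 = D5 at e1 e2 ⊢
  obtain ⟨f1, f2⟩ := eval_define₁ (N := N) (ρ := ρ) (D := D5) (tag := 17) (x := 4) (φ := .isLasso)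
    (by simpa only [e1 17 (by decide), d1 17 (by decide), c1 17 (by decide), b1 17 (by decide)]
      using a2 17 (by decide))
    (fun a => a = 0 ∧ I.Yes) (fun a ha R hR _ => by
      have hs' := fun s f g => val_statePos (I := I)
        (ρ := update (update (update (update ρ 4 a) 5 s) 6 f) 7 g) (by simp [h.h0])
        (by simp [h.h2]) 6
      have hc' : ∀ (a : Token) i, R a.code [i] ↔ I.encode[i]? = some a := fun a i => by
        have := a.code_lt
        rw [hR _ (by omega), e1 _ (by omega), d1 _ (by omega), hc]
      simp [Form.isLasso, Form.conjs, Form.tok, Form.reach, hs', h.h3, h1, hc', hR 14, hR 15,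
        hR 16, e1 14, e1 15, d1 14]
      rintro rfl
      rw [I.yes_iff (T := N - 1) (by rw [sq]; omega)]
      constructor
      · rintro ⟨q, hq', f, hf, g, hg, k1, k2, hfq, k3, k4, k5⟩
        obtain ⟨_, ⟨_, rfl⟩, k2⟩ := (e2 _ _ _ (by omega) hq' hf).1 k2
        obtain ⟨_, ⟨_, rfl⟩, k5⟩ := (e2 _ _ _ (by omega) hg hf).1 k5
        exact ⟨q, f, g, ((d2 _ _).1 k1).2.2, k2, (accepting_iff hfq).2 k3,
          (c2 _ _ _ (by omega)).1 k4, k5⟩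
      · rintro ⟨q, f, g, k1, k2, k3, k4, k5⟩
        have hfq : f < I.q := by
          obtain ⟨x, rfl, _⟩ := k3
          exact x.2
        obtain ⟨hf, hg⟩ := hstep k4
        have hq' : q < N := by
          rcases Relation.ReflTransGen.cases_head k2 with rfl | ⟨_, k6, _⟩
          exacts [hf, (hstep k6).1]
        exact ⟨q, hq', f, hf, g, hg, (d2 _ _).2 ⟨by omega, hq', k1⟩,
          (e2 _ _ _ ha hq' hf).2 ⟨q, ⟨hq', rfl⟩, k2⟩, hfq, (accepting_iff hfq).1 k3,
          (c2 _ _ _ (by omega)).2 k4, (e2 _ _ _ ha hg hf).2 ⟨g, ⟨hg, rfl⟩, k5⟩⟩)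
  refine ⟨fun t ht => ?_, fun a => (f2 a).trans ⟨fun h => h.2, fun h => ⟨by omega, h⟩⟩⟩
  rw [f1 t (by omega), e1 t (by omega), d1 t (by omega), c1 t (by omega), b1 t (by omega), a1 t ht]

end Cmd

theorem nba_polyTimeDecidable : PolyTimeDecidable NBAInstance.encode NBAInstance.Yes := by
  refine polyTimeDecidable_of_cmd .nba (.ex 0 (.mem 17 [.var 0])) ?_ ?_ _ _ fun I => ?_
  · have hb : ∀ x ∈ Cmd.lasso.bound, x ≠ 0 ∧ x ≠ 1 ∧ x ≠ 2 ∧ x ≠ 3 := by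
      simp only [Cmd.lasso, Cmd.bound, List.mem_append]
      rintro x (h | h)
      · exact Cmd.bound_separation x h
      · simp [Cmd.bound, Cmd.closure, Cmd.define, Form.isTrans, Form.isStep, Form.isRun,
          Form.isLasso, Form.reach, Form.tok, Form.all, Form.disj, Form.eq, Form.lt,
          Form.conjs, Form.bound] at h
        refine ⟨?_, ?_, ?_, ?_⟩ <;> rintro rfl <;> simp at h
    have hp : Cmd.lasso.Proper := by
      simp [Cmd.lasso, Cmd.Proper, Cmd.proper_separation, Cmd.bound, Cmd.closure, Cmd.define,
        Form.isTrans, Form.isStep, Form.isRun, Form.isLasso, Form.reach, Form.tok, Form.all,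
        Form.disj, Form.eq, Form.lt, Form.conjs, Form.bound, Form.Proper]
    have h2 : 2 ∉ Cmd.lasso.bound := fun h => (hb _ h).2.2.1 rfl
    have h3 : 3 ∉ Cmd.lasso.bound := fun h => (hb _ h).2.2.2 rfl
    refine Cmd.proper_withSize (fun x hx => ?_) ?_
    · simp [Cmd.firstSep, Cmd.bound, Form.bound, Form.lt] at hx
      rcases hx with rfl | rfl | rfl | rfl | h
      exacts [by decide, by decide, by decide, by decide, ⟨(hb x h).1, (hb x h).2.1⟩]
    · simp [Cmd.firstSep, Cmd.Proper, Cmd.bound, Form.bound, Form.Proper, Form.lt, h2, h3, hp]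
  · simp [Form.Proper, Form.bound]
  · obtain ⟨k1, k2, k3, k4, k5, k6⟩ := I.occurs_encode
    have hsep := encodeTemplate_sep k1
    let ρ1 : Var → ℕ := Function.update (Function.update (fun _ => 0) 0 I.n) 1
      (I.encode.length - 1)
    let ρ2 := Function.update ρ1 2 I.props.length
    let ρ3 := Function.update ρ2 3 I.q
    have hm : I.props.length < I.encode.length := by
      rw [I.length_encode, NBAInstance.statePos, NBAInstance.propPos]; omega
    have hq : I.q < I.encode.length := by rw [I.length_encode, NBAInstance.statePos]; omega
    obtain ⟨h1, h2⟩ := Cmd.eval_lasso (I := I) (ρ := ρ3) (D := inputDB 0 I.encode [])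
      ⟨by simp [ρ3, ρ2, ρ1], by simp [ρ3, ρ2, ρ1], by simp [ρ3, ρ2], by simp [ρ3]⟩
      (relOf_inputDB_code _) (fun t => not_relOf_inputDB _)
    have e3 := Cmd.eval_firstSep (N := I.encode.length) (ρ := ρ2) (D := inputDB 0 I.encode [])
      (x := 3) (pos := .statePos) (p := I.statePos) (s := .lasso) (by decide)
      (fun i => by rw [Cmd.val_statePos (I := I)] <;> simp [ρ2, ρ1])
      (fun i j => by rw [Cmd.val_statePos (I := I)] <;> simp [ρ2, ρ1])
      (relOf_inputDB_code _ .sep) hq k5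
      (fun i hi => by rw [(Occurs.cons_iff.1 (k4 ⟨i, hi⟩)).1]; simp) h1
    have e2 := Cmd.eval_firstSep (N := I.encode.length) (ρ := ρ1) (D := inputDB 0 I.encode [])
      (x := 2) (pos := .propPos) (p := I.propPos) (s := .firstSep 3 .statePos .lasso) (by decide)
      (fun i => by rw [Cmd.val_propPos (I := I)] <;> simp [ρ1])
      (fun i j => by rw [Cmd.val_propPos (I := I)] <;> simp [ρ1])
      (relOf_inputDB_code _ .sep) hm k3
      (fun i hi => by rw [(Occurs.cons_iff.1 (k2 i hi)).1]; simp) (by rw [e3]; exact h1)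
    have e1 := Cmd.eval_withSize (ρ := fun _ => 0)
      (s := .firstSep 2 .propPos (.firstSep 3 .statePos .lasso)) rfl
      (relOf_inputDB_code I.encode .sep) hsep.1
      (fun i hi => by rw [hsep.2 i hi]; simp) (by rw [e2, e3]; exact h1)
    rw [Cmd.nba, e1, e2, e3]
    simp only [Form.holds_ex, Form.holds_mem, List.map_cons, List.map_nil, Term.val_var,
      Function.update_self]
    constructor
    · rintro ⟨i, _, h⟩
      exact ((h2 i).1 h).2
    · exact fun h => ⟨0, by omega, (h2 0).2 ⟨rfl, h⟩⟩

theorem mainTheorem3 :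
    PolyTimeDecidable LTLInstance.encode LTLInstance.Yes ∧
    PolyTimeDecidable NBAInstance.encode NBAInstance.Yes ∧
    ∀ (V : Type) [Fintype V] (T : DBNTemplate V), T.IsRestricted →
      ∀ (A : Set (CIProp V)) (t : ℕ), Fintype.card V ^ 2 ≤ t →
        T.trace A t = T.trace A (Fintype.card V ^ 2) :=
  ⟨ltl_polyTimeDecidable, nba_polyTimeDecidable,
    fun _ _ _ hT A _ ht => DBNTemplate.trace_eq_of_le hT A ht⟩
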